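/- **Setting.** Let $n\ge 3$ and let $M$ be a smooth $n$-manifold with a chart at infinity, i.e. a diffeomorphism $\Phi: M\setminus K\to\mathbb R^n\setminus B_R$, where $K\subseteq M$ is compact and $B_R$ is the closed ball of radius $R\ge 1$. Let $h$ be a smooth Riemannian metric on $M$ and $r:M\to(0,\infty)$ a smooth function such that $\Phi$ is an isometry from $(M\setminus K,h)$ to $(\mathbb R^n\setminus B_R,\delta)$, $\delta$ the Euclidean metric, and $r=|\Phi|$ on $M\setminus K$. Let $D$ be the covariant derivative of $h$ and $\mu_h$ its volume measure; for a function $f$, $Df$ also denotes its $h$-gradient. For $k\in\mathbb N$, $1\le p<\infty$ and $\tau\in\mathbb R$, a tensor $T$ is in $W^{k,p}_{-\tau}$ if it has weak covariant derivatives $D^{(l)}T$, $0\le l\le k$, with $\int_M r^{p(\tau+l)-n}|D^{(l)}T|_h^p\,d\mu_h<\infty$. A Riemannian metric $g$ on $M$ is *$W^{2,2}_{-\tau}$-asymptotically Euclidean* if $|g|_h$ and $|g^{-1}|_h$ are essentially bounded, $g-h\in W^{2,2}_{-\tau}$, and $C^{-1}h\le g\le Ch$ almost everywhere for some constant $C>1$.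 Its Ricci tensor $\mathrm{Ric}^g$ is given in every smooth chart by the usual formula in the Christoffel symbols of $g$ and their first derivatives, all derivatives being weak; $\mathrm{Scal}^g$ is its $g$-trace and $G^g=\mathrm{Ric}^g-\tfrac12\mathrm{Scal}^g\,g$. A *sequence of cutoff functions* is a sequence $(\chi_\alpha)_{\alpha\ge1}$ of compactly supported locally Lipschitz functions $M\to\mathbb R$ such that, for some constant $C$, $|\chi_\alpha|+r|D\chi_\alpha|_h\le C$ almost everywhere for all $\alpha$, $K\subseteq\chi_\alpha^{-1}(1)\subseteq\chi_{\alpha+1}^{-1}(1)$ for all $\alpha$, and $\bigcup_\alpha\chi_\alpha^{-1}(1)=M$. **Theorem.** Let $g$ be a $W^{2,2}_{-(n-2)/2}$-asymptotically Euclidean metric on $M$. If $\mathrm{Scal}^g\in L^1(M,\mu_h)$, then the Ricci version of the weak ADM mass of $g$ is well defined and independent of the choice of cutoff functions. That is, $\mathrm{Ric}^g$ exists in the above sense, and there is a real number $m$ such that for every sequence of cutoff functions $(\chi_\alpha)_{\alpha\ge1}$ all the integrals below converge absolutely and $$\frac{-1}{(n-1)(n-2)\,\omega_{n-1}}\ \lim_{\alpha\to\infty}\int_M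 G^g(r\,Dr,-D\chi_\alpha)\,d\mu_h=m,$$ where $\omega_{n-1}$ is the area of the unit sphere in $\mathbb R^n$. -/

import Mathlib

open Set Filter Topology MeasureTheory Bundle
open scoped Manifold ContDiff

namespace AsympEuclid

noncomputable section

/-! ### Coordinate vectors, tensor fields and their components -/

/-- The field of `(0,2)`-tensors: a bilinear form on every tangent space. -/
abbrev BilinField (n : ℕ) (M : Type*) [TopologicalSpace M]
    [ChartedSpace (EuclideanSpace ℝ (Fin n)) M] :=
  ∀ x : M, TangentSpace (𝓡 n) x →L[ℝ] TangentSpace (𝓡 n) x →L[ℝ] ℝ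

/-- Covariant tensor fields of order `m`: an `m`-linear form on every tangent space. -/
abbrev TensorField (n : ℕ) (M : Type*) [TopologicalSpace M]
    [ChartedSpace (EuclideanSpace ℝ (Fin n)) M] (m : ℕ) :=
  ∀ x : M, MultilinearMap ℝ (fun _ : Fin m => TangentSpace (𝓡 n) x) ℝ

/-- A Riemannian metric on `M` with no regularity imposed: a positive definite symmetric
bilinear form on every tangent space. -/
abbrev RoughMetric (n : ℕ) (M : Type*) [TopologicalSpace M]
    [ChartedSpace (EuclideanSpace ℝ (Fin n)) M] :=
  RiemannianMetric (fun x : M => TangentSpace (𝓡 n) x)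

/-- A smooth Riemannian metric on `M`. -/
abbrev SmoothMetric (n : ℕ) (M : Type*) [TopologicalSpace M]
    [ChartedSpace (EuclideanSpace ℝ (Fin n)) M] [IsManifold (𝓡 n) ∞ M] :=
  ContMDiffRiemannianMetric (𝓡 n) ∞ (EuclideanSpace ℝ (Fin n))
    (fun x : M => TangentSpace (𝓡 n) x)

variable {n : ℕ} {M : Type*} [TopologicalSpace M] [ChartedSpace (EuclideanSpace ℝ (Fin n)) M]

/-- A `(0,2)`-tensor field as a tensor field of order `2`. -/
def BilinField.toTensor (b : BilinField n M) : TensorField n M 2 := fun x =>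
  { toFun := fun v => b x (v 0) (v 1)
    map_update_add' := by
      intro _ v i X Y
      fin_cases i <;> simp [Function.update]
    map_update_smul' := by
      intro _ v i c X
      fin_cases i <;> simp [Function.update] }

/-- The `i`-th standard basis vector of `ℝⁿ`. -/
abbrev stdVec (i : Fin n) : EuclideanSpace ℝ (Fin n) := EuclideanSpace.single i 1

/-- A basis of the tangent space at `x` (which in Mathlib is a copy of the model space `ℝⁿ`). All
pointwise notions below that are written in this basis do not depend on the basis. -/
def tangentVec (x : M) (i : Fin n) : TangentSpace (𝓡 n) x := stdVec i

/-- The coordinate vector field `∂_i` of the chart `φ`, at the point with coordinates `y`. -/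
def coordVec (φ : OpenPartialHomeomorph M (EuclideanSpace ℝ (Fin n)))
    (y : EuclideanSpace ℝ (Fin n)) (i : Fin n) : TangentSpace (𝓡 n) (φ.symm y) :=
  mfderiv (𝓡 n) (𝓡 n) φ.symm y (stdVec i)

/-- The differential of the chart `φ` at `x`. -/
def chartDifferential (φ : OpenPartialHomeomorph M (EuclideanSpace ℝ (Fin n))) (x : M) :
    TangentSpace (𝓡 n) x →L[ℝ] EuclideanSpace ℝ (Fin n) :=
  mfderiv (𝓡 n) (𝓡 n) φ x

/-- The component `T_{I 0, …, I (m-1)}` of a tensor field in the chart `φ`. -/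
def coordComp {m : ℕ} (φ : OpenPartialHomeomorph M (EuclideanSpace ℝ (Fin n)))
    (T : TensorField n M m) (I : Fin m → Fin n) (y : EuclideanSpace ℝ (Fin n)) : ℝ :=
  T (φ.symm y) (fun a => coordVec φ y (I a))

/-- The matrix `(b_{ij})` of a `(0,2)`-tensor field in the chart `φ`. -/
def coordMatrix (φ : OpenPartialHomeomorph M (EuclideanSpace ℝ (Fin n))) (b : BilinField n M)
    (y : EuclideanSpace ℝ (Fin n)) : Matrix (Fin n) (Fin n) ℝ :=
  Matrix.of fun i j => b (φ.symm y) (coordVec φ y i) (coordVec φ y j)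

/-- The matrix of a `(0,2)`-tensor field at `x` in the basis `tangentVec x`. -/
def gram (b : BilinField n M) (x : M) : Matrix (Fin n) (Fin n) ℝ :=
  Matrix.of fun i j => b x (tangentVec x i) (tangentVec x j)

/-! ### Pointwise Riemannian geometry -/

/-- The norm `|T|_h`, where `|T|_h² = h^{i₁j₁} ⋯ h^{iₘjₘ} T_{i₁…iₘ} T_{j₁…jₘ}`. -/
def tensorNorm (h : RoughMetric n M) {m : ℕ} (T : TensorField n M m) (x : M) : ℝ :=
  Real.sqrt (∑ I : Fin m → Fin n, ∑ J : Fin m → Fin n,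
    (∏ a, (gram h.inner x)⁻¹ (I a) (J a)) *
      T x (fun a => tangentVec x (I a)) * T x (fun a => tangentVec x (J a)))

/-- The norm `|g⁻¹|_h` of the inverse metric, where
`|g⁻¹|_h² = h_{ik} h_{jl} g^{ij} g^{kl}`. -/
def inverseNorm (h g : RoughMetric n M) (x : M) : ℝ :=
  Real.sqrt (∑ i, ∑ j, ∑ k, ∑ l, gram h.inner x i k * gram h.inner x j l *
    (gram g.inner x)⁻¹ i j * (gram g.inner x)⁻¹ k l)

/-- The differential `df` of a function, as a linear form on the tangent space at `x`. -/
def differential (f : M → ℝ) (x : M) : TangentSpace (𝓡 n) x →L[ℝ] ℝ :=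
  mfderiv (𝓡 n) 𝓘(ℝ, ℝ) f x

/-- The gradient `(h^{ij} ∂_j f) ∂_i` of a function with respect to `h`. -/
def gradient (h : RoughMetric n M) (f : M → ℝ) (x : M) : TangentSpace (𝓡 n) x :=
  ∑ i, ∑ j, ((gram h.inner x)⁻¹ i j * differential f x (tangentVec x j)) • tangentVec x i

/-- The Riemannian volume measure `dμ_h`: the smallest measure on `M` that is at least
`√(det h_{ij}) dy` in every smooth chart. Since these local measures agree on overlaps, it restricts
to `√(det h_{ij}) dy` on every chart domain. -/
def riemannianMeasure [MeasurableSpace M] (h : RoughMetric n M) : Measure M :=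
  ⨆ φ ∈ IsManifold.maximalAtlas (𝓡 n) ∞ M,
    ((volume.restrict φ.target).withDensity
      (fun y => ENNReal.ofReal (Real.sqrt (coordMatrix φ h.inner y).det))).map φ.symm

/-- The symbols `Γ^k_{ij} = ½ G^{kl} (∂_i G_{jl} + ∂_j G_{il} - ∂_l G_{ij})`, where `dG i` is the
matrix `∂_i G`. -/
def christoffel (G : Matrix (Fin n) (Fin n) ℝ) (dG : Fin n → Matrix (Fin n) (Fin n) ℝ)
    (k i j : Fin n) : ℝ :=
  (1 / 2) * ∑ l, G⁻¹ k l * (dG i j l + dG j i l - dG l i j)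

/-- The Christoffel symbols `Γ^k_{ij}` of a smooth metric `h` in the chart `φ`. -/
def smoothChristoffel (φ : OpenPartialHomeomorph M (EuclideanSpace ℝ (Fin n)))
    (h : RoughMetric n M) (y : EuclideanSpace ℝ (Fin n)) (k i j : Fin n) : ℝ :=
  christoffel (coordMatrix φ h.inner y)
    (fun a => Matrix.of fun b c =>
      fderiv ℝ (fun z => coordMatrix φ h.inner z b c) y (stdVec a)) k i j

/-! ### Weak derivatives -/

/-- On the open set `Ω ⊆ ℝⁿ`, `v` is the weak partial derivative `∂_i u`. -/
def IsWeakPartial (Ω : Set (EuclideanSpace ℝ (Fin n))) (i : Fin n)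
    (u v : EuclideanSpace ℝ (Fin n) → ℝ) : Prop :=
  LocallyIntegrableOn u Ω ∧ LocallyIntegrableOn v Ω ∧
    ∀ η : EuclideanSpace ℝ (Fin n) → ℝ, ContDiff ℝ ∞ η → HasCompactSupport η → tsupport η ⊆ Ω →
      ∫ y, u y * fderiv ℝ η y (stdVec i) = - ∫ y, v y * η y

/-- `T'` is the weak covariant derivative `DT` of the tensor field `T` with respect to the smooth
metric `h`, the new index standing first. In every smooth chart this says that, in the weak sense,
`∂_k T_I = (DT)_{kI} + ∑_a Γ^l_{k I_a} T_{I_0 … l … I_{m-1}}` (with `l` in place of `I_a`). -/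
def IsWeakCovDeriv (h : RoughMetric n M) {m : ℕ}
    (T : TensorField n M m) (T' : TensorField n M (m + 1)) : Prop :=
  ∀ φ ∈ IsManifold.maximalAtlas (𝓡 n) ∞ M, ∀ (k : Fin n) (I : Fin m → Fin n),
    IsWeakPartial φ.target k (coordComp φ T I)
      (fun y => coordComp φ T' (Fin.cons k I) y +
        ∑ a, ∑ l, smoothChristoffel φ h y l k (I a) * coordComp φ T (Function.update I a l) y)

variable (n) in
/-- A function on `M` that is locally Lipschitz in every smooth chart. -/
def IsLocallyLipschitz (f : M → ℝ) : Prop :=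
  ∀ φ ∈ IsManifold.maximalAtlas (𝓡 n) ∞ M, LocallyLipschitzOn φ.target (f ∘ φ.symm)

/-! ### Curvature of a metric in `W^{2,2}_loc` -/

/-- `Ric` is the Ricci tensor of `g` in the weak sense: in every smooth chart `g_{ij}` has
weak first derivatives, the Christoffel symbols formed with them have weak first derivatives, and
`Ric_{ij} = ∂_k Γ^k_{ij} - ∂_j Γ^k_{ik} + Γ^k_{kl} Γ^l_{ij} - Γ^k_{jl} Γ^l_{ik}` almost
everywhere. -/
def IsRicciTensor (g : RoughMetric n M) (Ric : BilinField n M) : Prop :=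
  ∀ φ ∈ IsManifold.maximalAtlas (𝓡 n) ∞ M,
    ∃ (dG : Fin n → EuclideanSpace ℝ (Fin n) → Matrix (Fin n) (Fin n) ℝ)
      (dΓ : Fin n → Fin n → Fin n → Fin n → EuclideanSpace ℝ (Fin n) → ℝ),
      let Γ : Fin n → Fin n → Fin n → EuclideanSpace ℝ (Fin n) → ℝ := fun k i j y =>
        christoffel (coordMatrix φ g.inner y) (fun a => dG a y) k i j
      (∀ a i j, IsWeakPartial φ.target a (fun y => coordMatrix φ g.inner y i j)
        (fun y => dG a y i j)) ∧
      (∀ a k i j, IsWeakPartial φ.target a (Γ k i j) (dΓ a k i j)) ∧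
      ∀ i j, ∀ᵐ y ∂(volume.restrict φ.target), coordMatrix φ Ric y i j =
        ∑ k, (dΓ k k i j y - dΓ j k i k y) +
          ∑ k, ∑ l, (Γ k k l y * Γ l i j y - Γ k j l y * Γ l i k y)

open Classical in
/-- The Ricci tensor `Ric^g` (determined up to a null set), for a metric which has one in the
weak sense. -/
def ricciTensor (g : RoughMetric n M) : BilinField n M :=
  if H : ∃ Ric : BilinField n M, IsRicciTensor g Ric then H.choose else fun _ => 0

/-- The scalar curvature `Scal^g = g^{ij} Ric_{ij}`. -/
def scalarCurvature (g : RoughMetric n M) (x : M) : ℝ :=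
  ∑ i, ∑ j, (gram g.inner x)⁻¹ i j * gram (ricciTensor g) x i j

/-- The Einstein tensor `G^g = Ric^g - ½ Scal^g g`. -/
def einsteinTensor (g : RoughMetric n M) : BilinField n M := fun x =>
  ricciTensor g x - (scalarCurvature g x / 2) • g.inner x

/-! ### Reference manifolds and weighted spaces -/

variable (n M) in
/-- A reference manifold: a chart at infinity `Φ : M \ K → ℝⁿ \ B_R`, a diffeomorphism, where `K` is
compact and `B_R` is the closed ball of radius `R ≥ 1`. -/
structure ReferenceManifold [IsManifold (𝓡 n) ∞ M] where
  K : Set M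
  isCompact_K : IsCompact K
  R : ℝ
  one_le_R : 1 ≤ R
  Φ : OpenPartialHomeomorph M (EuclideanSpace ℝ (Fin n))
  Φ_mem : Φ ∈ IsManifold.maximalAtlas (𝓡 n) ∞ M
  source_Φ : Φ.source = Kᶜ
  target_Φ : Φ.target = (Metric.closedBall 0 R)ᶜ

variable [IsManifold (𝓡 n) ∞ M]

/-- A background metric structure `(h, r)`: a smooth metric `h` and a smooth function
`r : M → (0,∞)` such that on `M \ K` the chart at infinity is an isometry to the Euclidean metric
and `r = |Φ|`. -/
structure BackgroundStructure (P : ReferenceManifold n M) where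
  smoothMetric : SmoothMetric n M
  r : M → ℝ
  contMDiff_r : ContMDiff (𝓡 n) 𝓘(ℝ, ℝ) ∞ r
  r_pos : ∀ x, 0 < r x
  isometry_Φ : ∀ x, x ∉ P.K → ∀ v w : TangentSpace (𝓡 n) x,
    smoothMetric.inner x v w =
      inner ℝ (chartDifferential P.Φ x v) (chartDifferential P.Φ x w)
  r_eq : ∀ x, x ∉ P.K → r x = ‖P.Φ x‖

variable {P : ReferenceManifold n M}

/-- The background metric `h`. -/
def BackgroundStructure.h (B : BackgroundStructure P) : RoughMetric n M :=
  B.smoothMetric.toRiemannianMetric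

variable [MeasurableSpace M]

/-- The background volume measure `dμ_h`. -/
def BackgroundStructure.μ (B : BackgroundStructure P) : Measure M := riemannianMeasure B.h

/-- `T ∈ L^p_{-τ}`: for `p < ∞`, `∫ r^{pτ-n} |T|_h^p dμ_h < ∞`, that is, `r^{τ-n/p} |T|_h ∈ L^p`;
for `p = ∞`, `r^τ |T|_h` is essentially bounded (here `p.toReal = 0`, so that `n / p.toReal = 0`).
As `r` is continuous and positive, such a `T` lies in `L^p_loc`. -/
def MemWeightedLp (B : BackgroundStructure P) (p : ENNReal) (τ : ℝ) {m : ℕ}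
    (T : TensorField n M m) : Prop :=
  (∀ φ ∈ IsManifold.maximalAtlas (𝓡 n) ∞ M, ∀ I : Fin m → Fin n,
    AEStronglyMeasurable (coordComp φ T I) (volume.restrict φ.target)) ∧
  MemLp (fun x => B.r x ^ (τ - n / p.toReal) * tensorNorm B.h T x) p B.μ

/-- `T ∈ W^{k,p}_{-τ}`: `T` has weak covariant derivatives `D^{(l)} T ∈ L^p_{-τ-l}` for
`0 ≤ l ≤ k`. -/
def MemWeightedSobolev (B : BackgroundStructure P) (k : ℕ) (p : ENNReal) (τ : ℝ) {m : ℕ}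
    (T : TensorField n M m) : Prop :=
  ∃ S : ∀ l : ℕ, TensorField n M (m + l),
    S 0 = T ∧ (∀ l < k, IsWeakCovDeriv B.h (S l) (S (l + 1))) ∧
      ∀ l ≤ k, MemWeightedLp B p (τ + l) (S l)

/-- `g` is `W^{k,p}_{-τ}`-asymptotically Euclidean. -/
structure IsAsymptoticallyEuclidean (B : BackgroundStructure P) (k : ℕ) (p : ENNReal) (τ : ℝ)
    (g : RoughMetric n M) : Prop where
  metric_bounded : MemWeightedLp B ⊤ 0 (BilinField.toTensor g.inner)
  inverse_bounded : MemLp (inverseNorm B.h g) ⊤ B.μ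
  error_mem : MemWeightedSobolev B k p τ
    (BilinField.toTensor fun x => g.inner x - B.h.inner x)
  equivalent : ∃ C : ℝ, 1 < C ∧ ∀ᵐ x ∂B.μ, ∀ v : TangentSpace (𝓡 n) x,
    C⁻¹ * B.h.inner x v v ≤ g.inner x v v ∧ g.inner x v v ≤ C * B.h.inner x v v

/-- A sequence of cutoff functions: compactly supported, locally Lipschitz, bounded in
`W^{1,∞}_0`, with sets `{χ_α = 1}` that contain `K`, increase with `α` and exhaust `M`. -/
structure IsCutoffSequence (B : BackgroundStructure P) (χ : ℕ → M → ℝ) : Prop where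
  compactSupport : ∀ α, HasCompactSupport (χ α)
  locallyLipschitz : ∀ α, IsLocallyLipschitz n (χ α)
  bounded : ∃ C : ℝ, ∀ α, ∀ᵐ x ∂B.μ, |χ α x| + B.r x *
    Real.sqrt (B.h.inner x (gradient B.h (χ α) x) (gradient B.h (χ α) x)) ≤ C
  subset_one : ∀ α, P.K ⊆ {x | χ α x = 1}
  monotone_one : ∀ α, {x | χ α x = 1} ⊆ {x | χ (α + 1) x = 1}
  exhaust : ⋃ α, {x | χ α x = 1} = univ

/-- The integrand `G^g(r Dr, -Dχ)`. -/
def ricciMassIntegrand (B : BackgroundStructure P) (g : RoughMetric n M) (χ : M → ℝ) (x : M) : ℝ :=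
  einsteinTensor g x (B.r x • gradient B.h B.r x) (-gradient B.h χ x)

/-- `ω_{n-1}`, the area of the unit sphere in `ℝⁿ`. -/
def sphereArea (n : ℕ) : ℝ := ((volume : Measure (EuclideanSpace ℝ (Fin n))).toSphere univ).toReal

/-- The Ricci version of the weak ADM mass of `g` with respect to the cutoff functions `χ` exists
(integrals converging absolutely, with a finite limit) and equals `m`. -/
def HasRicciMass (B : BackgroundStructure P) (g : RoughMetric n M) (χ : ℕ → M → ℝ) (m : ℝ) :
    Prop :=
  (∀ α, Integrable (ricciMassIntegrand B g (χ α)) B.μ) ∧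
  Tendsto (fun α => -1 / (((n : ℝ) - 1) * ((n : ℝ) - 2) * sphereArea n) *
    ∫ x, ricciMassIntegrand B g (χ α) x ∂B.μ) atTop (𝓝 m)

end

end AsympEuclid

open AsympEuclid

set_option linter.unusedSectionVars false

/-! The decay rate is exactly critical. With `τ = (n-2)/2` and `p = 2` the weighted norms say that
in the chart at infinity, where `h` is Euclidean, `|y|⁻¹(g - δ)`, `∂g` and `|y| ∂²g` are square
integrable. Hence products `∂g · ∂g` and `(g - δ) · ∂²g` are integrable by Cauchy–Schwarz, and the
Ricci tensor differs from its linearisation at `δ` by an integrable error. Integrability of the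
scalar curvature then gives integrability of the linearised scalar curvature, so the Einstein tensor
also equals its linearisation `L` up to an integrable error (`HasDecay.integrable_einstein_sub`).

The field `r Dr` is the position field `y`, so up to sign the mass integral is the integral of
`G_{ij} y^i ∂_j χ`. Since `|y| |∂χ|` is bounded and `∂χ_α` eventually vanishes at almost every point
(`fderiv_eq_zero_ae_of_level`), the integrable error contributes nothing in the limit. The remaining
`L` is divergence free, by the linearised Bianchi identity (`linEinstein_divergence_free`), and `∂_j
y^i = δ_{ij}`. Integrating by parts therefore turns `L_{ij} y^i ∂_j χ` into minus the trace of `L`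
times `χ`, plus a term on a fixed bounded region due to cutting off near the inner boundary. The
trace is `(1 - n/2)` times the linearised scalar curvature (`sum_linEinstein`), hence integrable.
Letting `χ_α` tend to `1` gives a limit that does not involve the sequence (`exists_tendsto_mass`).

For the Ricci tensor to exist, the Christoffel symbols need weak derivatives. In charts `g` is
bounded, uniformly positive on compact sets and has two `L²_loc` derivatives. So `g⁻¹` is bounded
with an `L²_loc` derivative (`IsWeakPartial.inv_entry`), and the product rule (`IsWeakPartial.mul`)
applies to `g⁻¹ ∂g`. Both are proved by mollification. The local Ricci matrices satisfy the tensor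
transformation law almost everywhere (`HasWeakCurvature.ricciForm_comp`), which rests on a weak
chain rule and uniqueness of weak derivatives. A countable atlas then glues them into one tensor
field (`exists_isRicciTensor`).

Finally, the volume measure, defined as a supremum over charts, has to be identified with Lebesgue
measure on the end (`riemannianMeasure_restrict`), so that integrals over `M` become integrals over
the exterior of a ball. -/

namespace AsympEuclid

noncomputable section

section

/-! ### Weak partial derivatives -/

/-- The model space. -/
abbrev Euc (n : ℕ) := EuclideanSpace ℝ (Fin n)

variable {n : ℕ} {Ω : Set (Euc n)} {i : Fin n} {u v : Euc n → ℝ}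

/-- Smooth functions with compact support in `Ω`. -/
structure IsTest (Ω : Set (Euc n)) (η : Euc n → ℝ) : Prop where
  smooth : ContDiff ℝ ∞ η
  compact : HasCompactSupport η
  subset : tsupport η ⊆ Ω

/-- The `i`-th partial derivative. -/
def pd (i : Fin n) (u : Euc n → ℝ) (y : Euc n) : ℝ := fderiv ℝ u y (stdVec i)

theorem integrable_mul_of_hasCompactSupport (hu : LocallyIntegrableOn u Ω)
    {g : Euc n → ℝ} (hg : Continuous g) (hc : HasCompactSupport g) (hs : tsupport g ⊆ Ω) :
    Integrable fun y => u y * g y := by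
  have h1 : IntegrableOn u (tsupport g) := hu.integrableOn_compact_subset hs hc
  have h2 : IntegrableOn (fun y => u y * g y) (tsupport g) :=
    h1.mul_continuousOn hg.continuousOn hc
  rwa [integrableOn_iff_integrable_of_support_subset] at h2
  intro y hy
  exact subset_tsupport g (right_ne_zero_of_mul hy)

theorem pd_continuous {η : Euc n → ℝ} (h : ContDiff ℝ ∞ η) (i : Fin n) : Continuous (pd i η) :=
  (h.continuous_fderiv (by simp)).clm_apply continuous_const

theorem pd_contDiff {η : Euc n → ℝ} (h : ContDiff ℝ ∞ η) (i : Fin n) : ContDiff ℝ ∞ (pd i η) :=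
  (h.fderiv_right (m := ∞) (by simp)).clm_apply contDiff_const

theorem pd_contDiffOn (hΩ : IsOpen Ω) {a : Euc n → ℝ} (h : ContDiffOn ℝ ∞ a Ω) (i : Fin n) :
    ContDiffOn ℝ ∞ (pd i a) Ω :=
  (h.fderiv_of_isOpen hΩ (m := ∞) (by simp)).clm_apply contDiffOn_const

theorem tsupport_pd_subset (η : Euc n → ℝ) (i : Fin n) : tsupport (pd i η) ⊆ tsupport η :=
  tsupport_fderiv_apply_subset ℝ (stdVec i)

theorem IsTest.pd {η : Euc n → ℝ} (h : IsTest Ω η) (i : Fin n) : IsTest Ω (pd i η) :=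
  ⟨pd_contDiff h.smooth i, h.compact.mono' (subset_closure.trans (tsupport_pd_subset η i)),
    (tsupport_pd_subset η i).trans h.subset⟩

theorem IsTest.integrable_mul {η : Euc n → ℝ} (h : IsTest Ω η)
    (hu : LocallyIntegrableOn u Ω) : Integrable fun y => u y * η y :=
  integrable_mul_of_hasCompactSupport hu h.smooth.continuous h.compact h.subset

theorem IsTest.integrable_mul_pd {η : Euc n → ℝ} (h : IsTest Ω η)
    (hu : LocallyIntegrableOn u Ω) (i : Fin n) :
    Integrable fun y => u y * fderiv ℝ η y (stdVec i) :=
  (h.pd i).integrable_mul hu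

theorem IsTest.smul {η a : Euc n → ℝ} (h : IsTest Ω η) (hΩ : IsOpen Ω)
    (ha : ContDiffOn ℝ ∞ a Ω) : IsTest Ω (fun y => a y * η y) := by
  have hsub : tsupport (fun y => a y * η y) ⊆ tsupport η := tsupport_mul_subset_right
  refine ⟨?_, h.compact.mul_left, hsub.trans h.subset⟩
  refine contDiff_iff_contDiffAt.2 fun y => ?_
  by_cases hy : y ∈ tsupport η
  · exact (ha.contDiffAt (hΩ.mem_nhds (h.subset hy))).mul h.smooth.contDiffAt
  · have : (fun y => a y * η y) =ᶠ[𝓝 y] fun _ => 0 := by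
      filter_upwards [(isClosed_tsupport η).isOpen_compl.mem_nhds hy] with z hz
      simp [image_eq_zero_of_notMem_tsupport hz]
    exact contDiffAt_const.congr_of_eventuallyEq this

theorem IsTest.mono {η : Euc n → ℝ} {Ω' : Set (Euc n)} (h : IsTest Ω' η) (hs : Ω' ⊆ Ω) :
    IsTest Ω η := ⟨h.smooth, h.compact, h.subset.trans hs⟩

theorem IsWeakPartial.integral_eq (h : IsWeakPartial Ω i u v) {η : Euc n → ℝ} (hη : IsTest Ω η) :
    ∫ y, u y * fderiv ℝ η y (stdVec i) = - ∫ y, v y * η y :=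
  h.2.2 η hη.smooth hη.compact hη.subset

theorem IsWeakPartial.of_test (hu : LocallyIntegrableOn u Ω) (hv : LocallyIntegrableOn v Ω)
    (h : ∀ η, IsTest Ω η → ∫ y, u y * fderiv ℝ η y (stdVec i) = - ∫ y, v y * η y) :
    IsWeakPartial Ω i u v :=
  ⟨hu, hv, fun η h1 h2 h3 => h η ⟨h1, h2, h3⟩⟩

theorem IsWeakPartial.mono (h : IsWeakPartial Ω i u v) {Ω' : Set (Euc n)} (hs : Ω' ⊆ Ω) :
    IsWeakPartial Ω' i u v :=
  .of_test (h.1.mono_set hs) (h.2.1.mono_set hs) fun _ hη => h.integral_eq (hη.mono hs)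

theorem IsWeakPartial.add {u' v' : Euc n → ℝ} (h : IsWeakPartial Ω i u v)
    (h' : IsWeakPartial Ω i u' v') :
    IsWeakPartial Ω i (fun y => u y + u' y) (fun y => v y + v' y) := by
  refine .of_test (h.1.add h'.1) (h.2.1.add h'.2.1) fun η hη => ?_
  simp only [add_mul]
  rw [integral_add (hη.integrable_mul_pd h.1 i) (hη.integrable_mul_pd h'.1 i),
    integral_add (hη.integrable_mul h.2.1) (hη.integrable_mul h'.2.1),
    h.integral_eq hη, h'.integral_eq hη]
  ring

theorem IsWeakPartial.zero : IsWeakPartial Ω i (fun _ => 0) (fun _ => 0) :=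
  .of_test (locallyIntegrable_zero.locallyIntegrableOn _)
    (locallyIntegrable_zero.locallyIntegrableOn _) (by simp)

theorem IsWeakPartial.sum {ι : Type*} (s : Finset ι) {U V : ι → Euc n → ℝ}
    (h : ∀ a ∈ s, IsWeakPartial Ω i (U a) (V a)) :
    IsWeakPartial Ω i (fun y => ∑ a ∈ s, U a y) (fun y => ∑ a ∈ s, V a y) := by
  classical
  induction s using Finset.induction_on with
  | empty => simpa using IsWeakPartial.zero
  | insert a s ha ih =>
    simp only [Finset.sum_insert ha]
    exact (h a (by simp)).add (ih fun b hb => h b (by simp [hb]))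

theorem LocallyIntegrableOn.congr_ae_restrict (hΩ : IsOpen Ω) (h : LocallyIntegrableOn u Ω)
    (huv : u =ᵐ[volume.restrict Ω] v) : LocallyIntegrableOn v Ω := by
  rw [locallyIntegrableOn_iff hΩ.isLocallyClosed] at h ⊢
  exact fun k hk hc => (h k hk hc).congr (ae_restrict_of_ae_restrict_of_subset hk huv)

theorem integral_mul_congr_of_ae_restrict (hΩ : IsOpen Ω) (huv : u =ᵐ[volume.restrict Ω] v)
    {g : Euc n → ℝ} (hg : tsupport g ⊆ Ω) : ∫ y, u y * g y = ∫ y, v y * g y := by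
  rw [Filter.EventuallyEq, ae_restrict_iff' hΩ.measurableSet] at huv
  refine integral_congr_ae ?_
  filter_upwards [huv] with y hy
  by_cases h : y ∈ Ω
  · rw [hy h]
  · simp [image_eq_zero_of_notMem_tsupport fun h' => h (hg h')]

theorem IsWeakPartial.congr (hΩ : IsOpen Ω) (h : IsWeakPartial Ω i u v) {u' v' : Euc n → ℝ}
    (hu : u =ᵐ[volume.restrict Ω] u') (hv : v =ᵐ[volume.restrict Ω] v') :
    IsWeakPartial Ω i u' v' := by
  refine .of_test (LocallyIntegrableOn.congr_ae_restrict hΩ h.1 hu)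
    (LocallyIntegrableOn.congr_ae_restrict hΩ h.2.1 hv) fun η hη => ?_
  rw [← integral_mul_congr_of_ae_restrict hΩ hv hη.subset, ← h.integral_eq hη]
  exact (integral_mul_congr_of_ae_restrict hΩ hu (hη.pd i).subset).symm

/-- The fundamental lemma of the calculus of variations. It makes weak derivatives unique and turns
identities tested against smooth functions into almost everywhere identities. -/
theorem ae_eq_of_forall_test (hΩ : IsOpen Ω) (hu : LocallyIntegrableOn u Ω)
    (hv : LocallyIntegrableOn v Ω)
    (h : ∀ η, IsTest Ω η → ∫ y, u y * η y = ∫ y, v y * η y) : u =ᵐ[volume.restrict Ω] v := by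
  have := hΩ.ae_eq_zero_of_integral_contDiff_smul_eq_zero (hu.sub hv) (μ := volume)
    fun η h1 h2 h3 => by
      have hη : IsTest Ω η := ⟨h1, h2, h3⟩
      have : ∀ y, η y • (u - v) y = u y * η y - v y * η y := fun y => by
        simp only [Pi.sub_apply, smul_eq_mul]; ring
      simp only [this]
      rw [integral_sub (hη.integrable_mul hu) (hη.integrable_mul hv), h η hη, sub_self]
  rw [Filter.EventuallyEq, ae_restrict_iff' hΩ.measurableSet]
  filter_upwards [this] with y hy hy'
  exact sub_eq_zero.1 (hy hy')

/-- Weak partial derivatives are unique. -/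
theorem IsWeakPartial.ae_unique (hΩ : IsOpen Ω) {u' v' : Euc n → ℝ} (h : IsWeakPartial Ω i u v)
    (h' : IsWeakPartial Ω i u' v') (huu : u =ᵐ[volume.restrict Ω] u') :
    v =ᵐ[volume.restrict Ω] v' := by
  refine ae_eq_of_forall_test hΩ h.2.1 h'.2.1 fun η hη => ?_
  rw [← neg_inj, ← h.integral_eq hη, ← h'.integral_eq hη]
  exact integral_mul_congr_of_ae_restrict hΩ huu (hη.pd i).subset

theorem pd_mul {a b : Euc n → ℝ} {y : Euc n} (ha : DifferentiableAt ℝ a y)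
    (hb : DifferentiableAt ℝ b y) :
    pd i (fun z => a z * b z) y = pd i a y * b y + a y * pd i b y := by
  unfold pd
  rw [fderiv_fun_mul ha hb]
  simp [smul_eq_mul]
  ring

/-- The product rule for a smooth function and a weakly differentiable one. -/
theorem IsWeakPartial.smooth_mul (hΩ : IsOpen Ω) (h : IsWeakPartial Ω i u v) {a : Euc n → ℝ}
    (ha : ContDiffOn ℝ ∞ a Ω) :
    IsWeakPartial Ω i (fun y => a y * u y) (fun y => pd i a y * u y + a y * v y) := by
  have hda := (pd_contDiffOn hΩ ha i).continuousOn
  have e1 := h.1.continuousOn_mul ha.continuousOn hΩ.isLocallyClosed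
  have e2 := h.1.continuousOn_mul hda hΩ.isLocallyClosed
  have e3 := h.2.1.continuousOn_mul ha.continuousOn hΩ.isLocallyClosed
  refine .of_test e1 (e2.add e3) fun η hη => ?_
  have ht := hη.smul hΩ ha
  have key := h.integral_eq ht
  -- The Leibniz rule read backwards. Since `a` is controlled only on `Ω`, points outside are
  -- treated separately: there every term vanishes because of the supports.
  have hpt : ∀ y, a y * u y * fderiv ℝ η y (stdVec i) =
      u y * fderiv ℝ (fun y => a y * η y) y (stdVec i) - pd i a y * u y * η y := by
    intro y
    by_cases hy : y ∈ Ω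
    · have := pd_mul (i := i) ((ha.contDiffAt (hΩ.mem_nhds hy)).differentiableAt (by simp))
        (hη.smooth.differentiable (by simp) y)
      simp only [pd] at this ⊢
      rw [this]; ring
    · have h1 : y ∉ tsupport η := fun h' => hy (hη.subset h')
      have h2 := image_eq_zero_of_notMem_tsupport fun h' => hy ((hη.pd i).subset h')
      have h3 := image_eq_zero_of_notMem_tsupport fun h' => hy ((ht.pd i).subset h')
      simp only [pd] at h2 h3
      rw [h2, h3, image_eq_zero_of_notMem_tsupport h1]; ring
  simp only [hpt]
  rw [integral_sub (ht.integrable_mul_pd h.1 i) (hη.integrable_mul e2), key]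
  have : ∀ y, (pd i a y * u y + a y * v y) * η y = pd i a y * u y * η y + v y * (a y * η y) :=
    fun y => by ring
  simp only [this]
  rw [integral_add (hη.integrable_mul e2) (ht.integrable_mul h.2.1)]
  ring

theorem locallyIntegrableOn_of_continuousOn (hΩ : IsOpen Ω) (h : ContinuousOn u Ω) :
    LocallyIntegrableOn u Ω := h.locallyIntegrableOn hΩ.measurableSet

theorem integral_pd_eq_zero {ζ : Euc n → ℝ} (h : ContDiff ℝ ∞ ζ) (hc : HasCompactSupport ζ)
    (i : Fin n) : ∫ y, pd i ζ y = 0 := by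
  have hc' : HasCompactSupport (pd i ζ) :=
    hc.mono' (subset_closure.trans (tsupport_pd_subset ζ i))
  have h1 := (pd_continuous h i).integrable_of_hasCompactSupport hc' (μ := volume)
  have h2 := h.continuous.integrable_of_hasCompactSupport hc (μ := volume)
  have := integral_mul_fderiv_eq_neg_fderiv_mul_of_integrable (μ := (volume : Measure (Euc n)))
    (f := fun _ => (1 : ℝ)) (g := ζ) (v := stdVec i) (by simp) (by simp only [one_mul]; exact h1)
    (by simpa using h2) (fun _ _ => by simp) (fun x _ => h.differentiable (by simp) x)
  simpa [pd] using this

/-- Smooth functions are weakly differentiable. -/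
theorem IsWeakPartial.of_contDiffOn (hΩ : IsOpen Ω) {a : Euc n → ℝ} (ha : ContDiffOn ℝ ∞ a Ω) :
    IsWeakPartial Ω i a (pd i a) := by
  -- The product rule with the constant function `1` as weakly differentiable factor gives the
  -- general case.
  have h1 : IsWeakPartial Ω i (fun _ => (1 : ℝ)) (fun _ => 0) := by
    refine .of_test (locallyIntegrableOn_of_continuousOn hΩ continuousOn_const)
      (locallyIntegrableOn_of_continuousOn hΩ continuousOn_const) fun η hη => ?_
    simpa [pd] using integral_pd_eq_zero hη.smooth hη.compact i
  simpa using h1.smooth_mul hΩ ha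

theorem IsWeakPartial.const_mul (hΩ : IsOpen Ω) (h : IsWeakPartial Ω i u v) (c : ℝ) :
    IsWeakPartial Ω i (fun y => c * u y) (fun y => c * v y) := by
  have := h.smooth_mul hΩ (a := fun _ => c) contDiffOn_const
  simpa [pd] using this

theorem IsWeakPartial.neg (hΩ : IsOpen Ω) (h : IsWeakPartial Ω i u v) :
    IsWeakPartial Ω i (fun y => -u y) (fun y => -v y) := by
  simpa using h.const_mul hΩ (-1)

theorem IsWeakPartial.sub (hΩ : IsOpen Ω) {u' v' : Euc n → ℝ} (h : IsWeakPartial Ω i u v)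
    (h' : IsWeakPartial Ω i u' v') :
    IsWeakPartial Ω i (fun y => u y - u' y) (fun y => v y - v' y) := by
  simpa [sub_eq_add_neg] using h.add (h'.neg hΩ)

end

section

open scoped NNReal Convolution

variable {n : ℕ} {Ω : Set (Euc n)} {i : Fin n} {u v : Euc n → ℝ}

/-! ### Mollification -/

theorem exists_isTest_one_nhds (hΩ : IsOpen Ω) {K : Set (Euc n)} (hK : IsCompact K) (hs : K ⊆ Ω) :
    ∃ θ : Euc n → ℝ, IsTest Ω θ ∧ (∀ᶠ y in 𝓝ˢ K, θ y = 1) ∧ ∀ y, θ y ∈ Icc (0 : ℝ) 1 := by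
  obtain ⟨K', hK', h1, h2⟩ := exists_compact_between hK hΩ hs
  obtain ⟨θ, hθ1, hθ0, hθ⟩ := exists_contMDiffMap_one_nhds_of_subset_interior (n := (⊤ : ℕ∞))
    (𝓘(ℝ, Euc n)) hK.isClosed h1
  have hsub : tsupport θ ⊆ K' := by
    refine closure_minimal (fun y hy => ?_) hK'.isClosed
    by_contra h
    exact hy (hθ0 y h)
  exact ⟨θ, ⟨θ.contMDiff.contDiff, HasCompactSupport.of_support_subset_isCompact hK'
    (subset_closure.trans hsub), hsub.trans h2⟩, hθ1, hθ⟩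

/-- A shrinking sequence of bump functions. -/
def bump (n k : ℕ) : ContDiffBump (0 : Euc n) where
  rIn := 1 / (k + 1)
  rOut := 2 / (k + 1)
  rIn_pos := by positivity
  rIn_lt_rOut := by gcongr; norm_num

theorem bump_rOut_tendsto : Tendsto (fun k => (bump n k).rOut) atTop (𝓝 0) := by
  have := (tendsto_one_div_add_atTop_nhds_zero_nat (𝕜 := ℝ)).const_mul 2
  simpa [bump, div_eq_mul_inv] using this

/-- The mollifications of a function. -/
def moll (k : ℕ) (f : Euc n → ℝ) : Euc n → ℝ :=
  (bump n k).normed volume ⋆[ContinuousLinearMap.lsmul ℝ ℝ, volume] f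

theorem moll_apply (k : ℕ) (f : Euc n → ℝ) (x : Euc n) :
    moll k f x = ∫ t, (bump n k).normed volume t * f (x - t) := rfl

theorem moll_apply' (k : ℕ) (f : Euc n → ℝ) (x : Euc n) :
    moll k f x = ∫ t, (bump n k).normed volume (x - t) * f t := by
  unfold moll
  rw [convolution_lsmul_swap]; rfl

theorem moll_contDiff (k : ℕ) {f : Euc n → ℝ} (hf : LocallyIntegrable f) :
    ContDiff ℝ ∞ (moll k f) :=
  (bump n k).hasCompactSupport_normed.contDiff_convolution_left _
    (bump n k).contDiff_normed hf

theorem moll_ae_tendsto {f : Euc n → ℝ} (hf : LocallyIntegrable f) :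
    ∀ᵐ x, Tendsto (fun k => moll k f x) atTop (𝓝 (f x)) := by
  -- The constant `2` is the fixed ratio of outer to inner radius; bounded eccentricity of the
  -- kernels is what Lebesgue differentiation needs.
  refine ContDiffBump.ae_convolution_tendsto_right_of_locallyIntegrable (K := 2)
    bump_rOut_tendsto (Eventually.of_forall fun k => le_of_eq ?_) hf
  simp [bump]; ring

theorem moll_integrable (k : ℕ) {f : Euc n → ℝ} (hf : LocallyIntegrable f) (x : Euc n) :
    Integrable fun t => (bump n k).normed volume (x - t) * f t := by
  have hc : HasCompactSupport fun t => (bump n k).normed volume (x - t) :=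
    (bump n k).hasCompactSupport_normed.comp_homeomorph (Homeomorph.subLeft x)
  have := hf.integrable_smul_left_of_hasCompactSupport
    ((bump n k).continuous_normed.comp (continuous_const.sub continuous_id)) hc
  exact this

theorem moll_sum (k : ℕ) {ι : Type*} (s : Finset ι) (c : ι → ℝ) {f : ι → Euc n → ℝ}
    (hf : ∀ a ∈ s, LocallyIntegrable (f a)) (x : Euc n) :
    moll k (fun y => ∑ a ∈ s, c a * f a y) x = ∑ a ∈ s, c a * moll k (f a) x := by
  simp only [moll_apply', Finset.mul_sum]
  rw [integral_finsetSum]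
  · refine Finset.sum_congr rfl fun a _ => ?_
    rw [← integral_const_mul]
    congr 1; ext t; ring
  · intro a ha
    convert (moll_integrable k (hf a ha) x).const_mul (c a) using 2
    ring

/-- The derivative falls on the kernel `ρ(x - t)`, which as a function of `t` is a test function.
Moving it to `f` produces two minus signs, which cancel. The kernel may reach anywhere, so the weak
derivative must exist on the whole space. -/
theorem pd_moll (k : ℕ) {f f' : Euc n → ℝ} (h : IsWeakPartial univ i f f') (x : Euc n) :
    pd i (moll k f) x = moll k f' x := by
  have hf : LocallyIntegrable f := locallyIntegrableOn_univ.1 h.1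
  set ρ := (bump n k).normed (volume : Measure (Euc n)) with hρ
  have hρs : ContDiff ℝ ∞ ρ := (bump n k).contDiff_normed
  have hρc : HasCompactSupport ρ := (bump n k).hasCompactSupport_normed
  have h1 := (hρc.hasFDerivAt_convolution_left (ContinuousLinearMap.lsmul ℝ ℝ)
    (hρs.of_le (by simp)) hf x).fderiv
  have ht : IsTest univ fun t => ρ (x - t) :=
    ⟨hρs.comp (contDiff_const.sub contDiff_id), hρc.comp_homeomorph (Homeomorph.subLeft x),
      subset_univ _⟩
  have h2 : ∀ t, fderiv ℝ (fun t => ρ (x - t)) t (stdVec i) = - fderiv ℝ ρ (x - t) (stdVec i) := by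
    intro t
    have e : HasFDerivAt (fun t => x - t) (-ContinuousLinearMap.id ℝ (Euc n)) t :=
      (hasFDerivAt_id t).const_sub x
    have := ((hρs.differentiable (by simp) (x - t)).hasFDerivAt.comp t e).fderiv
    simp only [Function.comp_def] at this
    rw [this]; simp
  have h3 := h.integral_eq ht
  have hconv : Integrable fun t => f t • fderiv ℝ ρ (x - t) :=
    hf.integrable_smul_right_of_hasCompactSupport
      ((hρs.continuous_fderiv (by simp)).comp (continuous_const.sub continuous_id))
      ((hρc.fderiv ℝ).comp_homeomorph (Homeomorph.subLeft x))
  have h4 : pd i (moll k f) x = ∫ t, f t * fderiv ℝ ρ (x - t) (stdVec i) := by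
    unfold pd moll
    rw [h1, ← convolution_flip, convolution_def]
    rw [ContinuousLinearMap.integral_apply]
    · refine integral_congr_ae (Eventually.of_forall fun t => ?_)
      simp [ContinuousLinearMap.precompL, mul_comm]
    · refine hconv.congr (Eventually.of_forall fun t => ?_)
      ext w
      simp [ContinuousLinearMap.precompL, mul_comm]
  rw [h4, moll_apply']
  simp only [h2, mul_neg, integral_neg, neg_inj] at h3
  rw [h3]
  congr 1; ext t; rw [mul_comm]

theorem moll_congr_ae (k : ℕ) {f g : Euc n → ℝ} (h : f =ᵐ[volume] g) : moll k f = moll k g :=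
  convolution_congr _ (EventuallyEq.refl _ _) h

/-- Translations act continuously on `L²`, the exponent being finite. -/
theorem tendsto_translate {f : Euc n → ℝ} (hf : MemLp f 2) :
    Tendsto (fun z => eLpNorm (fun x => f (x - z) - f x) 2 volume) (𝓝 0) (𝓝 0) := by
  have : Fact ((1 : ENNReal) ≤ 2) := ⟨by norm_num⟩
  have : Fact ((2 : ENNReal) ≠ ⊤) := ⟨by norm_num⟩
  have hc : Continuous fun z : Euc n => DomAddAct.mk (-z) +ᵥ hf.toLp f := by
    have : Continuous fun z : Euc n => DomAddAct.mk (-z) :=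
      DomAddAct.continuous_mk.comp continuous_neg
    exact this.vadd continuous_const
  have h0 : Tendsto (fun z : Euc n => edist (DomAddAct.mk (-z) +ᵥ hf.toLp f) (hf.toLp f))
      (𝓝 0) (𝓝 0) := by
    have := (hc.edist (continuous_const (y := hf.toLp f))).tendsto 0
    simpa using this
  refine h0.congr fun z => ?_
  rw [DomAddAct.mk_vadd_toLp, Lp.edist_toLp_toLp]
  refine eLpNorm_congr_ae (Eventually.of_forall fun x => ?_)
  simp [neg_add_eq_sub]

/-- Jensen's inequality for the probability measure `ρ dz`, obtained by comparing its `L¹` and `L²`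
norms. -/
theorem lintegral_mul_sq_le {ρ φ : Euc n → ENNReal} (hρ : Measurable ρ) (hφ : Measurable φ)
    (h1 : ∫⁻ z, ρ z = 1) : (∫⁻ z, ρ z * φ z) ^ 2 ≤ ∫⁻ z, ρ z * φ z ^ 2 := by
  have : IsProbabilityMeasure (volume.withDensity ρ) := ⟨by simpa using h1⟩
  have h := eLpNorm_le_eLpNorm_of_exponent_le (p := 1) (q := 2) (by norm_num)
    (hφ.aestronglyMeasurable (μ := volume.withDensity ρ))
  rw [eLpNorm_one_eq_lintegral_enorm] at h
  have h2 := eLpNorm_nnreal_pow_eq_lintegral (p := 2) (f := φ) (μ := volume.withDensity ρ)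
    (by norm_num)
  simp only [enorm_eq_self] at h h2
  rw [lintegral_withDensity_eq_lintegral_mul _ hρ hφ] at h
  rw [lintegral_withDensity_eq_lintegral_mul _ hρ (by fun_prop)] at h2
  simp only [Pi.mul_apply] at h h2
  have h3 : (∫⁻ z, ρ z * φ z) ^ (2 : ℝ) ≤ eLpNorm φ 2 (volume.withDensity ρ) ^ (2 : ℝ) := by
    gcongr
  have h2' : eLpNorm φ 2 (volume.withDensity ρ) ^ (2 : ℝ) = ∫⁻ z, ρ z * φ z ^ (2 : ℝ) := by
    simpa using h2
  rw [h2'] at h3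
  simpa using h3

end

/-! ### `L²` convergence of mollifications and local integrability classes -/

section

open scoped NNReal Convolution

variable {n : ℕ} {Ω : Set (Euc n)} {i : Fin n} {u v : Euc n → ℝ}

theorem eLpNorm_two_sq {α : Type*} [MeasurableSpace α] (μ : Measure α) (f : α → ℝ) :
    eLpNorm f 2 μ ^ 2 = ∫⁻ x, ‖f x‖ₑ ^ 2 ∂μ := by
  have := eLpNorm_nnreal_pow_eq_lintegral (p := 2) (f := f) (μ := μ) (by norm_num)
  simpa using this

/-- Mollifications of an `L²` function converge in `L²`. -/
theorem moll_tendsto_L2 {f : Euc n → ℝ} (hf : MemLp f 2) :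
    Tendsto (fun k => eLpNorm (fun x => moll k f x - f x) 2 volume) atTop (𝓝 0) := by
  -- A measurable representative is needed for Tonelli's theorem; mollifications do not see the
  -- change.
  wlog hm : Measurable f generalizing f
  · have h0 := hf.1.ae_eq_mk
    have := this (hf.ae_eq h0) hf.1.stronglyMeasurable_mk.measurable
    refine this.congr fun k => eLpNorm_congr_ae ?_
    filter_upwards [h0] with x hx
    rw [hx, moll_congr_ae k h0]
  have hloc : LocallyIntegrable f := hf.locallyIntegrable (by norm_num)
  rw [ENNReal.tendsto_atTop_zero]
  intro ε hε
  have h1 := (ENNReal.tendsto_nhds_zero.1 (tendsto_translate hf)) ε hε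
  obtain ⟨δ, hδ, hball⟩ := Metric.eventually_nhds_iff_ball.1 h1
  have h2 := (tendsto_order.1 (bump_rOut_tendsto (n := n))).2 δ hδ
  obtain ⟨N, hN⟩ := eventually_atTop.1 h2
  refine ⟨N, fun k hk => ?_⟩
  set ρ : Euc n → ENNReal := fun t => ENNReal.ofReal ((bump n k).normed volume t) with hρ
  have hρm : Measurable ρ := (bump n k).continuous_normed.measurable.ennreal_ofReal
  have hρ1 : ∫⁻ z, ρ z = 1 := by
    rw [← ofReal_integral_eq_lintegral_ofReal ((bump n k).integrable_normed)
      (Eventually.of_forall (bump n k).nonneg_normed), (bump n k).integral_normed]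
    simp
  -- The kernel has integral one, so the difference is an average of `f (x - t) - f x`, to which
  -- Jensen's inequality applies.
  have hpt : ∀ x, ‖moll k f x - f x‖ₑ ^ 2 ≤ ∫⁻ t, ρ t * ‖f (x - t) - f x‖ₑ ^ 2 := by
    intro x
    refine le_trans ?_ (lintegral_mul_sq_le (φ := fun t => ‖f (x - t) - f x‖ₑ) hρm
      (by fun_prop) hρ1)
    gcongr
    have e : moll k f x - f x =
        ∫ t, (bump n k).normed volume t * (f (x - t) - f x) := by
      have i1 : Integrable fun t => (bump n k).normed volume t * f (x - t) := by
        have := (moll_integrable k hloc x).comp_sub_left x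
        simpa using this
      simp only [mul_sub]
      rw [integral_sub i1 ((bump n k).integrable_normed.mul_const _), integral_mul_const,
        (bump n k).integral_normed, one_mul, moll_apply]
    rw [e]
    refine (enorm_integral_le_lintegral_enorm _).trans (lintegral_mono fun t => ?_)
    rw [enorm_mul, Real.enorm_of_nonneg ((bump n k).nonneg_normed t)]
  -- By Tonelli the square of the norm is at most the average over `t` of the squared norms of `f (·
  -- - t) - f`. The kernel is supported where `|t| < δ`, and there these are at most `ε ^ 2`.
  have hsq : eLpNorm (fun x => moll k f x - f x) 2 volume ^ 2 ≤ ε ^ 2 := by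
    rw [eLpNorm_two_sq]
    calc ∫⁻ x, ‖moll k f x - f x‖ₑ ^ 2
        ≤ ∫⁻ x, ∫⁻ t, ρ t * ‖f (x - t) - f x‖ₑ ^ 2 := lintegral_mono hpt
      _ = ∫⁻ t, ∫⁻ x, ρ t * ‖f (x - t) - f x‖ₑ ^ 2 := by
          refine lintegral_lintegral_swap (Measurable.aemeasurable ?_)
          simp only [Function.uncurry_def]
          fun_prop
      _ = ∫⁻ t, ρ t * ∫⁻ x, ‖f (x - t) - f x‖ₑ ^ 2 := by
          refine lintegral_congr fun t => ?_
          rw [lintegral_const_mul]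
          fun_prop
      _ ≤ ∫⁻ t, ρ t * ε ^ 2 := by
          refine lintegral_mono fun t => ?_
          by_cases ht : t ∈ Metric.ball (0 : Euc n) δ
          · rw [← eLpNorm_two_sq]
            gcongr
            exact hball t ht
          · have : ρ t = 0 := by
              have h0 : t ∉ Function.support ((bump n k).normed volume) := by
                rw [(bump n k).support_normed_eq]
                exact fun h => ht (Metric.ball_subset_ball (hN k hk).le h)
              simp [hρ, Function.notMem_support.1 h0]
            simp [this]
      _ = ε ^ 2 := by rw [lintegral_mul_const _ hρm, hρ1, one_mul]
  exact (ENNReal.pow_right_strictMono (two_ne_zero)).le_iff_le.1 hsq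

/-- Multiplication by a smooth cutoff extends weak derivatives to the whole space. -/
theorem IsWeakPartial.test_mul (h : IsWeakPartial Ω i u v) {θ : Euc n → ℝ}
    (hθ : IsTest Ω θ) :
    IsWeakPartial univ i (fun y => θ y * u y) (fun y => pd i θ y * u y + θ y * v y) := by
  have e1 : Integrable fun y => θ y * u y := by simpa [mul_comm] using hθ.integrable_mul h.1
  have e2 : Integrable fun y => pd i θ y * u y := by
    simpa [mul_comm] using (hθ.pd i).integrable_mul h.1
  have e3 : Integrable fun y => θ y * v y := by simpa [mul_comm] using hθ.integrable_mul h.2.1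
  refine .of_test (e1.locallyIntegrable.locallyIntegrableOn _)
    ((e2.add e3).locallyIntegrable.locallyIntegrableOn _) fun η hη => ?_
  have ht : IsTest Ω fun y => θ y * η y :=
    ⟨hθ.smooth.mul hη.smooth, hθ.compact.mul_right, tsupport_mul_subset_left.trans hθ.subset⟩
  have ht2 : IsTest Ω fun y => AsympEuclid.pd i θ y * η y :=
    ⟨(hθ.pd i).smooth.mul hη.smooth, (hθ.pd i).compact.mul_right,
      tsupport_mul_subset_left.trans (hθ.pd i).subset⟩
  have key := h.integral_eq ht
  have hpt : ∀ y, θ y * u y * fderiv ℝ η y (stdVec i) =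
      u y * fderiv ℝ (fun y => θ y * η y) y (stdVec i) - u y * (AsympEuclid.pd i θ y * η y) := by
    intro y
    have := pd_mul (i := i) (hθ.smooth.differentiable (by simp) y)
      (hη.smooth.differentiable (by simp) y)
    simp only [AsympEuclid.pd] at this ⊢
    rw [this]; ring
  simp only [hpt]
  rw [integral_sub (ht.integrable_mul_pd h.1 i) (ht2.integrable_mul h.1), key]
  have : ∀ y, (AsympEuclid.pd i θ y * u y + θ y * v y) * η y =
      u y * (AsympEuclid.pd i θ y * η y) + v y * (θ y * η y) := fun y => by ring
  simp only [this]
  rw [integral_add (ht2.integrable_mul h.1) (ht.integrable_mul h.2.1)]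
  ring

/-- Local square integrability. -/
def L2Loc (Ω : Set (Euc n)) (u : Euc n → ℝ) : Prop :=
  ∀ K ⊆ Ω, IsCompact K → MemLp u 2 (volume.restrict K)

/-- Measurable functions that are locally essentially bounded. -/
def BddLoc (Ω : Set (Euc n)) (u : Euc n → ℝ) : Prop :=
  ∀ K ⊆ Ω, IsCompact K → MemLp u ⊤ (volume.restrict K)

theorem BddLoc.l2Loc (h : BddLoc Ω u) : L2Loc Ω u := fun K hK hc => by
  have : IsFiniteMeasure (volume.restrict K) := ⟨by simpa using hc.measure_lt_top⟩
  exact (h K hK hc).mono_exponent le_top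

theorem BddLoc.of_continuousOn (h : ContinuousOn u Ω) : BddLoc Ω u := by
  intro K hK hc
  have h1 := h.mono hK
  obtain ⟨C, hC⟩ := hc.exists_bound_of_continuousOn h1
  exact memLp_top_of_bound (h1.aestronglyMeasurable hc.measurableSet) C
    ((ae_restrict_iff' hc.measurableSet).2 (Eventually.of_forall hC))

theorem BddLoc.mul (h : BddLoc Ω u) (h' : BddLoc Ω v) : BddLoc Ω fun y => u y * v y :=
  fun K hK hc => (h' K hK hc).mul (h K hK hc)

theorem BddLoc.mul_l2Loc (h : BddLoc Ω u) (h' : L2Loc Ω v) : L2Loc Ω fun y => u y * v y :=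
  fun K hK hc => (h' K hK hc).mul (h K hK hc)

theorem L2Loc.add (h : L2Loc Ω u) (h' : L2Loc Ω v) : L2Loc Ω fun y => u y + v y :=
  fun K hK hc => (h K hK hc).add (h' K hK hc)

theorem L2Loc.sub (h : L2Loc Ω u) (h' : L2Loc Ω v) : L2Loc Ω fun y => u y - v y :=
  fun K hK hc => (h K hK hc).sub (h' K hK hc)

theorem L2Loc.const_mul (h : L2Loc Ω u) (c : ℝ) : L2Loc Ω fun y => c * u y :=
  fun K hK hc => (h K hK hc).const_mul c

theorem L2Loc.sum {ι : Type*} (s : Finset ι) {U : ι → Euc n → ℝ} (h : ∀ a ∈ s, L2Loc Ω (U a)) :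
    L2Loc Ω fun y => ∑ a ∈ s, U a y :=
  fun K hK hc => memLp_finsetSum s fun a ha => h a ha K hK hc

theorem BddLoc.add (h : BddLoc Ω u) (h' : BddLoc Ω v) : BddLoc Ω fun y => u y + v y :=
  fun K hK hc => (h K hK hc).add (h' K hK hc)

theorem L2Loc.mul (hΩ : IsOpen Ω) (h : L2Loc Ω u) (h' : L2Loc Ω v) :
    LocallyIntegrableOn (fun y => u y * v y) Ω := by
  rw [locallyIntegrableOn_iff hΩ.isLocallyClosed]
  exact fun K hK hc => (h K hK hc).integrable_mul (h' K hK hc)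

theorem L2Loc.locallyIntegrableOn (hΩ : IsOpen Ω) (h : L2Loc Ω u) : LocallyIntegrableOn u Ω := by
  rw [locallyIntegrableOn_iff hΩ.isLocallyClosed]
  intro K hK hc
  have : IsFiniteMeasure (volume.restrict K) := ⟨by simpa using hc.measure_lt_top⟩
  exact (h K hK hc).integrable (by norm_num)

theorem L2Loc.test_mul (h : L2Loc Ω u) {η : Euc n → ℝ} (hη : Continuous η)
    (hc : HasCompactSupport η) (hs : tsupport η ⊆ Ω) : MemLp (fun y => η y * u y) 2 := by
  have h1 := h (tsupport η) hs hc
  have h2 : MemLp η ⊤ (volume.restrict (tsupport η)) :=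
    BddLoc.of_continuousOn (Ω := univ) hη.continuousOn _ (subset_univ _) hc
  have h3 : MemLp (fun y => η y * u y) 2 (volume.restrict (tsupport η)) := h1.mul h2
  have h4 : (tsupport η).indicator (fun y => η y * u y) = fun y => η y * u y := by
    rw [indicator_eq_self]
    intro y hy
    exact subset_tsupport η (left_ne_zero_of_mul hy)
  rw [← h4]
  exact (memLp_indicator_iff_restrict hc.measurableSet).2 h3

/-- Pairing with an `L²` function is continuous along `L²` convergence. -/
theorem tendsto_integral_mul_of_L2 {α : Type*} [MeasurableSpace α] {μ : Measure α}
    {f : ℕ → α → ℝ} {f₀ g : α → ℝ} (hf : ∀ k, MemLp (f k) 2 μ) (hf₀ : MemLp f₀ 2 μ)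
    (hg : MemLp g 2 μ) (h : Tendsto (fun k => eLpNorm (fun x => f k x - f₀ x) 2 μ) atTop (𝓝 0)) :
    Tendsto (fun k => ∫ x, f k x * g x ∂μ) atTop (𝓝 (∫ x, f₀ x * g x ∂μ)) := by
  refine tendsto_integral_of_L1 _ (hf₀.integrable_mul hg).1
    (Eventually.of_forall fun k => (hf k).integrable_mul hg) ?_
  have hub : Tendsto (fun k => eLpNorm (fun x => f k x - f₀ x) 2 μ * eLpNorm g 2 μ) atTop (𝓝 0) := by
    have := ENNReal.Tendsto.mul_const (b := eLpNorm g 2 μ) h (Or.inr hg.2.ne)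
    simpa using this
  refine tendsto_of_tendsto_of_tendsto_of_le_of_le tendsto_const_nhds hub (fun _ => zero_le) ?_
  intro k
  have := eLpNorm_smul_le_mul_eLpNorm (p := 2) (q := 2) (r := 1) (μ := μ)
    hg.1 ((hf k).sub hf₀).1
  rw [eLpNorm_one_eq_lintegral_enorm] at this
  refine le_trans (le_of_eq ?_) this
  refine lintegral_congr fun x => ?_
  simp [sub_mul]

end

/-! ### The product rule -/

section

open scoped NNReal Convolution

variable {n : ℕ} {Ω : Set (Euc n)} {i : Fin n} {u v : Euc n → ℝ}

theorem moll_hasCompactSupport (k : ℕ) {f : Euc n → ℝ} (hf : HasCompactSupport f) :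
    HasCompactSupport (moll k f) :=
  (bump n k).hasCompactSupport_normed.convolution _ hf

theorem moll_memLp (k : ℕ) {f : Euc n → ℝ} (hf : LocallyIntegrable f) (hc : HasCompactSupport f) :
    MemLp (moll k f) 2 :=
  (moll_contDiff k hf).continuous.memLp_of_hasCompactSupport (moll_hasCompactSupport k hc)

theorem pd_eq_zero_of_one_nhds {θ : Euc n → ℝ} {K : Set (Euc n)}
    (h : ∀ᶠ y in 𝓝ˢ K, θ y = 1) {y : Euc n} (hy : y ∈ K) (i : Fin n) : pd i θ y = 0 := by
  have h1 : θ =ᶠ[𝓝 y] fun _ => 1 := (eventually_nhdsSet_iff_forall.1 h) y hy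
  simp [pd, h1.fderiv_eq]

theorem integrable_mul_of_memLp_two {α : Type*} [MeasurableSpace α] {μ : Measure α} {f g : α → ℝ}
    (hf : MemLp f 2 μ) (hg : MemLp g 2 μ) : Integrable (fun x => f x * g x) μ :=
  hf.integrable_mul hg

theorem pd_add {a b : Euc n → ℝ} {y : Euc n} (ha : DifferentiableAt ℝ a y)
    (hb : DifferentiableAt ℝ b y) :
    pd i (fun z => a z + b z) y = pd i a y + pd i b y := by
  simp [pd, fderiv_fun_add ha hb]

theorem pd_sum {ι : Type*} (s : Finset ι) {a : ι → Euc n → ℝ} {y : Euc n}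
    (ha : ∀ j ∈ s, DifferentiableAt ℝ (a j) y) :
    pd i (fun z => ∑ j ∈ s, a j z) y = ∑ j ∈ s, pd i (a j) y := by
  simp [pd, fderiv_fun_sum ha]

theorem pd_const (c : ℝ) (y : Euc n) : pd i (fun _ => c) y = 0 := by
  simp [pd]

/-- The product rule in `W^{1,2}_loc`. -/
theorem IsWeakPartial.mul (hΩ : IsOpen Ω) {du dv : Euc n → ℝ} (h : IsWeakPartial Ω i u du)
    (h' : IsWeakPartial Ω i v dv) (hu : L2Loc Ω u) (hdu : L2Loc Ω du) (hv : L2Loc Ω v)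
    (hdv : L2Loc Ω dv) :
    IsWeakPartial Ω i (fun y => u y * v y) (fun y => du y * v y + u y * dv y) := by
  refine .of_test (hu.mul hΩ hv) ((hdu.mul hΩ hv).add (hu.mul hΩ hdv)) fun η hη => ?_
  -- Multiplying `v` by a cutoff equal to `1` near the support of `η` makes it globally defined and
  -- `L²`, so that it can be mollified, without changing anything tested against `η`.
  obtain ⟨θ, hθ, hθ1, -⟩ := exists_isTest_one_nhds hΩ hη.compact hη.subset
  have hθ1' : ∀ y ∈ tsupport η, θ y = 1 := fun y hy =>
    (eventually_nhdsSet_iff_forall.1 hθ1 y hy).self_of_nhds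
  set V : Euc n → ℝ := fun y => θ y * v y with hV
  set V' : Euc n → ℝ := fun y => pd i θ y * v y + θ y * dv y with hV'
  have hVw : IsWeakPartial univ i V V' := h'.test_mul hθ
  have hV2 : MemLp V 2 := hv.test_mul hθ.smooth.continuous hθ.compact hθ.subset
  have hV'2 : MemLp V' 2 :=
    (hv.test_mul (hθ.pd i).smooth.continuous (hθ.pd i).compact (hθ.pd i).subset).add
      (hdv.test_mul hθ.smooth.continuous hθ.compact hθ.subset)
  have hVc : HasCompactSupport V := hθ.compact.mul_right
  have hV'c : HasCompactSupport V' := (hθ.pd i).compact.mul_right.add hθ.compact.mul_right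
  have hVl : LocallyIntegrable V := locallyIntegrableOn_univ.1 hVw.1
  have hV'l : LocallyIntegrable V' := locallyIntegrableOn_univ.1 hVw.2.1
  have g1 : MemLp (fun y => pd i η y * u y) 2 :=
    hu.test_mul (hη.pd i).smooth.continuous (hη.pd i).compact (hη.pd i).subset
  have g2 : MemLp (fun y => η y * du y) 2 :=
    hdu.test_mul hη.smooth.continuous hη.compact hη.subset
  have g3 : MemLp (fun y => η y * u y) 2 :=
    hu.test_mul hη.smooth.continuous hη.compact hη.subset
  -- Only one factor is smoothed: then `moll k V * η` is a test function for `u`, and the identity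
  -- is the definition of the weak derivative of `u`. The limit `k → ∞` pairs `L²` convergence with
  -- fixed `L²` functions.
  have hk : ∀ k, ∫ y, moll k V y * (pd i η y * u y) =
      -(∫ y, moll k V y * (η y * du y)) - ∫ y, moll k V' y * (η y * u y) := by
    intro k
    have ht : IsTest Ω fun y => moll k V y * η y := hη.smul hΩ (moll_contDiff k hVl).contDiffOn
    have key := h.integral_eq ht
    have hpt : ∀ y, u y * fderiv ℝ (fun y => moll k V y * η y) y (stdVec i) =
        moll k V y * (pd i η y * u y) + moll k V' y * (η y * u y) := by
      intro y
      have := pd_mul (i := i) ((moll_contDiff k hVl).differentiable (by simp) y)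
        (hη.smooth.differentiable (by simp) y)
      rw [pd_moll k hVw] at this
      rw [show fderiv ℝ (fun y => moll k V y * η y) y (stdVec i) =
        pd i (fun y => moll k V y * η y) y from rfl, this]
      ring
    simp only [hpt] at key
    rw [integral_add (integrable_mul_of_memLp_two (moll_memLp k hVl hVc) g1)
      (integrable_mul_of_memLp_two (moll_memLp k hV'l hV'c) g3)] at key
    have e : ∀ y, du y * (moll k V y * η y) = moll k V y * (η y * du y) := fun y => by ring
    simp only [e] at key
    linarith
  have l1 := tendsto_integral_mul_of_L2 (fun k => moll_memLp k hVl hVc) hV2 g1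
    (moll_tendsto_L2 hV2)
  have l2 := tendsto_integral_mul_of_L2 (fun k => moll_memLp k hVl hVc) hV2 g2
    (moll_tendsto_L2 hV2)
  have l3 := tendsto_integral_mul_of_L2 (fun k => moll_memLp k hV'l hV'c) hV'2 g3
    (moll_tendsto_L2 hV'2)
  have hlim := tendsto_nhds_unique (l1.congr hk) (l2.neg.sub l3)
  have e1 : ∀ y, V y * (pd i η y * u y) = u y * v y * fderiv ℝ η y (stdVec i) := by
    intro y
    by_cases hy : y ∈ tsupport η
    · simp only [hV, hθ1' y hy, pd]; ring
    · have : pd i η y = 0 :=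
        image_eq_zero_of_notMem_tsupport fun h => hy (tsupport_pd_subset η i h)
      rw [show fderiv ℝ η y (stdVec i) = pd i η y from rfl, this]; ring
  have e2 : ∀ y, V y * (η y * du y) + V' y * (η y * u y) = (du y * v y + u y * dv y) * η y := by
    intro y
    by_cases hy : y ∈ tsupport η
    · simp only [hV, hV', hθ1' y hy, pd_eq_zero_of_one_nhds hθ1 hy]; ring
    · rw [image_eq_zero_of_notMem_tsupport hy]; ring
  simp only [e1] at hlim
  rw [hlim, ← integral_congr_ae (Eventually.of_forall e2),
    integral_add (integrable_mul_of_memLp_two hV2 g2) (integrable_mul_of_memLp_two hV'2 g3)]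
  ring

/-! ### Matrix inverses -/

theorem coercive_det_ne_zero {A : Matrix (Fin n) (Fin n) ℝ} {c : ℝ} (hc : 0 < c)
    (h : ∀ ξ : Fin n → ℝ, c * (ξ ⬝ᵥ ξ) ≤ ξ ⬝ᵥ A.mulVec ξ) : A.det ≠ 0 := by
  intro h0
  obtain ⟨w, hw, hAw⟩ := Matrix.exists_mulVec_eq_zero_iff.2 h0
  have := h w
  rw [hAw, dotProduct_zero] at this
  have h2 : 0 < w ⬝ᵥ w := by
    have h0 : 0 ≤ w ⬝ᵥ w := Finset.sum_nonneg fun j _ => mul_self_nonneg (w j)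
    rcases h0.lt_or_eq with h | h
    · exact h
    · exact absurd (dotProduct_self_eq_zero.1 h.symm) hw
  nlinarith

/-- The column `w` of the inverse solves `A w = e_b`, so `c |w|² ≤ w_b`. This gives first `w_b ≤
c⁻¹`, then `|w|² ≤ c⁻²`. -/
theorem coercive_inv_le {A : Matrix (Fin n) (Fin n) ℝ} {c : ℝ} (hc : 0 < c)
    (h : ∀ ξ : Fin n → ℝ, c * (ξ ⬝ᵥ ξ) ≤ ξ ⬝ᵥ A.mulVec ξ) (a b : Fin n) : |A⁻¹ a b| ≤ c⁻¹ := by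
  set w : Fin n → ℝ := fun a => A⁻¹ a b with hw
  have hAw : A.mulVec w = Pi.single b 1 := by
    have : A * A⁻¹ = 1 := Matrix.mul_nonsing_inv A (coercive_det_ne_zero hc h).isUnit
    ext j
    have := congrFun (congrFun this j) b
    rw [Matrix.mul_apply, Matrix.one_apply] at this
    simpa [Matrix.mulVec, dotProduct, Pi.single_apply] using this
  have h1 := h w
  rw [hAw, dotProduct_single_one] at h1
  have hsq : ∀ j, w j ^ 2 ≤ w ⬝ᵥ w := fun j => by
    rw [sq]
    exact Finset.single_le_sum (f := fun j => w j * w j) (fun j _ => mul_self_nonneg _)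
      (Finset.mem_univ j)
  have hb : w b ≤ c⁻¹ := by
    by_contra hlt
    push Not at hlt
    have h2 := hsq b
    have hpos : 0 < w b := lt_trans (inv_pos.2 hc) hlt
    have : 1 < c * w b := by
      rw [inv_lt_iff_one_lt_mul₀ hc] at hlt; linarith
    nlinarith
  have : w a ^ 2 ≤ (c⁻¹) ^ 2 := by
    have h2 := hsq a
    have h3 : w ⬝ᵥ w ≤ c⁻¹ * w b := by
      rw [inv_mul_eq_div, le_div_iff₀ hc]; linarith
    have h4 : c⁻¹ * w b ≤ c⁻¹ * c⁻¹ := by gcongr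
    nlinarith
  exact abs_le_of_sq_le_sq this (inv_pos.2 hc).le

/-- Cramer's rule, valid also for singular `A`, where both sides are zero. Smoothness, measurability
and continuity of inversion are all read off from it. -/
theorem inv_entry (A : Matrix (Fin n) (Fin n) ℝ) (a b : Fin n) :
    A⁻¹ a b = A.det⁻¹ * A.adjugate a b := by
  simp [Matrix.inv_def]

theorem contDiffOn_det {s : Set (Euc n)} {m : ℕ} {G : Euc n → Matrix (Fin m) (Fin m) ℝ}
    (hG : ∀ a b, ContDiffOn ℝ ∞ (fun y => G y a b) s) : ContDiffOn ℝ ∞ (fun y => (G y).det) s := by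
  simp only [Matrix.det_apply]
  exact ContDiffOn.sum fun σ _ => (contDiffOn_prod fun j _ => hG _ _).const_smul _

theorem contDiffOn_inv_entry {s : Set (Euc n)} {G : Euc n → Matrix (Fin n) (Fin n) ℝ}
    (hG : ∀ a b, ContDiffOn ℝ ∞ (fun y => G y a b) s) (hd : ∀ y ∈ s, (G y).det ≠ 0) (a b : Fin n) :
    ContDiffOn ℝ ∞ (fun y => (G y)⁻¹ a b) s := by
  simp only [inv_entry]
  refine ((contDiffOn_det hG).inv hd).mul ?_
  simp only [Matrix.adjugate_apply]
  refine contDiffOn_det fun p q => ?_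
  by_cases h : p = b
  · subst h; simpa using contDiffOn_const
  · simpa [Matrix.updateRow_ne h] using hG p q

theorem measurable_inv_entry (a b : Fin n) :
    Measurable fun A : Fin n → Fin n → ℝ => (Matrix.of A)⁻¹ a b := by
  simp only [inv_entry]
  have h1 : Continuous fun A : Fin n → Fin n → ℝ => (Matrix.of A).det :=
    Continuous.matrix_det continuous_id
  have h2 : Continuous fun A : Fin n → Fin n → ℝ => (Matrix.of A).adjugate a b :=
    (Continuous.matrix_adjugate continuous_id).matrix_elem a b
  exact h1.measurable.inv.mul h2.measurable

theorem aestronglyMeasurable_inv_entry {α : Type*} [MeasurableSpace α] {μ : Measure α}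
    {G : α → Matrix (Fin n) (Fin n) ℝ} (hG : ∀ a b, AEStronglyMeasurable (fun y => G y a b) μ)
    (a b : Fin n) : AEStronglyMeasurable (fun y => (G y)⁻¹ a b) μ := by
  have : AEMeasurable (fun y => (fun a b => G y a b : Fin n → Fin n → ℝ)) μ :=
    aemeasurable_pi_lambda _ fun a => aemeasurable_pi_lambda _ fun b => (hG a b).aemeasurable
  exact ((measurable_inv_entry a b).comp_aemeasurable this).aestronglyMeasurable

theorem tendsto_inv_entry {ι : Type*} {l : Filter ι} {G : ι → Matrix (Fin n) (Fin n) ℝ}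
    {A : Matrix (Fin n) (Fin n) ℝ} (h : ∀ a b, Tendsto (fun k => G k a b) l (𝓝 (A a b)))
    (hA : A.det ≠ 0) (a b : Fin n) : Tendsto (fun k => (G k)⁻¹ a b) l (𝓝 (A⁻¹ a b)) := by
  have hG : Tendsto G l (𝓝 A) := tendsto_pi_nhds.2 fun a => tendsto_pi_nhds.2 fun b => h a b
  simp only [inv_entry]
  have h1 : Continuous fun A : Matrix (Fin n) (Fin n) ℝ => A.det :=
    Continuous.matrix_det continuous_id
  have h2 : Continuous fun A : Matrix (Fin n) (Fin n) ℝ => A.adjugate a b :=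
    (Continuous.matrix_adjugate continuous_id).matrix_elem a b
  exact (((h1.tendsto A).comp hG).inv₀ hA).mul ((h2.tendsto A).comp hG)

/-- The derivative of the inverse of a differentiable matrix function. -/
theorem pd_inv_entry {G : Euc n → Matrix (Fin n) (Fin n) ℝ} {y : Euc n} {s : Set (Euc n)}
    (hs : IsOpen s) (hy : y ∈ s) (hG : ∀ a b, ContDiffOn ℝ ∞ (fun y => G y a b) s)
    (hd : ∀ y ∈ s, (G y).det ≠ 0) (a b : Fin n) :
    pd i (fun y => (G y)⁻¹ a b) y =
      -∑ c, ∑ d, (G y)⁻¹ a c * pd i (fun y => G y c d) y * (G y)⁻¹ d b := by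
  have hB := contDiffOn_inv_entry hG hd
  have dG : ∀ a b, DifferentiableAt ℝ (fun y => G y a b) y := fun a b =>
    ((hG a b).contDiffAt (hs.mem_nhds hy)).differentiableAt (by simp)
  have dB : ∀ a b, DifferentiableAt ℝ (fun y => (G y)⁻¹ a b) y := fun a b =>
    ((hB a b).contDiffAt (hs.mem_nhds hy)).differentiableAt (by simp)
  set PB : Matrix (Fin n) (Fin n) ℝ := Matrix.of fun a b => pd i (fun y => (G y)⁻¹ a b) y
  set PG : Matrix (Fin n) (Fin n) ℝ := Matrix.of fun a b => pd i (fun y => G y a b) y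
  -- Differentiate `G⁻¹ G = 1`; the identity holds on a neighbourhood, since `G` is invertible on
  -- the open set `s`.
  have hsum : PB * G y + (G y)⁻¹ * PG = 0 := by
    ext p q
    have hev : (fun y => ∑ r, (G y)⁻¹ p r * G y r q) =ᶠ[𝓝 y]
        fun _ => (1 : Matrix (Fin n) (Fin n) ℝ) p q := by
      filter_upwards [hs.mem_nhds hy] with z hz
      rw [← Matrix.mul_apply, Matrix.nonsing_inv_mul _ (hd z hz).isUnit]
    have h0 : pd i (fun y => ∑ r, (G y)⁻¹ p r * G y r q) y = 0 := by
      simp [pd, hev.fderiv_eq]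
    rw [pd_sum _ fun r _ => (dB p r).fun_mul (dG r q)] at h0
    simp only [pd_mul (dB _ _) (dG _ _), Finset.sum_add_distrib] at h0
    simpa [Matrix.mul_apply, PB, PG] using h0
  have h1 : PB = -((G y)⁻¹ * PG * (G y)⁻¹) := by
    have h2 : PB * G y = -((G y)⁻¹ * PG) := eq_neg_of_add_eq_zero_left hsum
    calc PB = PB * G y * (G y)⁻¹ := by
          rw [Matrix.mul_assoc, Matrix.mul_nonsing_inv _ (hd y hy).isUnit, Matrix.mul_one]
      _ = _ := by rw [h2, Matrix.neg_mul]
  have h3 := congrFun (congrFun h1 a) b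
  rw [show PB a b = pd i (fun y => (G y)⁻¹ a b) y from rfl] at h3
  rw [h3, Matrix.neg_apply, Matrix.mul_apply, neg_inj, Finset.sum_comm]
  refine Finset.sum_congr rfl fun d _ => ?_
  rw [Matrix.mul_apply, Finset.sum_mul]
  rfl

end

/-! ### The weak derivative of an inverse matrix -/

section

open scoped NNReal Convolution

variable {n : ℕ} {Ω : Set (Euc n)} {i : Fin n} {u v : Euc n → ℝ}

/-- Split the product as `(f k - f₀) * g k + f₀ * g k`. The first part is dominated by `|f k - f₀| *
w` and tends to zero by `L²` convergence; the second is handled by dominated convergence. -/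
theorem tendsto_integral_mul_of_L2_of_bound {α : Type*} [MeasurableSpace α] {μ : Measure α}
    {f g : ℕ → α → ℝ} {f₀ g₀ w : α → ℝ} (hf : ∀ k, MemLp (f k) 2 μ) (hf₀ : MemLp f₀ 2 μ)
    (hw : MemLp w 2 μ) (hg : ∀ k, AEStronglyMeasurable (g k) μ)
    (hgw : ∀ k, ∀ᵐ x ∂μ, |g k x| ≤ w x)
    (hg₀ : ∀ᵐ x ∂μ, Tendsto (fun k => g k x) atTop (𝓝 (g₀ x)))
    (h : Tendsto (fun k => eLpNorm (fun x => f k x - f₀ x) 2 μ) atTop (𝓝 0)) :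
    Tendsto (fun k => ∫ x, f k x * g k x ∂μ) atTop (𝓝 (∫ x, f₀ x * g₀ x ∂μ)) := by
  have hgL : ∀ k, MemLp (g k) 2 μ := fun k => hw.mono' (hg k) (by simpa using hgw k)
  have t1 : Tendsto (fun k => ∫ x, |f k x - f₀ x| * w x ∂μ) atTop (𝓝 0) := by
    have := tendsto_integral_mul_of_L2 (f := fun k x => |f k x - f₀ x|) (f₀ := fun _ => 0)
      (fun k => ((hf k).sub hf₀).norm) MemLp.zero' hw (by
        refine h.congr fun k => ?_
        rw [← eLpNorm_norm]; simp)
    simpa using this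
  have t2 : Tendsto (fun k => ∫ x, (f k x - f₀ x) * g k x ∂μ) atTop (𝓝 0) := by
    refine squeeze_zero_norm (fun k => ?_) t1
    refine (norm_integral_le_integral_norm _).trans ?_
    refine integral_mono_ae (integrable_mul_of_memLp_two ((hf k).sub hf₀) (hgL k)).norm
      (integrable_mul_of_memLp_two ((hf k).sub hf₀).norm hw) ?_
    filter_upwards [hgw k] with x hx
    simp only [norm_mul, Real.norm_eq_abs]
    exact mul_le_mul_of_nonneg_left hx (abs_nonneg _)
  have t3 : Tendsto (fun k => ∫ x, f₀ x * g k x ∂μ) atTop (𝓝 (∫ x, f₀ x * g₀ x ∂μ)) := by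
    refine tendsto_integral_of_dominated_convergence (fun x => |f₀ x| * w x)
      (fun k => hf₀.1.mul (hg k)) (integrable_mul_of_memLp_two hf₀.norm hw) (fun k => ?_) ?_
    · filter_upwards [hgw k] with x hx
      simp only [norm_mul, Real.norm_eq_abs]
      exact mul_le_mul_of_nonneg_left hx (abs_nonneg _)
    · filter_upwards [hg₀] with x hx using hx.const_mul _
  have := t2.add t3
  rw [zero_add] at this
  refine this.congr fun k => ?_
  have h1 : Integrable (fun x => (f k x - f₀ x) * g k x) μ :=
    integrable_mul_of_memLp_two ((hf k).sub hf₀) (hgL k)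
  rw [← integral_add h1 (integrable_mul_of_memLp_two hf₀ (hgL k))]
  congr 1; ext x; simp [sub_mul]

/-- Matrix functions that are, locally, bounded below by a positive multiple of the identity. -/
def LocCoercive (Ω : Set (Euc n)) (G : Euc n → Matrix (Fin n) (Fin n) ℝ) : Prop :=
  ∀ K ⊆ Ω, IsCompact K → ∃ c : ℝ, 0 < c ∧
    ∀ᵐ y ∂(volume.restrict K), ∀ ξ : Fin n → ℝ, c * (ξ ⬝ᵥ ξ) ≤ ξ ⬝ᵥ (G y).mulVec ξ

theorem LocCoercive.bddLoc_inv {G : Euc n → Matrix (Fin n) (Fin n) ℝ} (h : LocCoercive Ω G)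
    (hG : ∀ a b, BddLoc Ω fun y => G y a b) (a b : Fin n) : BddLoc Ω fun y => (G y)⁻¹ a b := by
  intro K hK hc
  obtain ⟨c, hc0, hcK⟩ := h K hK hc
  refine memLp_top_of_bound (aestronglyMeasurable_inv_entry (fun a b => (hG a b K hK hc).1) a b)
    c⁻¹ ?_
  filter_upwards [hcK] with y hy using coercive_inv_le hc0 hy a b

theorem moll_nonneg_ae (k : ℕ) {f : Euc n → ℝ} (hf : ∀ᵐ x, 0 ≤ f x) (x : Euc n) :
    0 ≤ moll k f x := by
  rw [moll_apply']
  refine integral_nonneg_of_ae ?_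
  filter_upwards [hf] with t ht using mul_nonneg ((bump n k).nonneg_normed _) ht

theorem dotProduct_mulVec_sum (A : Matrix (Fin n) (Fin n) ℝ) (ξ : Fin n → ℝ) :
    ξ ⬝ᵥ A.mulVec ξ = ∑ p : Fin n × Fin n, (ξ p.1 * ξ p.2) * A p.1 p.2 := by
  simp only [dotProduct, Matrix.mulVec, Fintype.sum_prod_type, Finset.mul_sum]
  refine Finset.sum_congr rfl fun a _ => Finset.sum_congr rfl fun b _ => by ring

theorem locallyIntegrableOn_finset_sum {ι : Type*} (s : Finset ι) {U : ι → Euc n → ℝ}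
    (h : ∀ a ∈ s, LocallyIntegrableOn (U a) Ω) :
    LocallyIntegrableOn (fun y => ∑ a ∈ s, U a y) Ω := by
  classical
  induction s using Finset.induction_on with
  | empty => simpa using locallyIntegrable_zero.locallyIntegrableOn Ω
  | insert a s ha ih =>
    simp only [Finset.sum_insert ha]
    exact (h a (by simp)).add (ih fun b hb => h b (by simp [hb]))

theorem sum_mul_smul_one (c : ℝ) (ξ : Fin n → ℝ) :
    ∑ p : Fin n × Fin n, ξ p.1 * ξ p.2 * (c * (1 : Matrix (Fin n) (Fin n) ℝ) p.1 p.2) =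
      c * (ξ ⬝ᵥ ξ) := by
  simp only [Fintype.sum_prod_type, dotProduct, Finset.mul_sum, Matrix.one_apply, mul_ite, mul_one,
    mul_zero, Finset.sum_ite_eq, Finset.mem_univ, if_true]
  exact Finset.sum_congr rfl fun a _ => by ring

/-- The weak derivative of the inverse of a matrix function in `W^{1,2}_loc ∩ L^∞_loc`. -/
theorem IsWeakPartial.inv_entry (hΩ : IsOpen Ω) {G dG : Euc n → Matrix (Fin n) (Fin n) ℝ}
    (hG : ∀ a b, IsWeakPartial Ω i (fun y => G y a b) fun y => dG y a b)
    (hb : ∀ a b, BddLoc Ω fun y => G y a b) (hd : ∀ a b, L2Loc Ω fun y => dG y a b)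
    (hco : LocCoercive Ω G) (a b : Fin n) :
    IsWeakPartial Ω i (fun y => (G y)⁻¹ a b)
      fun y => -∑ c, ∑ d, (G y)⁻¹ a c * dG y c d * (G y)⁻¹ d b := by
  have hB := hco.bddLoc_inv hb
  have hloc : ∀ c d, LocallyIntegrableOn (fun y => (G y)⁻¹ a c * dG y c d * (G y)⁻¹ d b) Ω :=
    fun c d => ((hB a c).mul_l2Loc (hd c d)).mul hΩ (hB d b).l2Loc
  refine .of_test ((hB a b).l2Loc.locallyIntegrableOn hΩ)
    (LocallyIntegrableOn.neg (locallyIntegrableOn_finset_sum _ fun c _ =>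
      locallyIntegrableOn_finset_sum _ fun d _ => hloc c d)) fun η hη => ?_
  obtain ⟨θ, hθ, hθ1, hθ01⟩ := exists_isTest_one_nhds hΩ hη.compact hη.subset
  have hθ1' : ∀ y ∈ tsupport η, θ y = 1 := fun y hy =>
    (eventually_nhdsSet_iff_forall.1 hθ1 y hy).self_of_nhds
  obtain ⟨c, hc, hcK⟩ := hco (tsupport θ) hθ.subset hθ.compact
  -- Direct mollification of `θ G` would lose positivity where `θ` vanishes. Subtracting `c` times
  -- the identity first leaves `θ (G - c)`, which is positive semidefinite everywhere. Its
  -- mollification stays so, and adding `c` back gives smooth matrices with the same lower bound on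
  -- the whole space.
  set δ : Fin n → Fin n → ℝ := fun p q => c * (1 : Matrix (Fin n) (Fin n) ℝ) p q with hδ
  set D : Fin n → Fin n → Euc n → ℝ := fun p q y => G y p q - δ p q with hD
  have hDw : ∀ p q, IsWeakPartial Ω i (D p q) fun y => dG y p q := fun p q => by
    have h1 := (IsWeakPartial.of_contDiffOn (i := i) hΩ
      (a := fun _ => δ p q) contDiffOn_const)
    simpa [pd_const] using (hG p q).sub hΩ h1
  have hD2 : ∀ p q, L2Loc Ω (D p q) := fun p q =>
    (hb p q).l2Loc.sub (BddLoc.of_continuousOn continuousOn_const).l2Loc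
  set V : Fin n → Fin n → Euc n → ℝ := fun p q y => θ y * D p q y with hV
  set V' : Fin n → Fin n → Euc n → ℝ := fun p q y => pd i θ y * D p q y + θ y * dG y p q with hV'
  have hVw : ∀ p q, IsWeakPartial univ i (V p q) (V' p q) := fun p q => (hDw p q).test_mul hθ
  have hVl : ∀ p q, LocallyIntegrable (V p q) := fun p q => locallyIntegrableOn_univ.1 (hVw p q).1
  have hV'l : ∀ p q, LocallyIntegrable (V' p q) := fun p q =>
    locallyIntegrableOn_univ.1 (hVw p q).2.1
  have hV'2 : ∀ p q, MemLp (V' p q) 2 := fun p q =>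
    ((hD2 p q).test_mul (hθ.pd i).smooth.continuous (hθ.pd i).compact (hθ.pd i).subset).add
      ((hd p q).test_mul hθ.smooth.continuous hθ.compact hθ.subset)
  have hV'c : ∀ p q, HasCompactSupport (V' p q) := fun p q =>
    (hθ.pd i).compact.mul_right.add hθ.compact.mul_right
  -- the smooth approximations of `G` near the support of `η`
  set Gk : ℕ → Euc n → Matrix (Fin n) (Fin n) ℝ := fun k y =>
    Matrix.of fun p q => δ p q + moll k (V p q) y with hGk
  -- For fixed `ξ` the quadratic form of the mollified part is the mollification of the nonnegative
  -- function `θ (ξ · Gξ - c |ξ|²)`.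
  have hGkc : ∀ k y (ξ : Fin n → ℝ), c * (ξ ⬝ᵥ ξ) ≤ ξ ⬝ᵥ (Gk k y).mulVec ξ := by
    intro k y ξ
    have h1 : ξ ⬝ᵥ (Gk k y).mulVec ξ = c * (ξ ⬝ᵥ ξ) +
        moll k (fun y => ∑ p : Fin n × Fin n, (ξ p.1 * ξ p.2) * V p.1 p.2 y) y := by
      rw [moll_sum k Finset.univ (fun p : Fin n × Fin n => ξ p.1 * ξ p.2) (fun p _ => hVl p.1 p.2),
        dotProduct_mulVec_sum]
      simp only [hGk, Matrix.of_apply, mul_add, Finset.sum_add_distrib]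
      rw [← sum_mul_smul_one]
    rw [h1, le_add_iff_nonneg_right]
    refine moll_nonneg_ae k ?_ y
    rw [ae_restrict_iff' (isClosed_tsupport θ).measurableSet] at hcK
    filter_upwards [hcK] with z hz
    by_cases hzθ : z ∈ tsupport θ
    · have h2 := hz hzθ ξ
      have h3 : ∑ p : Fin n × Fin n, (ξ p.1 * ξ p.2) * V p.1 p.2 z =
          θ z * (ξ ⬝ᵥ (G z).mulVec ξ - c * (ξ ⬝ᵥ ξ)) := by
        rw [← sum_mul_smul_one, dotProduct_mulVec_sum, ← Finset.sum_sub_distrib, Finset.mul_sum]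
        refine Finset.sum_congr rfl fun p _ => ?_
        simp only [hV, hD, hδ]; ring
      rw [h3]
      exact mul_nonneg (hθ01 z).1 (by linarith)
    · simp [hV, image_eq_zero_of_notMem_tsupport hzθ]
  have hGks : ∀ k p q, ContDiffOn ℝ ∞ (fun y => Gk k y p q) univ := fun k p q =>
    (contDiff_const.add (moll_contDiff k (hVl p q))).contDiffOn
  have hGkd : ∀ k y, (Gk k y).det ≠ 0 := fun k y => coercive_det_ne_zero hc (hGkc k y)
  have hGkp : ∀ k p q y, pd i (fun y => Gk k y p q) y = moll k (V' p q) y := by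
    intro k p q y
    rw [← pd_moll k (hVw p q)]
    simp only [hGk, Matrix.of_apply]
    rw [pd_add (differentiableAt_const _) ((moll_contDiff k (hVl p q)).differentiable (by simp) y),
      pd_const, zero_add]
  have hBks : ∀ k p q, ContDiff ℝ ∞ fun y => (Gk k y)⁻¹ p q := fun k p q =>
    contDiffOn_univ.1 (contDiffOn_inv_entry (hGks k) (fun y _ => hGkd k y) p q)
  have hBkle : ∀ k p q y, |(Gk k y)⁻¹ p q| ≤ c⁻¹ := fun k p q y => coercive_inv_le hc (hGkc k y) p q
  -- Where `θ = 1` the approximations converge to `G` almost everywhere, and inversion is continuous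
  -- at an invertible matrix.
  have hBklim : ∀ᵐ y, y ∈ tsupport η → ∀ p q,
      Tendsto (fun k => (Gk k y)⁻¹ p q) atTop (𝓝 ((G y)⁻¹ p q)) := by
    have h1 : ∀ᵐ y, ∀ p q, Tendsto (fun k => moll k (V p q) y) atTop (𝓝 (V p q y)) :=
      ae_all_iff.2 fun p => ae_all_iff.2 fun q => moll_ae_tendsto (hVl p q)
    rw [ae_restrict_iff' (isClosed_tsupport θ).measurableSet] at hcK
    filter_upwards [h1, hcK] with y hy1 hy2 hyη p q
    have hyθ : y ∈ tsupport θ :=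
      subset_tsupport θ (by simp [hθ1' y hyη])
    refine tendsto_inv_entry (fun p q => ?_) (coercive_det_ne_zero hc (hy2 hyθ)) p q
    have := (hy1 p q).const_add (δ p q)
    simpa [hGk, hV, hD, hθ1' y hyη] using this
  have hk : ∀ k, ∫ y, (Gk k y)⁻¹ a b * fderiv ℝ η y (stdVec i) =
      ∑ p, ∑ q, ∫ y, moll k (V' p q) y * ((Gk k y)⁻¹ a p * (Gk k y)⁻¹ q b * η y) := by
    intro k
    have h1 := (IsWeakPartial.of_contDiffOn (i := i) hΩ (hBks k a b).contDiffOn).integral_eq hη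
    rw [h1, ← integral_neg]
    have hint : ∀ p q, Integrable fun y =>
        moll k (V' p q) y * ((Gk k y)⁻¹ a p * (Gk k y)⁻¹ q b * η y) := fun p q =>
      (((moll_contDiff k (hV'l p q)).continuous.mul (((hBks k a p).continuous.mul
        (hBks k q b).continuous).mul hη.smooth.continuous))).integrable_of_hasCompactSupport
        (hη.compact.mul_left.mul_left)
    simp only [← integral_finsetSum _ fun q _ => hint _ q]
    rw [← integral_finsetSum _ fun p _ => integrable_finsetSum _ fun q _ => hint p q]
    refine integral_congr_ae (Eventually.of_forall fun y => ?_)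
    simp only [pd_inv_entry isOpen_univ (mem_univ y) (hGks k) (fun y _ => hGkd k y), hGkp]
    rw [neg_mul, neg_neg, Finset.sum_mul]
    refine Finset.sum_congr rfl fun p _ => ?_
    rw [Finset.sum_mul]
    exact Finset.sum_congr rfl fun q _ => by ring
  have l1 : Tendsto (fun k => ∫ y, (Gk k y)⁻¹ a b * fderiv ℝ η y (stdVec i)) atTop
      (𝓝 (∫ y, (G y)⁻¹ a b * fderiv ℝ η y (stdVec i))) := by
    have hint : Integrable (pd i η) :=
      (hη.pd i).smooth.continuous.integrable_of_hasCompactSupport (hη.pd i).compact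
    refine tendsto_integral_of_dominated_convergence (fun y => c⁻¹ * |pd i η y|) (fun k =>
      ((hBks k a b).continuous.mul (hη.pd i).smooth.continuous).aestronglyMeasurable)
      (hint.norm.const_mul _) (fun k => Eventually.of_forall fun y => ?_) ?_
    · rw [norm_mul]
      exact mul_le_mul_of_nonneg_right (hBkle k a b y) (norm_nonneg _)
    · filter_upwards [hBklim] with y hy
      by_cases hyη : y ∈ tsupport η
      · exact (hy hyη a b).mul_const _
      · have : fderiv ℝ η y (stdVec i) = 0 :=
          image_eq_zero_of_notMem_tsupport (f := pd i η) fun h => hyη (tsupport_pd_subset η i h)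
        simp [this]
  -- The derivative converges only in `L²`, while the inverses converge almost everywhere and are
  -- bounded by `c⁻¹`; the dominating function is therefore `c⁻² |η|`.
  have l2 : ∀ p q, Tendsto (fun k => ∫ y, moll k (V' p q) y *
      ((Gk k y)⁻¹ a p * (Gk k y)⁻¹ q b * η y)) atTop
      (𝓝 (∫ y, V' p q y * ((G y)⁻¹ a p * (G y)⁻¹ q b * η y))) := by
    intro p q
    have hw : MemLp (fun y => c⁻¹ * c⁻¹ * |η y|) 2 :=
      (continuous_const.mul hη.smooth.continuous.abs).memLp_of_hasCompactSupport
        (hη.compact.comp_left (g := abs) abs_zero).mul_left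
    refine tendsto_integral_mul_of_L2_of_bound (fun k => moll_memLp k (hV'l p q) (hV'c p q))
      (hV'2 p q) hw (fun k => (((hBks k a p).continuous.mul
        (hBks k q b).continuous).mul hη.smooth.continuous).aestronglyMeasurable)
      (fun k => Eventually.of_forall fun y => ?_) ?_ (moll_tendsto_L2 (hV'2 p q))
    · rw [abs_mul, abs_mul]
      gcongr
      · exact hBkle k a p y
      · exact hBkle k q b y
    · filter_upwards [hBklim] with y hy
      by_cases hyη : y ∈ tsupport η
      · exact ((hy hyη a p).mul (hy hyη q b)).mul_const _
      · simp [image_eq_zero_of_notMem_tsupport hyη]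
  have hlim := tendsto_nhds_unique (l1.congr hk)
    (tendsto_finsetSum _ fun p _ => tendsto_finsetSum _ fun q _ => l2 p q)
  have e : ∀ p q y, V' p q y * ((G y)⁻¹ a p * (G y)⁻¹ q b * η y) =
      (G y)⁻¹ a p * dG y p q * (G y)⁻¹ q b * η y := by
    intro p q y
    by_cases hy : y ∈ tsupport η
    · simp only [hV', hθ1' y hy, pd_eq_zero_of_one_nhds hθ1 hy]; ring
    · simp [image_eq_zero_of_notMem_tsupport hy]
  simp only [e] at hlim
  rw [hlim, ← integral_neg]
  have hint : ∀ p q, Integrable fun y => (G y)⁻¹ a p * dG y p q * (G y)⁻¹ q b * η y :=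
    fun p q => hη.integrable_mul (hloc p q)
  simp only [← integral_finsetSum _ fun q _ => hint _ q]
  rw [← integral_finsetSum _ fun p _ => integrable_finsetSum _ fun q _ => hint p q]
  refine integral_congr_ae (Eventually.of_forall fun y => ?_)
  simp only [neg_mul, neg_neg, Finset.sum_mul]

end

section

variable {n : ℕ} {Ω : Set (Euc n)} {i : Fin n} {u v : Euc n → ℝ}

/-! ### Change of variables -/

/-- A diffeomorphism between open subsets of the model space. -/
structure IsDiffeo (F : OpenPartialHomeomorph (Euc n) (Euc n)) : Prop where
  smooth : ContDiffOn ℝ ∞ F F.source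
  smooth_symm : ContDiffOn ℝ ∞ F.symm F.target

theorem IsDiffeo.symm {F : OpenPartialHomeomorph (Euc n) (Euc n)} (h : IsDiffeo F) :
    IsDiffeo F.symm := ⟨h.smooth_symm, by simpa using h.smooth⟩

/-- The Jacobian matrix `(∂_a F^i)_{ia}`. -/
def jac (F : Euc n → Euc n) (y : Euc n) : Matrix (Fin n) (Fin n) ℝ :=
  Matrix.of fun i a => fderiv ℝ F y (stdVec a) i

theorem sum_stdVec (w : Euc n) : ∑ j, w j • stdVec j = w := by
  ext k
  simp [Pi.single_apply]

theorem fderiv_apply_eq_jac (F : Euc n → Euc n) (y w : Euc n) (i : Fin n) :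
    fderiv ℝ F y w i = ∑ a, jac F y i a * w a := by
  conv_lhs => rw [← sum_stdVec w]
  simp only [map_sum, map_smul, jac, Matrix.of_apply]
  simp [mul_comm]

theorem fderiv_stdVec_eq_sum (F : Euc n → Euc n) (y : Euc n) (a : Fin n) :
    fderiv ℝ F y (stdVec a) = ∑ i, jac F y i a • stdVec i :=
  (sum_stdVec _).symm

theorem det_fderiv_eq (F : Euc n → Euc n) (y : Euc n) : (fderiv ℝ F y).det = (jac F y).det := by
  rw [ContinuousLinearMap.det,
    ← LinearMap.det_toMatrix (EuclideanSpace.basisFun (Fin n) ℝ).toBasis]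
  congr 1

theorem jac_contDiffOn {F : Euc n → Euc n} (hΩ : IsOpen Ω) (hF : ContDiffOn ℝ ∞ F Ω)
    (i a : Fin n) : ContDiffOn ℝ ∞ (fun y => jac F y i a) Ω := by
  have h1 : ContDiffOn ℝ ∞ (fun y => fderiv ℝ F y (stdVec a)) Ω :=
    (hF.fderiv_of_isOpen hΩ (m := ∞) (by simp)).clm_apply contDiffOn_const
  exact (contDiffOn_euclidean.1 h1) i

theorem jac_comp {F H : Euc n → Euc n} {y : Euc n} (hH : DifferentiableAt ℝ H (F y))
    (hF : DifferentiableAt ℝ F y) : jac (H ∘ F) y = jac H (F y) * jac F y := by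
  ext i a
  rw [jac, Matrix.of_apply, fderiv_comp y hH hF, ContinuousLinearMap.comp_apply,
    fderiv_apply_eq_jac, Matrix.mul_apply]
  rfl

theorem pd_comp {F : Euc n → Euc n} {y : Euc n} (hu : DifferentiableAt ℝ u (F y))
    (hF : DifferentiableAt ℝ F y) (a : Fin n) :
    pd a (fun z => u (F z)) y = ∑ j, jac F y j a * pd j u (F y) := by
  have : fderiv ℝ (fun z => u (F z)) y = (fderiv ℝ u (F y)).comp (fderiv ℝ F y) :=
    fderiv_comp y hu hF
  rw [pd, this, ContinuousLinearMap.comp_apply, fderiv_stdVec_eq_sum]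
  simp [pd]

namespace IsDiffeo

variable {F : OpenPartialHomeomorph (Euc n) (Euc n)} (hF : IsDiffeo F)

include hF

theorem differentiableAt {y : Euc n} (hy : y ∈ F.source) : DifferentiableAt ℝ F y :=
  (hF.smooth.contDiffAt (F.open_source.mem_nhds hy)).differentiableAt (by simp)

theorem jac_symm_mul {y : Euc n} (hy : y ∈ F.source) : jac F.symm (F y) * jac F y = 1 := by
  rw [← jac_comp (hF.symm.differentiableAt (F.map_source hy)) (hF.differentiableAt hy)]
  have : (F.symm ∘ F : Euc n → Euc n) =ᶠ[𝓝 y] id := by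
    filter_upwards [F.open_source.mem_nhds hy] with z hz using F.left_inv hz
  ext i a
  simp [jac, this.fderiv_eq, Matrix.one_apply]

theorem det_jac_ne_zero {y : Euc n} (hy : y ∈ F.source) : (jac F y).det ≠ 0 := by
  intro h
  have := congrArg Matrix.det (hF.jac_symm_mul hy)
  simp [h] at this

theorem det_fderiv_ne_zero {y : Euc n} (hy : y ∈ F.source) : (fderiv ℝ F y).det ≠ 0 := by
  rw [det_fderiv_eq]; exact hF.det_jac_ne_zero hy

theorem contDiffOn_abs_det : ContDiffOn ℝ ∞ (fun y => |(fderiv ℝ F y).det|) F.source := by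
  simp only [det_fderiv_eq]
  exact (contDiffOn_det fun i a => jac_contDiffOn F.open_source hF.smooth i a).abs
    fun y hy => hF.det_jac_ne_zero hy

theorem locallyIntegrableOn_comp (hu : LocallyIntegrableOn u F.target) :
    LocallyIntegrableOn (fun y => u (F y)) F.source := by
  rw [locallyIntegrableOn_iff F.open_source.isLocallyClosed]
  intro K hK hc
  have himg : IntegrableOn u (F '' K) :=
    hu.integrableOn_compact_subset (by
      rintro _ ⟨y, hy, rfl⟩
      exact F.map_source (hK hy)) (hc.image_of_continuousOn (F.continuousOn.mono hK))
  rw [integrableOn_image_iff_integrableOn_abs_det_fderiv_smul volume hc.measurableSet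
    (fun y hy => (hF.differentiableAt (hK hy)).hasFDerivAt.hasFDerivWithinAt)
    (F.injOn.mono hK)] at himg
  have hcont : ContinuousOn (fun y => |(fderiv ℝ F y).det|⁻¹) K :=
    (hF.contDiffOn_abs_det.continuousOn.mono hK).inv₀ fun y hy =>
      abs_ne_zero.2 (hF.det_fderiv_ne_zero (hK hy))
  refine (himg.continuousOn_mul hcont hc).congr_fun (fun y hy => ?_) hc.measurableSet
  have := abs_ne_zero.2 (hF.det_fderiv_ne_zero (hK hy))
  simp only [smul_eq_mul]
  field_simp

/-- The push-forward of densities along a diffeomorphism. -/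
theorem isTest_push {ζ : Euc n → ℝ} (hζ : IsTest F.source ζ) :
    IsTest F.target
      (F.target.indicator fun z => ζ (F.symm z) * |(fderiv ℝ F.symm z).det|) := by
  set w := F.target.indicator fun z => ζ (F.symm z) * |(fderiv ℝ F.symm z).det| with hw
  have hcK : IsCompact (F '' tsupport ζ) :=
    hζ.compact.image_of_continuousOn (F.continuousOn.mono hζ.subset)
  have hKt : F '' tsupport ζ ⊆ F.target := by
    rintro _ ⟨y, hy, rfl⟩
    exact F.map_source (hζ.subset hy)
  have hsub : Function.support w ⊆ F '' tsupport ζ := by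
    intro z hz
    have hzt : z ∈ F.target := by
      by_contra h
      exact hz (indicator_of_notMem h _)
    refine ⟨F.symm z, ?_, F.right_inv hzt⟩
    by_contra h
    exact hz (by simp [hw, hzt, image_eq_zero_of_notMem_tsupport h])
  have hts : tsupport w ⊆ F '' tsupport ζ := closure_minimal hsub hcK.isClosed
  refine ⟨contDiff_iff_contDiffAt.2 fun z => ?_,
    HasCompactSupport.of_support_subset_isCompact hcK hsub, hts.trans hKt⟩
  by_cases hz : z ∈ F.target
  · have h1 : ContDiffOn ℝ ∞ (fun z => ζ (F.symm z) * |(fderiv ℝ F.symm z).det|) F.target :=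
      (hζ.smooth.comp_contDiffOn hF.smooth_symm).mul hF.symm.contDiffOn_abs_det
    refine (h1.contDiffAt (F.open_target.mem_nhds hz)).congr_of_eventuallyEq ?_
    filter_upwards [F.open_target.mem_nhds hz] with x hx
    simp [hw, hx]
  · have : w =ᶠ[𝓝 z] fun _ => 0 := by
      filter_upwards [hcK.isClosed.isOpen_compl.mem_nhds fun h => hz (hKt h)] with x hx
      by_contra h
      exact hx (hsub h)
    exact contDiffAt_const.congr_of_eventuallyEq this

/-- Change of variables along `F`. This duality is the reason for the Jacobian factor in the
push-forward. -/
theorem integral_mul_push {ζ : Euc n → ℝ} (hζ : tsupport ζ ⊆ F.source) (g : Euc n → ℝ) :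
    ∫ z, g z * F.target.indicator (fun z => ζ (F.symm z) * |(fderiv ℝ F.symm z).det|) z =
      ∫ y, g (F y) * ζ y := by
  have h1 := integral_target_eq_integral_abs_det_fderiv_smul (volume : Measure (Euc n))
    (f := F.symm) (f' := fun z => fderiv ℝ F.symm z)
    (fun z hz => (hF.symm.differentiableAt hz).hasFDerivAt) (fun y => g (F y) * ζ y)
  have h2 : ∫ y in F.symm.target, g (F y) * ζ y = ∫ y, g (F y) * ζ y := by
    refine setIntegral_eq_integral_of_forall_compl_eq_zero fun y hy => ?_
    rw [image_eq_zero_of_notMem_tsupport fun h => hy (hζ h), mul_zero]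
  rw [← h2, h1, ← integral_indicator F.symm.open_source.measurableSet]
  congr 1
  ext z
  by_cases hz : z ∈ F.target
  · have hz' : z ∈ F.symm.source := hz
    rw [indicator_of_mem hz, indicator_of_mem hz', F.right_inv hz, smul_eq_mul]
    ring
  · have hz' : z ∉ F.symm.source := hz
    rw [indicator_of_notMem hz, indicator_of_notMem hz', mul_zero]

/-- The chain rule for weak derivatives under a diffeomorphism. -/
theorem isWeakPartial_comp {du : Fin n → Euc n → ℝ}
    (hu : ∀ j, IsWeakPartial F.target j u (du j)) (hu' : LocallyIntegrableOn u F.target)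
    (a : Fin n) :
    IsWeakPartial F.source a (fun y => u (F y)) fun y => ∑ j, jac F y j a * du j (F y) := by
  have hJ := fun j => jac_contDiffOn F.open_source hF.smooth j a
  have hloc : ∀ j, LocallyIntegrableOn (fun y => jac F y j a * du j (F y)) F.source := fun j =>
    (hF.locallyIntegrableOn_comp (hu j).2.1).continuousOn_mul (hJ j).continuousOn
      F.open_source.isLocallyClosed
  refine .of_test (hF.locallyIntegrableOn_comp hu')
    (locallyIntegrableOn_finset_sum _ fun j _ => hloc j) fun η hη => ?_
  set push : (Euc n → ℝ) → Euc n → ℝ := fun ζ =>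
    F.target.indicator fun z => ζ (F.symm z) * |(fderiv ℝ F.symm z).det| with hpush
  have hζ : ∀ j, IsTest F.source fun y => jac F y j a * η y := fun j =>
    hη.smul F.open_source (hJ j)
  have hW : ∀ j, IsTest F.target (push fun y => jac F y j a * η y) := fun j =>
    hF.isTest_push (hζ j)
  have hP : IsTest F.target (push (pd a η)) := hF.isTest_push (hη.pd a)
  -- Piola's identity: the push-forward of the field `(∂_a F^j) η` has divergence the push-forward
  -- of `∂_a η`. Testing against a smooth `ξ` and pulling back reduces it to the classical chain
  -- rule for `ξ ∘ F`, so the Jacobian determinant is never differentiated.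
  have piola : (fun z => ∑ j, pd j (push fun y => jac F y j a * η y) z)
      =ᵐ[volume.restrict F.target] push (pd a η) := by
    refine ae_eq_of_forall_test F.open_target
      (locallyIntegrableOn_finset_sum _ fun j _ =>
        (pd_continuous (hW j).smooth j).locallyIntegrable.locallyIntegrableOn _)
      (hP.smooth.continuous.locallyIntegrable.locallyIntegrableOn _) fun ξ hξ => ?_
    have e1 : ∫ z, (∑ j, pd j (push fun y => jac F y j a * η y) z) * ξ z =
        -∑ j, ∫ y, pd j ξ (F y) * (jac F y j a * η y) := by
      simp only [Finset.sum_mul]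
      rw [integral_finsetSum _ fun j _ => ((((hW j).pd j).mono (subset_univ _)).integrable_mul
        (hξ.smooth.continuous.locallyIntegrable.locallyIntegrableOn univ)).congr
          (Eventually.of_forall fun _ => mul_comm _ _), ← Finset.sum_neg_distrib]
      refine Finset.sum_congr rfl fun j _ => ?_
      have h1 := (IsWeakPartial.of_contDiffOn (i := j) isOpen_univ
        hξ.smooth.contDiffOn).integral_eq ((hW j).mono (subset_univ _))
      rw [hF.integral_mul_push (hζ j).subset] at h1
      rw [← h1]
      congr 1; ext z; rw [mul_comm]; rfl
    have e2 : ∫ z, push (pd a η) z * ξ z = ∫ y, ξ (F y) * pd a η y := by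
      rw [← hF.integral_mul_push (hη.pd a).subset]
      congr 1; ext z; rw [mul_comm]
    have hξF : ContDiffOn ℝ ∞ (fun y => ξ (F y)) F.source := hξ.smooth.comp_contDiffOn hF.smooth
    have h3 := (IsWeakPartial.of_contDiffOn (i := a) F.open_source hξF).integral_eq hη
    have h4 : ∀ j, Integrable fun y => pd j ξ (F y) * (jac F y j a * η y) := fun j =>
      (hζ j).integrable_mul (((hξ.pd j).smooth.continuous.comp_continuousOn
        F.continuousOn).locallyIntegrableOn F.open_source.measurableSet)
    rw [e1, e2, show (∫ y, ξ (F y) * pd a η y) = _ from h3, neg_inj,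
      ← integral_finsetSum _ fun j _ => h4 j]
    refine integral_congr_ae (Eventually.of_forall fun y => ?_)
    by_cases hy : y ∈ F.source
    · simp only [pd_comp (hξ.smooth.differentiable (by simp) _) (hF.differentiableAt hy),
        Finset.sum_mul]
      exact Finset.sum_congr rfl fun j _ => by ring
    · simp [image_eq_zero_of_notMem_tsupport fun h => hy (hη.subset h)]
  -- On the target side all derivatives now fall on test functions, so only the definition of the
  -- weak derivatives of `u` is needed.
  calc ∫ y, u (F y) * fderiv ℝ η y (stdVec a)
      = ∫ z, u z * push (pd a η) z := (hF.integral_mul_push (hη.pd a).subset u).symm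
    _ = ∫ z, u z * ∑ j, pd j (push fun y => jac F y j a * η y) z := by
        refine integral_congr_ae ?_
        rw [Filter.EventuallyEq, ae_restrict_iff' F.open_target.measurableSet] at piola
        filter_upwards [piola] with z hz
        by_cases hzt : z ∈ F.target
        · rw [hz hzt]
        · rw [image_eq_zero_of_notMem_tsupport fun h => hzt (hP.subset h),
            Finset.sum_eq_zero fun j _ =>
              image_eq_zero_of_notMem_tsupport fun h => hzt (((hW j).pd j).subset h)]
    _ = ∑ j, ∫ z, u z * pd j (push fun y => jac F y j a * η y) z := by
        simp only [Finset.mul_sum]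
        exact integral_finsetSum _ fun j _ => ((hW j).pd j).integrable_mul hu'
    _ = ∑ j, -∫ y, du j (F y) * (jac F y j a * η y) := by
        refine Finset.sum_congr rfl fun j _ => ?_
        rw [← hF.integral_mul_push (hζ j).subset]
        exact (hu j).integral_eq (hW j)
    _ = _ := by
        rw [Finset.sum_neg_distrib, ← integral_finsetSum _ fun j _ =>
          (hζ j).integrable_mul (hF.locallyIntegrableOn_comp (hu j).2.1)]
        congr 2; ext y
        rw [Finset.sum_mul]
        exact Finset.sum_congr rfl fun j _ => by ring

end IsDiffeo

end

section

variable {n : ℕ} {M : Type*} [TopologicalSpace M] [ChartedSpace (EuclideanSpace ℝ (Fin n)) M]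
  {φ ψ : OpenPartialHomeomorph M (EuclideanSpace ℝ (Fin n))}

/-! ### Charts -/

theorem mdifferentiable_of_mem_maximalAtlas (hφ : φ ∈ IsManifold.maximalAtlas (𝓡 n) ∞ M) :
    φ.MDifferentiable (𝓡 n) (𝓡 n) :=
  ⟨(contMDiffOn_of_mem_maximalAtlas hφ).mdifferentiableOn (by simp),
    (contMDiffOn_symm_of_mem_maximalAtlas hφ).mdifferentiableOn (by simp)⟩

/-- Transition maps are diffeomorphisms. -/
theorem isDiffeo_transition (hφ : φ ∈ IsManifold.maximalAtlas (𝓡 n) ∞ M)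
    (hψ : ψ ∈ IsManifold.maximalAtlas (𝓡 n) ∞ M) : IsDiffeo (φ.symm.trans ψ) := by
  have key : ∀ {φ ψ : OpenPartialHomeomorph M (EuclideanSpace ℝ (Fin n))},
      φ ∈ IsManifold.maximalAtlas (𝓡 n) ∞ M → ψ ∈ IsManifold.maximalAtlas (𝓡 n) ∞ M →
      ContDiffOn ℝ ∞ (φ.symm.trans ψ) (φ.symm.trans ψ).source := by
    intro φ ψ hφ hψ
    rw [← contMDiffOn_iff_contDiffOn]
    have h1 := contMDiffOn_of_mem_maximalAtlas hψ
    have h2 := contMDiffOn_symm_of_mem_maximalAtlas hφ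
    rw [OpenPartialHomeomorph.trans_source]
    exact h1.comp' h2
  refine ⟨key hφ hψ, ?_⟩
  have := key hψ hφ
  simpa [OpenPartialHomeomorph.trans_symm_eq_symm_trans_symm] using this

theorem mem_transition_source {y : Euc n} :
    y ∈ (φ.symm.trans ψ).source ↔ y ∈ φ.target ∧ φ.symm y ∈ ψ.source := by
  rw [OpenPartialHomeomorph.trans_source]; rfl

theorem transition_symm_apply {y : Euc n} (hy : y ∈ (φ.symm.trans ψ).source) :
    ψ.symm ((φ.symm.trans ψ) y) = φ.symm y :=
  ψ.left_inv (mem_transition_source.1 hy).2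

theorem transition_mem_target {y : Euc n} (hy : y ∈ (φ.symm.trans ψ).source) :
    (φ.symm.trans ψ) y ∈ ψ.target :=
  ψ.map_source (mem_transition_source.1 hy).2

theorem coordVec_injective (hφ : φ ∈ IsManifold.maximalAtlas (𝓡 n) ∞ M) {y : Euc n}
    (hy : y ∈ φ.target) :
    Function.Injective (mfderiv (𝓡 n) (𝓡 n) φ.symm y) :=
  (mdifferentiable_of_mem_maximalAtlas hφ).symm.mfderiv_injective hy

/-- The coordinate vectors, as elements of the model space. -/
def coordVecE (φ : OpenPartialHomeomorph M (EuclideanSpace ℝ (Fin n))) (y : Euc n) (i : Fin n) :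
    Euc n := coordVec φ y i

/-- The chain rule for `φ⁻¹ = ψ⁻¹ ∘ F` near `y`. Both sides are written in the model space because
the base points `φ.symm y` and `ψ.symm (F y)` are equal only by a proof. -/
theorem coordVec_transition (hφ : φ ∈ IsManifold.maximalAtlas (𝓡 n) ∞ M)
    (hψ : ψ ∈ IsManifold.maximalAtlas (𝓡 n) ∞ M) {y : Euc n}
    (hy : y ∈ (φ.symm.trans ψ).source) (a : Fin n) :
    coordVecE φ y a = ∑ i, jac (φ.symm.trans ψ) y i a • coordVecE ψ ((φ.symm.trans ψ) y) i := by
  set F := φ.symm.trans ψ with hF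
  have hev : (φ.symm : Euc n → M) =ᶠ[𝓝 y] ψ.symm ∘ F := by
    filter_upwards [F.open_source.mem_nhds hy] with z hz
    exact (transition_symm_apply hz).symm
  have hFd : DifferentiableAt ℝ F y := (isDiffeo_transition hφ hψ).differentiableAt hy
  have hψd : MDifferentiableAt (𝓡 n) (𝓡 n) ψ.symm (F y) :=
    (mdifferentiable_of_mem_maximalAtlas hψ).mdifferentiableAt_symm (transition_mem_target hy)
  have h1 := hev.mfderiv_eq (I := 𝓡 n) (I' := 𝓡 n)
  have h2 := mfderiv_comp y hψd hFd.mdifferentiableAt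
  have h3 : coordVecE φ y a =
      (mfderiv (𝓡 n) (𝓡 n) ψ.symm (F y) : Euc n →L[ℝ] Euc n) (fderiv ℝ F y (stdVec a)) := by
    change (mfderiv (𝓡 n) (𝓡 n) φ.symm y : Euc n →L[ℝ] Euc n) (stdVec a) = _
    rw [← mfderiv_eq_fderiv]
    exact congrArg (fun L : Euc n →L[ℝ] Euc n => L (stdVec a)) (h1.trans h2)
  have h4 : ∀ L : Euc n →L[ℝ] Euc n, L (∑ i, jac F y i a • stdVec i) =
      ∑ i, jac F y i a • L (stdVec i) := fun L => by simp only [map_sum, map_smul]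
  rw [h3, fderiv_stdVec_eq_sum]
  exact h4 _

/-- Smooth vector fields in the fibres given by coordinate vectors. -/
theorem contMDiffOn_coordVec [IsManifold (𝓡 n) ∞ M]
    (hφ : φ ∈ IsManifold.maximalAtlas (𝓡 n) ∞ M) (i : Fin n) :
    ContMDiffOn (𝓡 n) ((𝓡 n).prod 𝓘(ℝ, Euc n)) ∞
      (fun y => (TotalSpace.mk' (Euc n) (φ.symm y) (coordVec φ y i) : TangentBundle (𝓡 n) M))
      φ.target := by
  have h1 := (contMDiffOn_symm_of_mem_maximalAtlas hφ).contMDiffOn_tangentMapWithin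
    (m := ∞) (by simp) φ.open_target.uniqueMDiffOn
  have h2 : ContMDiffOn (𝓡 n) ((𝓡 n).prod 𝓘(ℝ, Euc n)) ∞
      (fun y : Euc n => (⟨y, stdVec i⟩ : TangentBundle (𝓡 n) (Euc n))) φ.target :=
    contMDiffOn_vectorSpace_iff_contDiffOn.2 contDiffOn_const
  refine (h1.comp h2 fun y hy => hy).congr fun y hy => ?_
  simp only [Function.comp_def, tangentMapWithin, coordVec]
  rw [mfderivWithin_of_isOpen φ.open_target hy]

theorem contDiffOn_coordMatrix_smooth [IsManifold (𝓡 n) ∞ M]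
    (hφ : φ ∈ IsManifold.maximalAtlas (𝓡 n) ∞ M)
    (h : SmoothMetric n M) (i j : Fin n) :
    ContDiffOn ℝ ∞ (fun y => coordMatrix φ h.inner y i j) φ.target := by
  rw [← contMDiffOn_iff_contDiffOn]
  have h1 := h.contMDiff.comp_contMDiffOn (contMDiffOn_symm_of_mem_maximalAtlas hφ)
  have h2 : ContMDiffOn (𝓡 n) ((𝓡 n).prod 𝓘(ℝ, ℝ)) ∞ (fun y => TotalSpace.mk' ℝ
      (E := Bundle.Trivial M ℝ) (φ.symm y)
      (h.inner (φ.symm y) (coordVec φ y i) (coordVec φ y j))) φ.target :=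
    ContMDiffOn.clm_bundle_apply₂ (F₁ := Euc n) (F₂ := Euc n) h1 (contMDiffOn_coordVec hφ i)
      (contMDiffOn_coordVec hφ j)
  intro y hy
  have h3 := h2 y hy
  rw [contMDiffWithinAt_totalSpace] at h3
  exact h3.2

theorem coordMatrix_transition (hφ : φ ∈ IsManifold.maximalAtlas (𝓡 n) ∞ M)
    (hψ : ψ ∈ IsManifold.maximalAtlas (𝓡 n) ∞ M) (b : BilinField n M) {y : Euc n}
    (hy : y ∈ (φ.symm.trans ψ).source) (p q : Fin n) :
    coordMatrix φ b y p q = ∑ i, ∑ j, jac (φ.symm.trans ψ) y i p * jac (φ.symm.trans ψ) y j q *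
      coordMatrix ψ b ((φ.symm.trans ψ) y) i j := by
  set F := φ.symm.trans ψ with hF
  have hx : ψ.symm (F y) = φ.symm y := transition_symm_apply hy
  set β : M → Euc n →L[ℝ] Euc n →L[ℝ] ℝ := b with hβ
  change β (φ.symm y) (coordVecE φ y p) (coordVecE φ y q) = ∑ i, ∑ j, jac F y i p * jac F y j q *
    β (ψ.symm (F y)) (coordVecE ψ (F y) i) (coordVecE ψ (F y) j)
  rw [hx, coordVec_transition hφ hψ hy, coordVec_transition hφ hψ hy]
  have h4 : ∀ (L : Euc n →L[ℝ] Euc n →L[ℝ] ℝ) (c d : Fin n → ℝ) (v : Fin n → Euc n),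
      L (∑ i, c i • v i) (∑ j, d j • v j) = ∑ i, ∑ j, c i * d j * L (v i) (v j) := by
    intro L c d v
    simp only [map_sum, map_smul, sum_apply, smul_apply, smul_eq_mul, Finset.mul_sum]
    rw [Finset.sum_comm]
    exact Finset.sum_congr rfl fun i _ => Finset.sum_congr rfl fun j _ => by ring
  exact h4 _ _ _ _

end

section

variable {n : ℕ} {M : Type*} [TopologicalSpace M] [ChartedSpace (EuclideanSpace ℝ (Fin n)) M]
  {φ ψ : OpenPartialHomeomorph M (EuclideanSpace ℝ (Fin n))}

/-! ### Pointwise Riemannian algebra -/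

/-- The value of a `(0,2)`-tensor field at a point, as a bilinear form on the model space. -/
def formAt (b : BilinField n M) (x : M) : Euc n →L[ℝ] Euc n →L[ℝ] ℝ := b x

theorem bilin_eq_sum (L : Euc n →L[ℝ] Euc n →L[ℝ] ℝ) (v w : Euc n) :
    L v w = ∑ i, ∑ j, v i * w j * L (stdVec i) (stdVec j) := by
  conv_lhs => rw [← sum_stdVec v, ← sum_stdVec w]
  simp only [map_sum, map_smul, sum_apply, smul_apply, smul_eq_mul, Finset.mul_sum]
  rw [Finset.sum_comm]
  exact Finset.sum_congr rfl fun i _ => Finset.sum_congr rfl fun j _ => by ring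

theorem gram_apply (b : BilinField n M) (x : M) (i j : Fin n) :
    gram b x i j = formAt b x (stdVec i) (stdVec j) := rfl

theorem formAt_eq_dotProduct (b : BilinField n M) (x : M) (v w : Euc n) :
    formAt b x v w = (⇑v) ⬝ᵥ (gram b x).mulVec w := by
  rw [bilin_eq_sum]
  simp only [dotProduct, Matrix.mulVec, Finset.mul_sum, gram_apply]
  exact Finset.sum_congr rfl fun i _ => Finset.sum_congr rfl fun j _ => by ring

theorem formAt_pos (h : RoughMetric n M) (x : M) {v : Euc n} (hv : v ≠ 0) :
    0 < formAt h.inner x v v := h.pos x v hv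

theorem formAt_symm (h : RoughMetric n M) (x : M) (v w : Euc n) :
    formAt h.inner x v w = formAt h.inner x w v := h.symm x v w

theorem gram_isSymm (h : RoughMetric n M) (x : M) : (gram h.inner x).IsSymm := by
  ext i j
  exact formAt_symm h x _ _

theorem gram_posDef (h : RoughMetric n M) (x : M) : (gram h.inner x).PosDef := by
  refine Matrix.PosDef.of_dotProduct_mulVec_pos ?_ fun ξ hξ => ?_
  · ext i j
    exact formAt_symm h x (stdVec j) (stdVec i)
  · have := formAt_eq_dotProduct h.inner x (WithLp.toLp 2 ξ) (WithLp.toLp 2 ξ)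
    simp only [star_trivial]
    have h2 : (WithLp.toLp 2 ξ : Euc n) ≠ 0 := by simpa using hξ
    have h3 := formAt_pos h x h2
    rw [this] at h3
    exact h3

theorem gram_isUnit_det (h : RoughMetric n M) (x : M) : IsUnit (gram h.inner x).det :=
  (gram_posDef h x).det_pos.ne'.isUnit

open scoped MatrixOrder Matrix.Norms.L2Operator in
/-- A frame that is orthonormal for `h`, with its dual expansion. -/
theorem exists_frame (h : RoughMetric n M) (x : M) : ∃ C : Matrix (Fin n) (Fin n) ℝ,
    (gram h.inner x)⁻¹ = C.transpose * C ∧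
    (∀ v : Euc n, v = ∑ c, formAt h.inner x v (∑ i, C c i • stdVec i) • ∑ i, C c i • stdVec i) ∧
    ∀ v : Euc n, formAt h.inner x v v =
      ∑ c, formAt h.inner x v (∑ i, C c i • stdVec i) ^ 2 := by
  -- The inverse Gram matrix is positive, hence of the form `Cᵀ C`. The rows of `C` are the frame,
  -- and its expansion is `v = v G Cᵀ C`.
  obtain ⟨C, hC⟩ := CStarAlgebra.nonneg_iff_eq_star_mul_self.1
    (gram_posDef h x).inv.posSemidef.nonneg
  rw [Matrix.star_eq_conjTranspose] at hC
  have hC' : (gram h.inner x)⁻¹ = C.transpose * C := by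
    rw [hC, Matrix.conjTranspose_eq_transpose_of_trivial]
  set G := gram h.inner x with hG
  have hexp : ∀ v : Euc n, v = ∑ c, formAt h.inner x v (∑ i, C c i • stdVec i) •
      ∑ i, C c i • stdVec i := by
    intro v
    have h1 : ∀ c, formAt h.inner x v (∑ i, C c i • stdVec i) = ∑ j, ∑ i, v j * G j i * C c i := by
      intro c
      rw [bilin_eq_sum, ]
      refine Finset.sum_congr rfl fun j _ => Finset.sum_congr rfl fun i _ => ?_
      rw [hG, gram_apply]
      have : (∑ i, C c i • stdVec i : Euc n) i = C c i := by
        simp [Pi.single_apply]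
      rw [this]; ring
    have h3 : Matrix.vecMul v (G * (C.transpose * C)) = v := by
      rw [← hC', Matrix.mul_nonsing_inv _ (gram_isUnit_det h x), Matrix.vecMul_one]
    ext k
    rw [← congrFun h3 k, ← Matrix.mul_assoc, ← Matrix.vecMul_vecMul]
    simp only [h1, WithLp.ofLp_sum, Finset.sum_apply, WithLp.ofLp_smul, Pi.smul_apply, smul_eq_mul]
    simp only [Matrix.vecMul, dotProduct, Matrix.mul_apply, Matrix.transpose_apply]
    refine Finset.sum_congr rfl fun c _ => ?_
    congr 1
    · refine Finset.sum_congr rfl fun j _ => ?_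
      rw [Finset.mul_sum]
      exact Finset.sum_congr rfl fun i _ => by ring
    · simp
  refine ⟨C, hC', hexp, fun v => ?_⟩
  have e := congrArg (formAt h.inner x v) (hexp v)
  rw [map_sum] at e
  rw [e]
  refine Finset.sum_congr rfl fun c _ => ?_
  rw [map_smul, smul_eq_mul, sq]

/-- The tensor norm bounds the components of a tensor. -/
theorem abs_tensor_le (h : RoughMetric n M) {m : ℕ} (T : TensorField n M m) (x : M)
    (v : Fin m → Euc n) :
    |T x v| ≤ tensorNorm h T x * ∏ a, Real.sqrt (formAt h.inner x (v a) (v a)) := by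
  obtain ⟨C, hC, hexp, hsq⟩ := exists_frame h x
  set U : MultilinearMap ℝ (fun _ : Fin m => Euc n) ℝ := T x with hU
  set u : Fin n → Euc n := fun c => ∑ i, C c i • stdVec i with hu
  have hUu : ∀ K : Fin m → Fin n, U (fun a => u (K a)) =
      ∑ I : Fin m → Fin n, (∏ a, C (K a) (I a)) * U fun a => stdVec (I a) := by
    intro K
    rw [MultilinearMap.map_sum]
    refine Finset.sum_congr rfl fun I _ => ?_
    rw [MultilinearMap.map_smul_univ, smul_eq_mul]
  -- In the frame the tensor norm is the `ℓ²` norm of the array of components.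
  have hnorm : tensorNorm h T x ^ 2 = ∑ K : Fin m → Fin n, U (fun a => u (K a)) ^ 2 := by
    have e1 : ∑ I : Fin m → Fin n, ∑ J : Fin m → Fin n, (∏ a, (gram h.inner x)⁻¹ (I a) (J a)) *
        T x (fun a => tangentVec x (I a)) * T x (fun a => tangentVec x (J a)) =
        ∑ K : Fin m → Fin n, U (fun a => u (K a)) ^ 2 := by
      simp only [hUu, sq, Finset.sum_mul_sum]
      symm
      rw [Finset.sum_comm]
      refine Finset.sum_congr rfl fun I _ => ?_
      rw [Finset.sum_comm]
      refine Finset.sum_congr rfl fun J _ => ?_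
      symm
      have : ∏ a, (gram h.inner x)⁻¹ (I a) (J a) =
          ∑ K : Fin m → Fin n, ∏ a, C (K a) (I a) * C (K a) (J a) := by
        simp only [hC, Matrix.mul_apply, Matrix.transpose_apply]
        rw [Finset.prod_univ_sum, Fintype.piFinset_univ]
      rw [this, Finset.sum_mul, Finset.sum_mul]
      refine Finset.sum_congr rfl fun K _ => ?_
      rw [Finset.prod_mul_distrib]
      change (_ * U (fun a => stdVec (I a))) * U (fun a => stdVec (J a)) = _
      ring
    rw [tensorNorm, e1, Real.sq_sqrt (Finset.sum_nonneg fun K _ => sq_nonneg _)]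
  have hT : U v = ∑ K : Fin m → Fin n, (∏ a, formAt h.inner x (v a) (u (K a))) *
      U fun a => u (K a) := by
    conv_lhs => rw [show v = fun a => ∑ c, formAt h.inner x (v a) (u c) • u c from
      funext fun a => hexp (v a)]
    rw [MultilinearMap.map_sum]
    refine Finset.sum_congr rfl fun I _ => ?_
    rw [MultilinearMap.map_smul_univ, smul_eq_mul]
  -- Cauchy–Schwarz over multi-indices; the squared coefficients of the `v a` sum to the product of
  -- the squared lengths.
  have hCS := Finset.sum_mul_sq_le_sq_mul_sq Finset.univ
    (fun K : Fin m → Fin n => ∏ a, formAt h.inner x (v a) (u (K a)))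
    (fun K : Fin m → Fin n => U fun a => u (K a))
  rw [← hT, ← hnorm] at hCS
  have hprod : ∑ K : Fin m → Fin n, (∏ a, formAt h.inner x (v a) (u (K a))) ^ 2 =
      (∏ a, Real.sqrt (formAt h.inner x (v a) (v a))) ^ 2 := by
    rw [← Finset.prod_pow]
    have : ∀ a, Real.sqrt (formAt h.inner x (v a) (v a)) ^ 2 =
        ∑ c, formAt h.inner x (v a) (u c) ^ 2 := by
      intro a
      rw [Real.sq_sqrt, hsq]
      rw [hsq]
      exact Finset.sum_nonneg fun c _ => sq_nonneg _
    simp only [this]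
    rw [Finset.prod_univ_sum, Fintype.piFinset_univ]
    exact Finset.sum_congr rfl fun K _ => (Finset.prod_pow _ _ _).symm
  rw [hprod] at hCS
  have : (T x v) ^ 2 ≤ (tensorNorm h T x * ∏ a, Real.sqrt (formAt h.inner x (v a) (v a))) ^ 2 := by
    rw [mul_pow, mul_comm]; exact hCS
  exact abs_le_of_sq_le_sq this (mul_nonneg (Real.sqrt_nonneg _)
    (Finset.prod_nonneg fun a _ => Real.sqrt_nonneg _))

/-- The matrix whose columns are the coordinate vectors. -/
def frameMatrix (φ : OpenPartialHomeomorph M (EuclideanSpace ℝ (Fin n))) (y : Euc n) :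
    Matrix (Fin n) (Fin n) ℝ :=
  Matrix.of fun j i => coordVecE φ y i j

theorem coordMatrix_apply (b : BilinField n M) (y : Euc n) (i j : Fin n) :
    coordMatrix φ b y i j = formAt b (φ.symm y) (coordVecE φ y i) (coordVecE φ y j) := rfl

theorem coordMatrix_eq (b : BilinField n M) (y : Euc n) :
    coordMatrix φ b y = (frameMatrix φ y).transpose * gram b (φ.symm y) * frameMatrix φ y := by
  ext i j
  rw [coordMatrix_apply, formAt_eq_dotProduct, Matrix.mul_assoc, Matrix.mul_apply, dotProduct]
  refine Finset.sum_congr rfl fun k _ => ?_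
  rw [Matrix.mul_apply]
  rfl

theorem frameMatrix_det_ne_zero (hφ : φ ∈ IsManifold.maximalAtlas (𝓡 n) ∞ M) {y : Euc n}
    (hy : y ∈ φ.target) : (frameMatrix φ y).det ≠ 0 := by
  intro h0
  obtain ⟨w, hw, hAw⟩ := Matrix.exists_mulVec_eq_zero_iff.2 h0
  have hinj := coordVec_injective hφ hy
  set L : Euc n →L[ℝ] Euc n := mfderiv (𝓡 n) (𝓡 n) φ.symm y with hL
  have h1 : L (WithLp.toLp 2 w) = 0 := by
    have h2 : L (WithLp.toLp 2 w) = ∑ i, w i • coordVecE φ y i := by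
      conv_lhs => rw [← sum_stdVec (WithLp.toLp 2 w)]
      simp only [map_sum, map_smul]
      rfl
    rw [h2]
    ext k
    have := congrFun hAw k
    simp only [Matrix.mulVec, dotProduct, frameMatrix, Matrix.of_apply, Pi.zero_apply] at this
    simp only [WithLp.ofLp_sum, Finset.sum_apply, WithLp.ofLp_smul, Pi.smul_apply, smul_eq_mul]
    refine Eq.trans ?_ this
    exact Finset.sum_congr rfl fun i _ => mul_comm _ _
  have h3 : (WithLp.toLp 2 w : Euc n) = 0 := hinj (h1.trans (map_zero L).symm)
  exact hw (by simpa using h3)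

theorem coordMatrix_pos (hφ : φ ∈ IsManifold.maximalAtlas (𝓡 n) ∞ M) (h : RoughMetric n M)
    {y : Euc n} (hy : y ∈ φ.target) : (coordMatrix φ h.inner y).PosDef := by
  rw [coordMatrix_eq, ← Matrix.conjTranspose_eq_transpose_of_trivial]
  exact (gram_posDef h _).conjTranspose_mul_mul_same
    (Matrix.mulVec_injective_iff_isUnit.2
      ((Matrix.isUnit_iff_isUnit_det _).2 (frameMatrix_det_ne_zero hφ hy).isUnit))

theorem coordMatrix_symm (h : RoughMetric n M) (y : Euc n) (i j : Fin n) :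
    coordMatrix φ h.inner y i j = coordMatrix φ h.inner y j i := formAt_symm h _ _ _

theorem sum_mul_eq_trace (A B : Matrix (Fin n) (Fin n) ℝ) :
    ∑ i, ∑ j, A i j * B i j = (A * B.transpose).trace := by
  simp [Matrix.trace, Matrix.mul_apply]

/-- Traces with respect to a metric can be computed in every chart. -/
theorem sum_gram_inv_mul (hφ : φ ∈ IsManifold.maximalAtlas (𝓡 n) ∞ M) (g : RoughMetric n M)
    (b : BilinField n M) {y : Euc n} (hy : y ∈ φ.target) :
    ∑ i, ∑ j, (gram g.inner (φ.symm y))⁻¹ i j * gram b (φ.symm y) i j =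
      ∑ i, ∑ j, (coordMatrix φ g.inner y)⁻¹ i j * coordMatrix φ b y i j := by
  rw [sum_mul_eq_trace, sum_mul_eq_trace, coordMatrix_eq, coordMatrix_eq]
  have hA := (frameMatrix_det_ne_zero hφ hy).isUnit
  set A := frameMatrix φ y
  have hA' : IsUnit A.transpose.det := by rwa [Matrix.det_transpose]
  rw [Matrix.mul_inv_rev, Matrix.mul_inv_rev, Matrix.transpose_mul, Matrix.transpose_mul,
    Matrix.transpose_transpose]
  rw [show A⁻¹ * ((gram g.inner (φ.symm y))⁻¹ * A.transpose⁻¹) *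
      (A.transpose * ((gram b (φ.symm y)).transpose * A)) =
      A⁻¹ * ((gram g.inner (φ.symm y))⁻¹ * (A.transpose⁻¹ * A.transpose) *
        (gram b (φ.symm y)).transpose * A) by simp only [Matrix.mul_assoc]]
  rw [Matrix.nonsing_inv_mul _ hA', Matrix.mul_one, Matrix.trace_mul_comm A⁻¹, Matrix.mul_assoc,
    Matrix.mul_nonsing_inv _ hA, Matrix.mul_one]

theorem abs_coordComp_le (h : RoughMetric n M) {m : ℕ} (T : TensorField n M m) (I : Fin m → Fin n)
    (y : Euc n) : |coordComp φ T I y| ≤ tensorNorm h T (φ.symm y) *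
      ∏ a, Real.sqrt (coordMatrix φ h.inner y (I a) (I a)) :=
  abs_tensor_le h T (φ.symm y) fun a => coordVecE φ y (I a)

/-- The gradient, as an element of the model space. -/
def gradE (h : RoughMetric n M) (f : M → ℝ) (x : M) : Euc n := gradient h f x

theorem gradient_inner (h : RoughMetric n M) (f : M → ℝ) (x : M) (w : Euc n) :
    formAt h.inner x (gradE h f x) w = differential f x w := by
  set L : Euc n →L[ℝ] ℝ := differential f x with hL
  set G := gram h.inner x with hG
  have h1 : gradE h f x = ∑ i, (∑ j, G⁻¹ i j * L (stdVec j)) • stdVec i := by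
    simp only [Finset.sum_smul]; rfl
  have h2 : ∀ i, gradE h f x i = (G⁻¹.mulVec fun j => L (stdVec j)) i := by
    intro i
    rw [h1]
    simp [Matrix.mulVec, dotProduct, Pi.single_apply]
  rw [formAt_eq_dotProduct, ← hG, show ⇑(gradE h f x) =
    G⁻¹.mulVec (fun j => L (stdVec j)) from funext h2, Matrix.dotProduct_mulVec]
  have hsymm : G⁻¹.transpose = G⁻¹ := by
    rw [Matrix.transpose_nonsing_inv, (gram_isSymm h x).eq]
  rw [← Matrix.vecMul_transpose, hsymm, Matrix.vecMul_vecMul,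
    Matrix.nonsing_inv_mul _ (gram_isUnit_det h x), Matrix.vecMul_one]
  have h3 : L w = ∑ i, w i * L (stdVec i) := by
    conv_lhs => rw [← sum_stdVec w]
    rw [map_sum]
    exact Finset.sum_congr rfl fun i _ => map_smul L _ _
  exact Eq.trans (Finset.sum_congr rfl fun i _ => mul_comm _ _) h3.symm

end

section

variable {n : ℕ}

/-! ### Algebra of the transformation laws -/

/-- The Ricci tensor formed from connection symbols and their first derivatives. -/
def ricciForm (Γ : Fin n → Fin n → Fin n → ℝ) (dΓ : Fin n → Fin n → Fin n → Fin n → ℝ)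
    (i j : Fin n) : ℝ :=
  ∑ k, (dΓ k k i j - dΓ j k i k) + ∑ k, ∑ l, (Γ k k l * Γ l i j - Γ k j l * Γ l i k)

theorem christoffel_comm {G : Matrix (Fin n) (Fin n) ℝ} {dG : Fin n → Matrix (Fin n) (Fin n) ℝ}
    (h : ∀ a i j, dG a i j = dG a j i) (k i j : Fin n) :
    christoffel G dG k i j = christoffel G dG k j i := by
  unfold christoffel
  congr 1
  refine Finset.sum_congr rfl fun l _ => ?_
  rw [h l i j]; ring

/-- The transformation law of the curvature of a connection. -/
theorem curvature_transformation {ι : Type*} {A : Type*} [Ring A] {J : A} {HJ cn' θ : ι → A}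
    {dcn' D S : ι → ι → A} (h1 : ∀ a, J * cn' a = HJ a + θ a * J) (hS : ∀ a c, S c a = S a c)
    (h2 : ∀ a c, HJ c * cn' a + J * dcn' c a = S c a + θ a * HJ c + D c a * J) (a c : ι) :
    J * (dcn' c a - dcn' a c + cn' c * cn' a - cn' a * cn' c) =
      (D c a - D a c + θ c * θ a - θ a * θ c) * J := by
  -- Here `h1` is a change of gauge and `h2` its derivative. Solve the first for `HJ`, substitute in
  -- the second and antisymmetrise in `a` and `c`: the symmetric `S` drops out.
  have hH : ∀ a, HJ a = J * cn' a - θ a * J := fun a => by rw [h1 a]; abel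
  have e : ∀ a c, J * dcn' c a = S c a + θ a * (J * cn' c - θ c * J) + D c a * J -
      (J * cn' c - θ c * J) * cn' a := by
    intro a c
    have := h2 a c
    rw [hH c] at this
    rw [← this]; abel
  have : J * (dcn' c a - dcn' a c + cn' c * cn' a - cn' a * cn' c) =
      J * dcn' c a - J * dcn' a c + J * cn' c * cn' a - J * cn' a * cn' c := by noncomm_ring
  rw [this, e a c, e c a, hS c a]
  noncomm_ring

/-- The transformation law of the Ricci tensor. -/
theorem ricciForm_transformation {J : Matrix (Fin n) (Fin n) ℝ} (hJ : IsUnit J.det)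
    {HJ : Fin n → Matrix (Fin n) (Fin n) ℝ} {T : Fin n → Fin n → Matrix (Fin n) (Fin n) ℝ}
    {Γ Γ' : Fin n → Fin n → Fin n → ℝ} {dΓ dΓ' : Fin n → Fin n → Fin n → Fin n → ℝ}
    (hΓ : ∀ k i j, Γ k i j = Γ k j i) (hΓ' : ∀ k i j, Γ' k i j = Γ' k j i)
    (hHJ : ∀ a b m, HJ a m b = HJ b m a) (hT : ∀ a c, T c a = T a c)
    (h1 : ∀ m a b, ∑ k, J m k * Γ' k b a = HJ a m b + ∑ j, ∑ i, J j a * (Γ m i j * J i b))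
    (h2 : ∀ m a b c, ∑ k, (HJ c m k * Γ' k b a + J m k * dΓ' c k b a) = T c a m b +
      ∑ j, ∑ i, ((HJ c j a * J i b + J j a * HJ c i b) * Γ m i j +
        J j a * J i b * ∑ l, J l c * dΓ l m i j)) (a b : Fin n) :
    ricciForm Γ' dΓ' b a = ∑ q, ∑ i, J q b * J i a * ricciForm Γ dΓ q i := by
  -- The symbols are read as matrices of a connection form, `θ` is the pulled back form, and `S`
  -- collects what is symmetric in `a` and `c`: third derivatives of the coordinate change and the
  -- terms where `J j a` is differentiated.
  set cn : Fin n → Matrix (Fin n) (Fin n) ℝ := fun a => Matrix.of fun k b => Γ k b a with hcn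
  set cn' : Fin n → Matrix (Fin n) (Fin n) ℝ := fun a => Matrix.of fun k b => Γ' k b a with hcnp
  set dcn : Fin n → Fin n → Matrix (Fin n) (Fin n) ℝ := fun c a =>
    Matrix.of fun k b => dΓ c k b a with hdcn
  set dcn' : Fin n → Fin n → Matrix (Fin n) (Fin n) ℝ := fun c a =>
    Matrix.of fun k b => dΓ' c k b a with hdcnp
  set θ : Fin n → Matrix (Fin n) (Fin n) ℝ := fun a => ∑ j, J j a • cn j with hθ
  set D : Fin n → Fin n → Matrix (Fin n) (Fin n) ℝ := fun c a =>
    ∑ l, ∑ j, (J l c * J j a) • dcn l j with hD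
  set S : Fin n → Fin n → Matrix (Fin n) (Fin n) ℝ := fun c a =>
    T c a + ∑ j, HJ c j a • (cn j * J) with hS
  set R : Fin n → Fin n → Matrix (Fin n) (Fin n) ℝ := fun c a =>
    dcn c a - dcn a c + cn c * cn a - cn a * cn c with hR
  set R' : Fin n → Fin n → Matrix (Fin n) (Fin n) ℝ := fun c a =>
    dcn' c a - dcn' a c + cn' c * cn' a - cn' a * cn' c with hR'
  -- Symmetry of the lower indices rewrites the Ricci formula as a trace of the curvature matrices.
  have ric : ∀ {Γ : Fin n → Fin n → Fin n → ℝ} (dΓ : Fin n → Fin n → Fin n → Fin n → ℝ)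
      (_ : ∀ k i j, Γ k i j = Γ k j i) (i j : Fin n), ricciForm Γ dΓ i j =
      ∑ k, (dΓ k k i j - dΓ j k i k + ∑ l, Γ k l k * Γ l i j - ∑ l, Γ k l j * Γ l i k) := by
    intro Γ dΓ hΓ i j
    unfold ricciForm
    rw [← Finset.sum_add_distrib]
    refine Finset.sum_congr rfl fun k _ => ?_
    rw [add_sub_assoc, ← Finset.sum_sub_distrib]
    congr 1
    refine Finset.sum_congr rfl fun l _ => ?_
    rw [hΓ k k l, hΓ k j l]
  have hric : ∀ i j, ricciForm Γ dΓ i j = ∑ k, R k j k i := by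
    intro i j
    rw [ric dΓ hΓ]
    refine Finset.sum_congr rfl fun k _ => ?_
    simp [hR, hcn, hdcn, Matrix.mul_apply]
  have hric' : ∀ i j, ricciForm Γ' dΓ' i j = ∑ k, R' k j k i := by
    intro i j
    rw [ric dΓ' hΓ']
    refine Finset.sum_congr rfl fun k _ => ?_
    simp [hR', hcnp, hdcnp, Matrix.mul_apply]
  have hcurv := curvature_transformation (J := J) (HJ := HJ) (cn' := cn') (θ := θ) (dcn' := dcn')
    (D := D) (S := S) (fun a => by
      ext m b
      have := h1 m a b
      simp only [Matrix.mul_apply, Matrix.add_apply, hθ, hcnp, hcn, Matrix.of_apply, this,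
        Matrix.sum_apply, Matrix.smul_apply, smul_eq_mul, Finset.sum_mul]
      congr 1
      exact Finset.sum_congr rfl fun j _ => Finset.sum_congr rfl fun i _ => by ring)
    (fun a c => by
      simp only [hS]
      rw [hT]
      congr 1
      exact Finset.sum_congr rfl fun j _ => by rw [hHJ])
    (fun a c => by
      ext m b
      have := h2 m a b c
      rw [Finset.sum_add_distrib] at this
      simp only [Matrix.mul_apply, Matrix.add_apply, hθ, hcnp, hdcnp, hcn, hdcn, hS, hD,
        Matrix.of_apply, this, Matrix.sum_apply, Matrix.smul_apply, smul_eq_mul, Finset.sum_mul,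
        Finset.mul_sum]
      rw [add_assoc, add_assoc]
      congr 1
      simp only [add_mul, Finset.sum_add_distrib]
      rw [add_assoc]
      congr 1
      · exact Finset.sum_congr rfl fun j _ => Finset.sum_congr rfl fun i _ => by ring
      congr 1
      · exact Finset.sum_congr rfl fun j _ => Finset.sum_congr rfl fun i _ => by ring
      · conv_rhs => rw [Finset.sum_comm]
        refine Finset.sum_congr rfl fun j _ => ?_
        rw [Finset.sum_comm]
        exact Finset.sum_congr rfl fun l _ => Finset.sum_congr rfl fun i _ => by ring)
  have hRJ : ∀ c a, D c a - D a c + θ c * θ a - θ a * θ c =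
      ∑ l, ∑ j, (J l c * J j a) • R l j := by
    intro c a
    have e1 : D a c = ∑ l, ∑ j, (J l c * J j a) • dcn j l := by
      simp only [hD]
      rw [Finset.sum_comm]
      exact Finset.sum_congr rfl fun j _ => Finset.sum_congr rfl fun l _ => by rw [mul_comm]
    have e2 : θ c * θ a = ∑ l, ∑ j, (J l c * J j a) • (cn l * cn j) := by
      simp only [hθ, Finset.sum_mul_sum, smul_mul_smul_comm]
    have e3 : θ a * θ c = ∑ l, ∑ j, (J l c * J j a) • (cn j * cn l) := by
      simp only [hθ, Finset.sum_mul_sum, smul_mul_smul_comm]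
      rw [Finset.sum_comm]
      exact Finset.sum_congr rfl fun j _ => Finset.sum_congr rfl fun l _ => by rw [mul_comm (J l a)]
    rw [e1, e2, e3]
    simp only [hD, hR, smul_sub, smul_add, Finset.sum_sub_distrib, Finset.sum_add_distrib]
  -- The curvature is conjugated by `J` and pulled back in its form indices. In the trace, the `J`
  -- of one form index cancels against `J⁻¹`.
  have hfin : ∀ c a, R' c a = J⁻¹ * ((∑ l, ∑ j, (J l c * J j a) • R l j) * J) := by
    intro c a
    rw [← hRJ, ← hcurv a c, ← Matrix.mul_assoc, Matrix.nonsing_inv_mul _ hJ, Matrix.one_mul]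
  have hδ : ∀ l p, ∑ k, J l k * J⁻¹ k p = (1 : Matrix (Fin n) (Fin n) ℝ) l p := fun l p => by
    rw [← Matrix.mul_apply, Matrix.mul_nonsing_inv _ hJ]
  rw [hric']
  calc ∑ k, R' k a k b
      = ∑ k, ∑ p, ∑ l, ∑ j, J l k * J⁻¹ k p * (J j a * (R l j * J) p b) := by
        refine Finset.sum_congr rfl fun k _ => ?_
        rw [hfin, Matrix.mul_apply]
        refine Finset.sum_congr rfl fun p _ => ?_
        simp only [Finset.sum_mul, Matrix.sum_apply, Matrix.smul_mul, Matrix.smul_apply,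
          smul_eq_mul, Finset.mul_sum]
        exact Finset.sum_congr rfl fun l _ => Finset.sum_congr rfl fun j _ => by ring
    _ = ∑ l, ∑ j, ∑ p, (∑ k, J l k * J⁻¹ k p) * (J j a * (R l j * J) p b) := by
        simp only [Finset.sum_mul]
        rw [Finset.sum_comm]
        have : ∀ p, ∑ k, ∑ l, ∑ j, J l k * J⁻¹ k p * (J j a * (R l j * J) p b) =
            ∑ l, ∑ j, ∑ k, J l k * J⁻¹ k p * (J j a * (R l j * J) p b) := by
          intro p
          rw [Finset.sum_comm]
          exact Finset.sum_congr rfl fun l _ => Finset.sum_comm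
        simp only [this]
        rw [Finset.sum_comm]
        exact Finset.sum_congr rfl fun l _ => Finset.sum_comm
    _ = ∑ l, ∑ j, J j a * (R l j * J) l b := by
        refine Finset.sum_congr rfl fun l _ => Finset.sum_congr rfl fun j _ => ?_
        simp [hδ, Matrix.one_apply]
    _ = _ := by
        simp only [hric, Matrix.mul_apply, Finset.mul_sum]
        rw [Finset.sum_comm]
        conv_rhs => rw [Finset.sum_comm]
        refine Finset.sum_congr rfl fun j _ => ?_
        rw [Finset.sum_comm]
        exact Finset.sum_congr rfl fun l _ => Finset.sum_congr rfl fun j _ => by ring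

/-- The transformation law of the Christoffel symbols. -/
theorem christoffel_transformation {J : Matrix (Fin n) (Fin n) ℝ} (hJ : IsUnit J.det)
    {HJ : Fin n → Matrix (Fin n) (Fin n) ℝ} (hHJ : ∀ a b m, HJ a m b = HJ b m a)
    {G G' : Matrix (Fin n) (Fin n) ℝ} {dG dG' : Fin n → Matrix (Fin n) (Fin n) ℝ}
    (hG : IsUnit G.det) (hGs : ∀ p q, G p q = G q p)
    (hG' : ∀ b c, G' b c = ∑ p, ∑ q, J p b * J q c * G p q)
    (hdG' : ∀ a b c, dG' a b c = ∑ p, ∑ q, ((HJ a p b * J q c + J p b * HJ a q c) * G p q +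
      J p b * J q c * ∑ r, J r a * dG r p q)) (m a b : Fin n) :
    ∑ k, J m k * christoffel G' dG' k b a =
      HJ a m b + ∑ j, ∑ i, J j a * (christoffel G dG m i j * J i b) := by
  have hGm : G' = J.transpose * (G * J) := by
    ext b c
    rw [hG', Matrix.mul_apply]
    refine Finset.sum_congr rfl fun p _ => ?_
    rw [Matrix.mul_apply, Finset.mul_sum]
    exact Finset.sum_congr rfl fun q _ => by rw [Matrix.transpose_apply]; ring
  have hJt : IsUnit J.transpose.det := by rwa [Matrix.det_transpose]
  set W : Fin n → Fin n → Fin n → ℝ := fun i j l => dG i j l + dG j i l - dG l i j with hW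
  set W' : Fin n → ℝ := fun l => dG' b a l + dG' a b l - dG' l b a with hW'
  have hΓ' : (fun k => christoffel G' dG' k b a) = (1 / 2 : ℝ) • G'⁻¹.mulVec W' := by
    ext k
    simp [christoffel, Matrix.mulVec, dotProduct, hW']
  set V : Fin n → ℝ := fun p => 2 * ∑ q, G p q * HJ a q b + ∑ i, ∑ j, J i b * J j a * W i j p
    with hV
  -- Symbols of the first kind. Of the six terms with second derivatives of the coordinate change,
  -- four cancel in pairs and two coincide, by symmetry of `G` and of `HJ`; hence the factor `2` in
  -- `V`.
  have key : W' = J.transpose.mulVec V := by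
    ext c
    have s1 : ∑ p, ∑ q, J p a * HJ b q c * G p q = ∑ p, ∑ q, HJ c p b * J q a * G p q := by
      rw [Finset.sum_comm]
      exact Finset.sum_congr rfl fun p _ => Finset.sum_congr rfl fun q _ => by
        rw [hHJ b c p, hGs q p]; ring
    have s2 : ∑ p, ∑ q, J p b * HJ a q c * G p q = ∑ p, ∑ q, J p b * HJ c q a * G p q :=
      Finset.sum_congr rfl fun p _ => Finset.sum_congr rfl fun q _ => by rw [hHJ a c q]
    have s3 : ∑ p, ∑ q, HJ b p a * J q c * G p q = ∑ p, ∑ q, HJ a p b * J q c * G p q :=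
      Finset.sum_congr rfl fun p _ => Finset.sum_congr rfl fun q _ => by rw [hHJ b a p]
    have s4 : ∑ p, J p c * ∑ q, G p q * HJ a q b = ∑ p, ∑ q, HJ a p b * J q c * G p q := by
      simp only [Finset.mul_sum]
      rw [Finset.sum_comm]
      exact Finset.sum_congr rfl fun p _ => Finset.sum_congr rfl fun q _ => by
        rw [hGs q p]; ring
    have t1 : ∑ p, ∑ q, J p a * J q c * ∑ r, J r b * dG r p q =
        ∑ p, ∑ i, ∑ j, J p c * (J i b * J j a * dG i j p) := by
      simp only [Finset.mul_sum]
      rw [Finset.sum_comm]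
      refine Finset.sum_congr rfl fun p _ => ?_
      rw [Finset.sum_comm]
      exact Finset.sum_congr rfl fun i _ => Finset.sum_congr rfl fun j _ => by ring
    have t2 : ∑ p, ∑ q, J p b * J q c * ∑ r, J r a * dG r p q =
        ∑ p, ∑ i, ∑ j, J p c * (J i b * J j a * dG j i p) := by
      simp only [Finset.mul_sum]
      rw [Finset.sum_comm]
      exact Finset.sum_congr rfl fun p _ => Finset.sum_congr rfl fun i _ =>
        Finset.sum_congr rfl fun j _ => by ring
    have t3 : ∑ p, ∑ q, J p b * J q a * ∑ r, J r c * dG r p q =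
        ∑ p, ∑ i, ∑ j, J p c * (J i b * J j a * dG p i j) := by
      simp only [Finset.mul_sum]
      have : ∀ i, ∑ j, ∑ p, J i b * J j a * (J p c * dG p i j) =
          ∑ p, ∑ j, J i b * J j a * (J p c * dG p i j) := fun i => Finset.sum_comm
      simp only [this]
      rw [Finset.sum_comm]
      exact Finset.sum_congr rfl fun p _ => Finset.sum_congr rfl fun i _ =>
        Finset.sum_congr rfl fun j _ => by ring
    have rhs : J.transpose.mulVec V c = 2 * ∑ p, J p c * ∑ q, G p q * HJ a q b +
        (∑ p, ∑ i, ∑ j, J p c * (J i b * J j a * dG i j p) +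
          ∑ p, ∑ i, ∑ j, J p c * (J i b * J j a * dG j i p) -
          ∑ p, ∑ i, ∑ j, J p c * (J i b * J j a * dG p i j)) := by
      simp only [Matrix.mulVec, dotProduct, Matrix.transpose_apply, hV, hW, mul_add, mul_sub,
        Finset.mul_sum, Finset.sum_add_distrib, Finset.sum_sub_distrib]
      congr 1
      exact Finset.sum_congr rfl fun p _ => Finset.sum_congr rfl fun q _ => by ring
    rw [rhs, s4]
    simp only [hW', hdG', add_mul, Finset.sum_add_distrib]
    rw [s1, s2, s3, t1, t2, t3]
    ring
  have hlhs : J.mulVec (fun k => christoffel G' dG' k b a) = (1 / 2 : ℝ) • G⁻¹.mulVec V := by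
    rw [hΓ', key, hGm, Matrix.mulVec_smul, Matrix.mulVec_mulVec, Matrix.mulVec_mulVec,
      Matrix.mul_inv_rev, Matrix.mul_inv_rev]
    congr 2
    rw [Matrix.mul_assoc, Matrix.mul_assoc, Matrix.nonsing_inv_mul _ hJt, Matrix.mul_one,
      ← Matrix.mul_assoc, Matrix.mul_nonsing_inv _ hJ, Matrix.one_mul]
  have h1 := congrFun hlhs m
  simp only [Matrix.mulVec, dotProduct, Pi.smul_apply, smul_eq_mul] at h1
  rw [h1]
  have hδ : ∀ q, ∑ p, G⁻¹ m p * G p q = (1 : Matrix (Fin n) (Fin n) ℝ) m q := fun q => by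
    rw [← Matrix.mul_apply, Matrix.nonsing_inv_mul _ hG]
  have e1 : ∑ p, G⁻¹ m p * (2 * ∑ q, G p q * HJ a q b) = 2 * HJ a m b := by
    have : ∑ p, G⁻¹ m p * (2 * ∑ q, G p q * HJ a q b) =
        2 * ∑ q, (∑ p, G⁻¹ m p * G p q) * HJ a q b := by
      simp only [Finset.mul_sum, Finset.sum_mul]
      rw [Finset.sum_comm]
      exact Finset.sum_congr rfl fun p _ => Finset.sum_congr rfl fun q _ => by ring
    rw [this]
    simp [hδ, Matrix.one_apply]
  have e2 : ∑ p, G⁻¹ m p * ∑ i, ∑ j, J i b * J j a * W i j p =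
      2 * ∑ j, ∑ i, J j a * (christoffel G dG m i j * J i b) := by
    simp only [christoffel, Finset.mul_sum, Finset.sum_mul]
    rw [Finset.sum_comm]
    conv_rhs => rw [Finset.sum_comm]
    refine Finset.sum_congr rfl fun i _ => ?_
    rw [Finset.sum_comm]
    exact Finset.sum_congr rfl fun j _ => Finset.sum_congr rfl fun p _ => by
      simp only [hW]; ring
  simp only [hV, mul_add, Finset.sum_add_distrib]
  rw [e1, e2]
  ring

end

section

variable {n : ℕ} {Ω : Set (Euc n)}

/-! ### The Ricci tensor under a change of coordinates -/

theorem pd_comm (hΩ : IsOpen Ω) {f : Euc n → ℝ} (hf : ContDiffOn ℝ ∞ f Ω) {y : Euc n} (hy : y ∈ Ω)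
    (a b : Fin n) : pd a (pd b f) y = pd b (pd a f) y := by
  have hc := hf.contDiffAt (hΩ.mem_nhds hy)
  have hd : DifferentiableAt ℝ (fderiv ℝ f) y :=
    (hc.fderiv_right (m := 1) (by norm_cast)).differentiableAt (by simp)
  have h1 : ∀ v w : Euc n, fderiv ℝ (fun z => fderiv ℝ f z v) y w = fderiv ℝ (fderiv ℝ f) y w v := by
    intro v w
    rw [fderiv_clm_apply hd (differentiableAt_const v)]
    simp
  have hs := hc.isSymmSndFDerivAt (by simp only [minSmoothness_of_isRCLikeNormedField]; norm_cast)
  change fderiv ℝ (fun z => fderiv ℝ f z (stdVec b)) y (stdVec a) =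
    fderiv ℝ (fun z => fderiv ℝ f z (stdVec a)) y (stdVec b)
  rw [h1, h1]
  exact hs _ _

/-- The derivatives `∂_a ∂_b F^p` of the Jacobian matrix. -/
def jacDeriv (F : Euc n → Euc n) (y : Euc n) (a : Fin n) : Matrix (Fin n) (Fin n) ℝ :=
  Matrix.of fun p b => pd a (fun z => jac F z p b) y

theorem jacDeriv_comm (hΩ : IsOpen Ω) {F : Euc n → Euc n} (hF : ContDiffOn ℝ ∞ F Ω) {y : Euc n}
    (hy : y ∈ Ω) (a b m : Fin n) : jacDeriv F y a m b = jacDeriv F y b m a := by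
  have key : ∀ a b, jacDeriv F y a m b = pd a (pd b fun z => F z m) y := by
    intro a b
    simp only [jacDeriv, Matrix.of_apply, pd]
    congr 1
    refine Filter.EventuallyEq.fderiv_eq ?_
    filter_upwards [hΩ.mem_nhds hy] with z hz
    have hd : DifferentiableAt ℝ F z := (hF.contDiffAt (hΩ.mem_nhds hz)).differentiableAt (by simp)
    have := ((EuclideanSpace.proj (𝕜 := ℝ) m).hasFDerivAt.comp z hd.hasFDerivAt).fderiv
    simp only [jac, Matrix.of_apply]
    change _ = fderiv ℝ (EuclideanSpace.proj m ∘ F) z (stdVec b)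
    rw [this]
    rfl
  rw [key, key]
  exact pd_comm hΩ ((contDiffOn_euclidean.1 hF) m) hy a b

/-- The exceptional set in the source is contained in the image of a null set under the
differentiable map `F.symm`, and such images are null. -/
theorem IsDiffeo.ae_comp {F : OpenPartialHomeomorph (Euc n) (Euc n)} (hF : IsDiffeo F)
    {p : Euc n → Prop} (h : ∀ᵐ z ∂volume.restrict F.target, p z) :
    ∀ᵐ y ∂volume.restrict F.source, p (F y) := by
  rw [ae_restrict_iff' F.open_target.measurableSet, ae_iff] at h
  rw [ae_restrict_iff' F.open_source.measurableSet, ae_iff]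
  have := addHaar_image_eq_zero_of_differentiableOn_of_addHaar_eq_zero (volume : Measure (Euc n))
    (f := F.symm) (s := {z | ¬(z ∈ F.target → p z)})
    (fun z hz => (hF.symm.differentiableAt (by
      simp only [mem_ofPred_eq, Classical.not_imp] at hz; exact hz.1)).differentiableWithinAt) h
  refine measure_mono_null (fun y hy => ?_) this
  simp only [mem_ofPred_eq, Classical.not_imp] at hy
  refine ⟨F y, ?_, F.left_inv hy.1⟩
  simp only [mem_ofPred_eq, Classical.not_imp]
  exact ⟨F.map_source hy.1, hy.2⟩

/-- Weak first derivatives of a matrix field, and of the Christoffel symbols formed with them. -/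
structure HasWeakCurvature (Ω : Set (Euc n)) (G : Euc n → Matrix (Fin n) (Fin n) ℝ)
    (dG : Fin n → Euc n → Matrix (Fin n) (Fin n) ℝ)
    (dΓ : Fin n → Fin n → Fin n → Fin n → Euc n → ℝ) : Prop where
  metric : ∀ a i j, IsWeakPartial Ω a (fun y => G y i j) fun y => dG a y i j
  connection : ∀ a k i j, IsWeakPartial Ω a
    (fun y => christoffel (G y) (fun a => dG a y) k i j) (dΓ a k i j)

theorem HasWeakCurvature.mono {G : Euc n → Matrix (Fin n) (Fin n) ℝ}
    {dG : Fin n → Euc n → Matrix (Fin n) (Fin n) ℝ}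
    {dΓ : Fin n → Fin n → Fin n → Fin n → Euc n → ℝ} (h : HasWeakCurvature Ω G dG dΓ)
    {Ω' : Set (Euc n)} (hs : Ω' ⊆ Ω) : HasWeakCurvature Ω' G dG dΓ :=
  ⟨fun a i j => (h.metric a i j).mono hs, fun a k i j => (h.connection a k i j).mono hs⟩

theorem HasWeakCurvature.deriv_symm {G : Euc n → Matrix (Fin n) (Fin n) ℝ}
    {dG : Fin n → Euc n → Matrix (Fin n) (Fin n) ℝ}
    {dΓ : Fin n → Fin n → Fin n → Fin n → Euc n → ℝ} (h : HasWeakCurvature Ω G dG dΓ)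
    (hΩ : IsOpen Ω) (hG : ∀ y ∈ Ω, ∀ p q, G y p q = G y q p) :
    ∀ᵐ y ∂volume.restrict Ω, ∀ a i j, dG a y i j = dG a y j i := by
  simp only [ae_all_iff]
  intro a i j
  exact (h.metric a i j).ae_unique hΩ (h.metric a j i)
    ((ae_restrict_iff' hΩ.measurableSet).2 (ae_of_all _ fun y hy => hG y hy i j))

/-- The Ricci tensor of a weakly differentiable metric transforms as a tensor. -/
theorem HasWeakCurvature.ricciForm_comp {F : OpenPartialHomeomorph (Euc n) (Euc n)}
    (hF : IsDiffeo F) {G G' : Euc n → Matrix (Fin n) (Fin n) ℝ}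
    {dG dG' : Fin n → Euc n → Matrix (Fin n) (Fin n) ℝ}
    {dΓ dΓ' : Fin n → Fin n → Fin n → Fin n → Euc n → ℝ}
    (h : HasWeakCurvature F.target G dG dΓ) (h' : HasWeakCurvature F.source G' dG' dΓ')
    (hG : ∀ y ∈ F.target, ∀ p q, G y p q = G y q p) (hGd : ∀ y ∈ F.target, IsUnit (G y).det)
    (hG' : ∀ y ∈ F.source, ∀ b c,
      G' y b c = ∑ p, ∑ q, jac F y p b * jac F y q c * G (F y) p q) :
    ∀ᵐ y ∂volume.restrict F.source, ∀ b a,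
      ricciForm (christoffel (G' y) fun a => dG' a y) (fun a k i j => dΓ' a k i j y) b a =
        ∑ q, ∑ i, jac F y q b * jac F y i a *
          ricciForm (christoffel (G (F y)) fun a => dG a (F y))
            (fun a k i j => dΓ a k i j (F y)) q i := by
  have hU := F.open_source
  have hJs := fun p b => jac_contDiffOn hU hF.smooth p b
  have hJd : ∀ {y}, y ∈ F.source → ∀ p b, DifferentiableAt ℝ (fun z => jac F z p b) y :=
    fun hy p b => ((hJs p b).contDiffAt (hU.mem_nhds hy)).differentiableAt (by simp)
  have hin : ∀ᵐ y ∂volume.restrict F.source, y ∈ F.source := ae_restrict_mem hU.measurableSet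
  have hG's : ∀ y ∈ F.source, ∀ p q, G' y p q = G' y q p := by
    intro y hy p q
    rw [hG' y hy, hG' y hy, Finset.sum_comm]
    refine Finset.sum_congr rfl fun i _ => Finset.sum_congr rfl fun j _ => ?_
    rw [hG (F y) (F.map_source hy) j i]; ring
  have hpd : ∀ y ∈ F.source, ∀ a p b q c, pd a (fun z => jac F z p b * jac F z q c) y =
      jacDeriv F y a p b * jac F y q c + jac F y p b * jacDeriv F y a q c :=
    fun y hy a p b q c => pd_mul (hJd hy p b) (hJd hy q c)
  have s1 := hF.ae_comp (h.deriv_symm F.open_target hG)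
  have s2 := h'.deriv_symm hU hG's
  -- Both sides of `hG'` are weakly differentiable, so uniqueness of weak derivatives gives the
  -- transformation of `∂G`.
  have d1 : ∀ᵐ y ∂volume.restrict F.source, ∀ a b c, dG' a y b c = ∑ p, ∑ q,
      ((jacDeriv F y a p b * jac F y q c + jac F y p b * jacDeriv F y a q c) * G (F y) p q +
        jac F y p b * jac F y q c * ∑ r, jac F y r a * dG r (F y) p q) := by
    simp only [ae_all_iff]
    intro a b c
    have hw := IsWeakPartial.sum Finset.univ fun p _ => IsWeakPartial.sum Finset.univ fun q _ =>
      (hF.isWeakPartial_comp (fun j => h.metric j p q) (h.metric a p q).1 a).smooth_mul hU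
        ((hJs p b).mul (hJs q c))
    filter_upwards [(h'.metric a b c).ae_unique hU hw ((ae_restrict_iff' hU.measurableSet).2
      (ae_of_all _ fun y hy => hG' y hy b c)), hin] with y hy hyU
    rw [hy]
    refine Finset.sum_congr rfl fun p _ => Finset.sum_congr rfl fun q _ => ?_
    rw [hpd y hyU]
  -- The law is kept in the form `J Γ' = ∂J + …`, not solved for `Γ'`: each weakly differentiable
  -- factor then has only smooth coefficients, and `d3` follows from the smooth product rule.
  have d2 : ∀ᵐ y ∂volume.restrict F.source, ∀ m a b,
      ∑ k, jac F y m k * christoffel (G' y) (fun a => dG' a y) k b a =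
        jacDeriv F y a m b + ∑ j, ∑ i, jac F y j a *
          (christoffel (G (F y)) (fun a => dG a (F y)) m i j * jac F y i b) := by
    filter_upwards [d1, hin] with y hd hy m a b
    exact christoffel_transformation (isUnit_iff_ne_zero.2 (hF.det_jac_ne_zero hy))
      (fun a b m => jacDeriv_comm hU hF.smooth hy a b m) (hGd _ (F.map_source hy))
      (hG _ (F.map_source hy)) (hG' y hy) hd m a b
  have d3 : ∀ᵐ y ∂volume.restrict F.source, ∀ m a b c,
      ∑ k, (jacDeriv F y c m k * christoffel (G' y) (fun a => dG' a y) k b a +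
          jac F y m k * dΓ' c k b a y) =
        pd c (fun z => jacDeriv F z a m b) y + ∑ j, ∑ i,
          ((jacDeriv F y c j a * jac F y i b + jac F y j a * jacDeriv F y c i b) *
              christoffel (G (F y)) (fun a => dG a (F y)) m i j +
            jac F y j a * jac F y i b * ∑ l, jac F y l c * dΓ l m i j (F y)) := by
    simp only [ae_all_iff]
    intro m a b c
    have hl := IsWeakPartial.sum Finset.univ fun k _ =>
      (h'.connection c k b a).smooth_mul hU (hJs m k)
    have hr := (IsWeakPartial.of_contDiffOn (i := c) hU (pd_contDiffOn hU (hJs m b) a)).add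
      (IsWeakPartial.sum Finset.univ fun j _ => IsWeakPartial.sum Finset.univ fun i _ =>
        (hF.isWeakPartial_comp (fun l => h.connection l m i j)
          (h.connection a m i j).1 c).smooth_mul hU ((hJs j a).mul (hJs i b)))
    have he := hl.ae_unique hU hr (by
      filter_upwards [d2] with y hy
      rw [hy m a b]
      congr 1
      exact Finset.sum_congr rfl fun j _ => Finset.sum_congr rfl fun i _ => by ring)
    filter_upwards [he, hin] with y hy hyU
    refine hy.trans ?_
    congr 1
    refine Finset.sum_congr rfl fun j _ => Finset.sum_congr rfl fun i _ => ?_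
    rw [hpd y hyU]
  filter_upwards [s1, s2, d2, d3, hin] with y h1 h2 h3 h4 hy b a
  refine ricciForm_transformation (isUnit_iff_ne_zero.2 (hF.det_jac_ne_zero hy))
    (HJ := jacDeriv F y)
    (T := fun c a => Matrix.of fun m b => pd c (fun z => jacDeriv F z a m b) y)
    (christoffel_comm h1) (christoffel_comm h2)
    (fun a b m => jacDeriv_comm hU hF.smooth hy a b m) (fun a c => ?_) h3 h4 a b
  ext m b
  exact pd_comm hU (hJs m b) hy c a

end

section

variable {n : ℕ} {M : Type*} [TopologicalSpace M] [ChartedSpace (EuclideanSpace ℝ (Fin n)) M]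
  {φ ψ : OpenPartialHomeomorph M (EuclideanSpace ℝ (Fin n))}

/-! ### Existence of the Ricci tensor -/

theorem chartDifferential_coordVec (hφ : φ ∈ IsManifold.maximalAtlas (𝓡 n) ∞ M)
    (hψ : ψ ∈ IsManifold.maximalAtlas (𝓡 n) ∞ M) {y : Euc n}
    (hy : y ∈ (φ.symm.trans ψ).source) (p a : Fin n) :
    (chartDifferential ψ (φ.symm y) (coordVec φ y p)) a = jac (φ.symm.trans ψ) y a p := by
  obtain ⟨h1, h2⟩ := mem_transition_source.1 hy
  have hc := mfderiv_comp y
    ((mdifferentiable_of_mem_maximalAtlas hψ).mdifferentiableAt h2)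
    ((mdifferentiable_of_mem_maximalAtlas hφ).mdifferentiableAt_symm h1)
  have hf : mfderiv (𝓡 n) (𝓡 n) (ψ ∘ φ.symm) y = fderiv ℝ (φ.symm.trans ψ) y := mfderiv_eq_fderiv
  rw [hf] at hc
  have := congrArg (fun L : Euc n →L[ℝ] Euc n => L (stdVec p) a) hc
  exact this.symm

/-- The bilinear form `∑ R_{ab} dψ^a ⊗ dψ^b`. -/
def formOfMatrix (ψ : OpenPartialHomeomorph M (EuclideanSpace ℝ (Fin n)))
    (R : Matrix (Fin n) (Fin n) ℝ) (x : M) :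
    TangentSpace (𝓡 n) x →L[ℝ] TangentSpace (𝓡 n) x →L[ℝ] ℝ :=
  ∑ a, ∑ b, R a b • ContinuousLinearMap.smulRight
    ((EuclideanSpace.proj (𝕜 := ℝ) a).comp (chartDifferential ψ x))
    ((EuclideanSpace.proj (𝕜 := ℝ) b).comp (chartDifferential ψ x))

theorem formOfMatrix_apply (R : Matrix (Fin n) (Fin n) ℝ) (x : M) (v w : TangentSpace (𝓡 n) x) :
    formOfMatrix ψ R x v w =
      ∑ a, ∑ b, (chartDifferential ψ x v) a * (chartDifferential ψ x w) b * R a b := by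
  simp only [formOfMatrix, sum_apply, smul_apply, ContinuousLinearMap.smulRight_apply,
    ContinuousLinearMap.comp_apply, smul_eq_mul]
  refine Finset.sum_congr rfl fun a _ => Finset.sum_congr rfl fun b _ => ?_
  simp only [PiLp.proj_apply]
  ring

/-- At each point the form is taken from a chart chosen in a countable cover. In any given chart the
transformation law holds off one null set for all these charts at once, so the choice is invisible
almost everywhere and need not be measurable. -/
theorem exists_isRicciTensor [IsManifold (𝓡 n) ∞ M] [SecondCountableTopology M]
    (g : RoughMetric n M)
    (h : ∀ φ ∈ IsManifold.maximalAtlas (𝓡 n) ∞ M, ∃ dG dΓ,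
      HasWeakCurvature φ.target (coordMatrix φ g.inner) dG dΓ) :
    ∃ Ric : BilinField n M, IsRicciTensor g Ric := by
  choose! dG dΓ hw using h
  obtain ⟨s, hs, hcov⟩ := TopologicalSpace.countable_cover_nhds
    fun x : M => chart_source_mem_nhds (EuclideanSpace ℝ (Fin n)) x
  have hx : ∀ x : M, ∃ z ∈ s, x ∈ (chartAt (EuclideanSpace ℝ (Fin n)) z).source := by
    intro x
    have : x ∈ ⋃ z ∈ s, (chartAt (EuclideanSpace ℝ (Fin n)) z).source := hcov ▸ mem_univ x
    simpa using this
  choose c hcs hcx using hx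
  have hat : ∀ z : M, chartAt (EuclideanSpace ℝ (Fin n)) z ∈ IsManifold.maximalAtlas (𝓡 n) ∞ M :=
    fun z => IsManifold.chart_mem_maximalAtlas z
  set rf : OpenPartialHomeomorph M (EuclideanSpace ℝ (Fin n)) → Euc n → Matrix (Fin n) (Fin n) ℝ :=
    fun φ y => Matrix.of fun i j => ricciForm
      (christoffel (coordMatrix φ g.inner y) fun a => dG φ a y) (fun a k i j => dΓ φ a k i j y) i j
    with hrf
  refine ⟨fun x => formOfMatrix (chartAt _ (c x)) (rf (chartAt _ (c x)) (chartAt _ (c x) x)) x,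
    fun φ hφ => ⟨dG φ, dΓ φ, (hw φ hφ).metric, (hw φ hφ).connection, ?_⟩⟩
  have hae : ∀ z ∈ s, ∀ᵐ y : Euc n,
      y ∈ (φ.symm.trans (chartAt (EuclideanSpace ℝ (Fin n)) z)).source → ∀ b a, rf φ y b a =
        ∑ q, ∑ i, jac (φ.symm.trans (chartAt (EuclideanSpace ℝ (Fin n)) z)) y q b *
          jac (φ.symm.trans (chartAt (EuclideanSpace ℝ (Fin n)) z)) y i a *
          rf (chartAt _ z) (chartAt _ z (φ.symm y)) q i := by
    intro z _
    set ψ := chartAt (EuclideanSpace ℝ (Fin n)) z with hψd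
    have hψ := hat z
    have hF := isDiffeo_transition hφ hψ
    have hsub1 : (φ.symm.trans ψ).source ⊆ φ.target := fun y hy => (mem_transition_source.1 hy).1
    have hsub2 : (φ.symm.trans ψ).target ⊆ ψ.target := by
      intro y hy
      rw [OpenPartialHomeomorph.trans_target] at hy
      exact hy.1
    rw [← ae_restrict_iff' (φ.symm.trans ψ).open_source.measurableSet]
    exact ((hw ψ hψ).mono hsub2).ricciForm_comp hF ((hw φ hφ).mono hsub1)
      (fun y _ p q => coordMatrix_symm g y p q)
      (fun y hy => (coordMatrix_pos hψ g (hsub2 hy)).det_pos.ne'.isUnit)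
      (fun y hy b c => coordMatrix_transition hφ hψ g.inner hy b c)
  intro i j
  rw [ae_restrict_iff' φ.open_target.measurableSet]
  filter_upwards [(ae_ball_iff hs).2 hae] with y hy hyt
  have hsrc : y ∈ (φ.symm.trans (chartAt (EuclideanSpace ℝ (Fin n)) (c (φ.symm y)))).source :=
    mem_transition_source.2 ⟨hyt, hcx _⟩
  have h1 := hy _ (hcs (φ.symm y)) hsrc i j
  change coordMatrix φ _ y i j = rf φ y i j
  rw [h1]
  simp only [coordMatrix, Matrix.of_apply, formOfMatrix_apply,
    chartDifferential_coordVec hφ (hat _) hsrc]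

theorem isRicciTensor_ricciTensor (g : RoughMetric n M)
    (h : ∃ Ric : BilinField n M, IsRicciTensor g Ric) : IsRicciTensor g (ricciTensor g) := by
  unfold ricciTensor
  rw [dif_pos h]
  exact h.choose_spec

end

section

variable {n : ℕ} {M : Type*} [TopologicalSpace M] [ChartedSpace (EuclideanSpace ℝ (Fin n)) M]
  {φ ψ : OpenPartialHomeomorph M (EuclideanSpace ℝ (Fin n))}

/-! ### The volume measure in charts -/

theorem _root_.ContinuousOn.measurableSet_inter_preimage' {X Y : Type*} [TopologicalSpace X]
    [MeasurableSpace X] [BorelSpace X] [TopologicalSpace Y] [MeasurableSpace Y] [BorelSpace Y]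
    {f : X → Y} {s : Set X} (hf : ContinuousOn f s) (hs : MeasurableSet s) {t : Set Y}
    (ht : MeasurableSet t) : MeasurableSet (s ∩ f ⁻¹' t) := by
  have h := (continuousOn_iff_continuous_domRestrict.1 hf).measurable ht
  have := hs.subtype_image h
  rwa [show Subtype.val '' (s.domRestrict f ⁻¹' t) = s ∩ f ⁻¹' t by
    ext x; simp [and_comm]] at this

/-- The density `√(det h_{ij})` in a chart. -/
def density (φ : OpenPartialHomeomorph M (EuclideanSpace ℝ (Fin n))) (h : RoughMetric n M)
    (y : Euc n) : ℝ := Real.sqrt (coordMatrix φ h.inner y).det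

/-- The measure `√(det h_{ij}) dy` of a chart. -/
def chartMeasure [MeasurableSpace M] (φ : OpenPartialHomeomorph M (EuclideanSpace ℝ (Fin n)))
    (h : RoughMetric n M) : Measure M :=
  ((volume.restrict φ.target).withDensity fun y => ENNReal.ofReal (density φ h y)).map φ.symm

theorem density_pos (hφ : φ ∈ IsManifold.maximalAtlas (𝓡 n) ∞ M) (h : RoughMetric n M) {y : Euc n}
    (hy : y ∈ φ.target) : 0 < density φ h y :=
  Real.sqrt_pos.2 (coordMatrix_pos hφ h hy).det_pos

theorem density_transition (hφ : φ ∈ IsManifold.maximalAtlas (𝓡 n) ∞ M)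
    (hψ : ψ ∈ IsManifold.maximalAtlas (𝓡 n) ∞ M) (h : RoughMetric n M) {y : Euc n}
    (hy : y ∈ (φ.symm.trans ψ).source) :
    density φ h y = |(fderiv ℝ (φ.symm.trans ψ) y).det| * density ψ h ((φ.symm.trans ψ) y) := by
  have : coordMatrix φ h.inner y = (jac (φ.symm.trans ψ) y).transpose *
      coordMatrix ψ h.inner ((φ.symm.trans ψ) y) * jac (φ.symm.trans ψ) y := by
    ext p q
    rw [coordMatrix_transition hφ hψ h.inner hy, Matrix.mul_assoc, Matrix.mul_apply]
    refine Finset.sum_congr rfl fun i _ => ?_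
    rw [Matrix.mul_apply, Finset.mul_sum]
    exact Finset.sum_congr rfl fun j _ => by rw [Matrix.transpose_apply]; ring
  rw [density, this, Matrix.det_mul, Matrix.det_mul, Matrix.det_transpose, det_fderiv_eq, density,
    mul_comm (Matrix.det _) (Matrix.det _), mul_assoc, ← sq, mul_comm,
    Real.sqrt_mul (sq_nonneg _), Real.sqrt_sq_eq_abs]

theorem continuousOn_density [IsManifold (𝓡 n) ∞ M]
    (hφ : φ ∈ IsManifold.maximalAtlas (𝓡 n) ∞ M) (h : SmoothMetric n M) :
    ContinuousOn (density φ h.toRiemannianMetric) φ.target :=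
  (contDiffOn_det fun i j => contDiffOn_coordMatrix_smooth hφ h i j).continuousOn.sqrt

section
variable [MeasurableSpace M] [BorelSpace M]

theorem aemeasurable_chart_symm : AEMeasurable φ.symm (volume.restrict φ.target) :=
  φ.continuousOn_symm.aemeasurable φ.open_target.measurableSet

theorem aemeasurable_chart_symm_withDensity (f : Euc n → ENNReal) :
    AEMeasurable φ.symm ((volume.restrict φ.target).withDensity f) :=
  aemeasurable_chart_symm.mono_ac (withDensity_absolutelyContinuous _ _)

theorem chartMeasure_apply (φ : OpenPartialHomeomorph M (EuclideanSpace ℝ (Fin n)))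
    (h : RoughMetric n M) {E : Set M} (hE : MeasurableSet E) :
    chartMeasure φ h E =
      ∫⁻ y in φ.target ∩ φ.symm ⁻¹' E, ENNReal.ofReal (density φ h y) := by
  rw [chartMeasure, Measure.map_apply_of_aemeasurable (aemeasurable_chart_symm_withDensity _) hE,
    withDensity_apply', Measure.restrict_restrict' φ.open_target.measurableSet, inter_comm]

theorem chartMeasure_le (hφ : φ ∈ IsManifold.maximalAtlas (𝓡 n) ∞ M) (h : RoughMetric n M) :
    chartMeasure φ h ≤ riemannianMeasure h :=
  le_iSup₂_of_le (f := fun φ _ => chartMeasure φ h) φ hφ le_rfl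

/-- Change of variables along the transition map, under which `√det h` picks up exactly the
Jacobian. Only an inequality results, because part of `E` may lie outside the domain of `ψ`. -/
theorem chartMeasure_le_of_subset (hφ : φ ∈ IsManifold.maximalAtlas (𝓡 n) ∞ M)
    (hψ : ψ ∈ IsManifold.maximalAtlas (𝓡 n) ∞ M) (h : RoughMetric n M) {E : Set M}
    (hE : MeasurableSet E) (hs : E ⊆ φ.source) : chartMeasure ψ h E ≤ chartMeasure φ h E := by
  set F := φ.symm.trans ψ with hF
  have hd := isDiffeo_transition hφ hψ
  have himg : ψ.target ∩ ψ.symm ⁻¹' E = F '' (F.source ∩ φ.symm ⁻¹' E) := by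
    ext z
    constructor
    · rintro ⟨hz, hzE⟩
      refine ⟨φ (ψ.symm z), ⟨mem_transition_source.2 ⟨φ.map_source (hs hzE), ?_⟩, ?_⟩, ?_⟩
      · rw [φ.left_inv (hs hzE)]; exact ψ.map_target hz
      · rw [mem_preimage, φ.left_inv (hs hzE)]; exact hzE
      · change ψ (φ.symm (φ (ψ.symm z))) = z
        rw [φ.left_inv (hs hzE), ψ.right_inv hz]
    · rintro ⟨y, ⟨hy, hyE⟩, rfl⟩
      refine ⟨transition_mem_target hy, ?_⟩
      rw [mem_preimage, transition_symm_apply hy]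
      exact hyE
  have hsub : F.source ⊆ φ.target := fun y hy => (mem_transition_source.1 hy).1
  have hm : MeasurableSet (F.source ∩ φ.symm ⁻¹' E) :=
    (φ.continuousOn_symm.mono hsub).measurableSet_inter_preimage' F.open_source.measurableSet hE
  rw [chartMeasure_apply _ _ hE, chartMeasure_apply _ _ hE, himg,
    lintegral_image_eq_lintegral_abs_det_fderiv_mul volume hm
      (f' := fderiv ℝ F) (fun y hy => (hd.differentiableAt hy.1).hasFDerivAt.hasFDerivWithinAt)
      (F.injOn.mono inter_subset_left)]
  calc ∫⁻ y in F.source ∩ φ.symm ⁻¹' E,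
        ENNReal.ofReal |(fderiv ℝ F y).det| * ENNReal.ofReal (density ψ h (F y))
      = ∫⁻ y in F.source ∩ φ.symm ⁻¹' E, ENNReal.ofReal (density φ h y) := by
        refine setLIntegral_congr_fun hm fun y hy => ?_
        rw [density_transition hφ hψ h hy.1, ENNReal.ofReal_mul (abs_nonneg _)]
    _ ≤ _ := lintegral_mono_set (inter_subset_inter_left _ hsub)

/-- A supremum of measures is not evaluated set by set, so an explicit common upper bound is used:
the measure of the given chart, plus infinite mass at every point outside its domain. Restricted to
the domain, the second summand disappears. -/
theorem riemannianMeasure_le_add (hφ : φ ∈ IsManifold.maximalAtlas (𝓡 n) ∞ M)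
    (h : RoughMetric n M) : riemannianMeasure h ≤
      chartMeasure φ h + (⊤ : ENNReal) • Measure.count.restrict φ.sourceᶜ := by
  refine iSup₂_le fun ψ hψ => ?_
  change chartMeasure ψ h ≤ _
  refine Measure.le_iff.2 fun E hE => ?_
  rw [Measure.add_apply, Measure.smul_apply, Measure.restrict_apply hE]
  by_cases hs : E ⊆ φ.source
  · exact (chartMeasure_le_of_subset hφ hψ h hE hs).trans le_self_add
  · have hne : (E ∩ φ.sourceᶜ).Nonempty := by
      obtain ⟨x, hx, hx'⟩ := not_subset.1 hs
      exact ⟨x, hx, hx'⟩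
    have hc : Measure.count (E ∩ φ.sourceᶜ) ≠ 0 := fun h0 =>
      hne.ne_empty (Measure.count_eq_zero_iff.1 h0)
    rw [smul_eq_mul, ENNReal.top_mul hc]
    simp

theorem riemannianMeasure_restrict (hφ : φ ∈ IsManifold.maximalAtlas (𝓡 n) ∞ M)
    (h : RoughMetric n M) : (riemannianMeasure h).restrict φ.source = chartMeasure φ h := by
  have hm := φ.open_source.measurableSet
  refine le_antisymm (Measure.le_iff.2 fun E hE => ?_) (Measure.le_iff.2 fun E hE => ?_)
  · rw [Measure.restrict_apply hE]
    refine (riemannianMeasure_le_add hφ h (E ∩ φ.source)).trans ?_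
    rw [Measure.add_apply, Measure.smul_apply, Measure.restrict_apply (hE.inter hm)]
    have : E ∩ φ.source ∩ φ.sourceᶜ = ∅ := by ext; simp
    rw [this]
    simp only [measure_empty, smul_zero, add_zero]
    exact measure_mono inter_subset_left
  · rw [Measure.restrict_apply hE]
    refine le_trans (le_of_eq ?_) (chartMeasure_le hφ h (E ∩ φ.source))
    rw [chartMeasure_apply _ _ hE, chartMeasure_apply _ _ (hE.inter hm)]
    congr 2
    ext y
    simp only [mem_inter_iff, mem_preimage]
    exact ⟨fun hy => ⟨hy.1, hy.2, φ.map_target hy.1⟩, fun hy => ⟨hy.1, hy.2.1⟩⟩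

theorem map_restrict_source (hφ : φ ∈ IsManifold.maximalAtlas (𝓡 n) ∞ M) (h : RoughMetric n M) :
    ((riemannianMeasure h).restrict φ.source).map φ =
      (volume.restrict φ.target).withDensity fun y => ENNReal.ofReal (density φ h y) := by
  have hφm : AEMeasurable φ (chartMeasure φ h) := by
    rw [← riemannianMeasure_restrict hφ h]
    exact φ.continuousOn.aemeasurable φ.open_source.measurableSet
  rw [riemannianMeasure_restrict hφ h]
  unfold chartMeasure at hφm ⊢
  rw [AEMeasurable.map_map_of_aemeasurable hφm (aemeasurable_chart_symm_withDensity _)]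
  conv_rhs => rw [← Measure.map_id (μ := (volume.restrict φ.target).withDensity _)]
  refine Measure.map_congr ?_
  refine (withDensity_absolutelyContinuous _ _).ae_le ?_
  exact (ae_restrict_iff' φ.open_target.measurableSet).2 (ae_of_all _ fun y hy => φ.right_inv hy)

/-- The density is positive, so null sets for `μ_h` are Lebesgue null in coordinates. -/
theorem ae_chart_of_ae [IsManifold (𝓡 n) ∞ M] (hφ : φ ∈ IsManifold.maximalAtlas (𝓡 n) ∞ M)
    (h : SmoothMetric n M) {p : M → Prop}
    (hp : ∀ᵐ x ∂riemannianMeasure h.toRiemannianMetric, p x) :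
    ∀ᵐ y ∂volume.restrict φ.target, p (φ.symm y) := by
  have h1 := ae_mono (chartMeasure_le hφ h.toRiemannianMetric) hp
  have h2 := ae_of_ae_map (aemeasurable_chart_symm_withDensity _) h1
  rw [ae_withDensity_iff' ((continuousOn_density hφ h).aemeasurable
    φ.open_target.measurableSet).ennreal_ofReal] at h2
  filter_upwards [h2, ae_restrict_mem φ.open_target.measurableSet] with y hy hyt
  exact hy (by simpa using density_pos hφ _ hyt)

theorem ae_of_ae_charts [IsManifold (𝓡 n) ∞ M] [SecondCountableTopology M] (h : RoughMetric n M)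
    {p : M → Prop} (hp : ∀ φ ∈ IsManifold.maximalAtlas (𝓡 n) ∞ M,
      ∀ᵐ y ∂volume.restrict φ.target, p (φ.symm y)) : ∀ᵐ x ∂riemannianMeasure h, p x := by
  obtain ⟨s, hs, hcov⟩ := TopologicalSpace.countable_cover_nhds
    fun x : M => chart_source_mem_nhds (EuclideanSpace ℝ (Fin n)) x
  have hz : ∀ z ∈ s, ∀ᵐ x ∂riemannianMeasure h,
      x ∈ (chartAt (EuclideanSpace ℝ (Fin n)) z).source → p x := by
    intro z _
    set φ := chartAt (EuclideanSpace ℝ (Fin n)) z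
    have hφ : φ ∈ IsManifold.maximalAtlas (𝓡 n) ∞ M := IsManifold.chart_mem_maximalAtlas z
    rw [← ae_restrict_iff' φ.open_source.measurableSet]
    have h1 : ∀ᵐ y ∂((riemannianMeasure h).restrict φ.source).map φ, p (φ.symm y) := by
      rw [map_restrict_source hφ h]
      exact (withDensity_absolutelyContinuous _ _).ae_le (hp φ hφ)
    filter_upwards [ae_of_ae_map (φ.continuousOn.aemeasurable φ.open_source.measurableSet) h1,
      ae_restrict_mem φ.open_source.measurableSet] with x hx hxs
    rwa [φ.left_inv hxs] at hx
  filter_upwards [(ae_ball_iff hs).2 hz] with x hx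
  have : x ∈ ⋃ z ∈ s, (chartAt (EuclideanSpace ℝ (Fin n)) z).source := hcov ▸ mem_univ x
  obtain ⟨z, hzs, hxz⟩ := mem_iUnion₂.1 this
  exact hx z hzs hxz

end

end

section

variable {n : ℕ} {Ω : Set (Euc n)}

/-! ### Metrics with two weak derivatives -/

/-- The weak derivatives of the Christoffel symbols of a metric with two weak derivatives. -/
def christoffelDeriv (B : Matrix (Fin n) (Fin n) ℝ) (dG : Fin n → Matrix (Fin n) (Fin n) ℝ)
    (ddG : Fin n → Fin n → Matrix (Fin n) (Fin n) ℝ) (c k i j : Fin n) : ℝ :=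
  (1 / 2) * ∑ l, ((-∑ p, ∑ q, B k p * dG c p q * B q l) * (dG i j l + dG j i l - dG l i j) +
    B k l * (ddG c i j l + ddG c j i l - ddG c l i j))

/-- The symbols are products of `G⁻¹` with first derivatives of `G`. Both factors are in
`W^{1,2}_loc`: the derivative of the inverse is a bounded multiple of `∂G`. The product rule then
applies, with derivatives merely locally integrable. -/
theorem hasWeakCurvature_of_l2Loc (hΩ : IsOpen Ω) {G : Euc n → Matrix (Fin n) (Fin n) ℝ}
    {dG : Fin n → Euc n → Matrix (Fin n) (Fin n) ℝ}
    {ddG : Fin n → Fin n → Euc n → Matrix (Fin n) (Fin n) ℝ}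
    (hb : ∀ a b, BddLoc Ω fun y => G y a b) (hco : LocCoercive Ω G)
    (h1 : ∀ a i j, IsWeakPartial Ω a (fun y => G y i j) fun y => dG a y i j)
    (h2 : ∀ c a i j, IsWeakPartial Ω c (fun y => dG a y i j) fun y => ddG c a y i j)
    (l1 : ∀ a i j, L2Loc Ω fun y => dG a y i j) (l2 : ∀ c a i j, L2Loc Ω fun y => ddG c a y i j) :
    HasWeakCurvature Ω G dG fun c k i j y =>
      christoffelDeriv (G y)⁻¹ (fun a => dG a y) (fun c a => ddG c a y) c k i j := by
  refine ⟨h1, fun c k i j => IsWeakPartial.const_mul hΩ (.sum _ fun l _ => ?_) _⟩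
  have hB := hco.bddLoc_inv hb
  have hBd := IsWeakPartial.inv_entry hΩ (h1 c) hb (l1 c) hco k l
  refine IsWeakPartial.mul hΩ hBd (((h2 c i j l).add (h2 c j i l)).sub hΩ (h2 c l i j))
    (hB k l).l2Loc ?_ (((l1 i j l).add (l1 j i l)).sub (l1 l i j))
    (((l2 c i j l).add (l2 c j i l)).sub (l2 c l i j))
  have : L2Loc Ω fun y => ∑ p, ∑ q, (G y)⁻¹ k p * dG c y p q * (G y)⁻¹ q l := by
    refine .sum _ fun p _ => .sum _ fun q _ => ?_
    have := (hB q l).mul_l2Loc ((hB k p).mul_l2Loc (l1 c p q))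
    simpa only [mul_comm] using this
  simpa using this.const_mul (-1)

/-- The quadratic form has a positive minimum on the compact product of `K` with the unit sphere;
homogeneity does the rest. -/
theorem exists_coercive_of_posDef {K : Set (Euc n)} (hK : IsCompact K)
    {H : Euc n → Matrix (Fin n) (Fin n) ℝ} (hc : ∀ i j, ContinuousOn (fun y => H y i j) K)
    (hp : ∀ y ∈ K, (H y).PosDef) :
    ∃ c : ℝ, 0 < c ∧ ∀ y ∈ K, ∀ ξ : Fin n → ℝ, c * (ξ ⬝ᵥ ξ) ≤ ξ ⬝ᵥ (H y).mulVec ξ := by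
  set q : Euc n × (Euc n) → ℝ := fun z => (⇑z.2) ⬝ᵥ (H z.1).mulVec z.2 with hq
  have hS : IsCompact (K ×ˢ Metric.sphere (0 : Euc n) 1) := hK.prod (isCompact_sphere _ _)
  have hqc : ContinuousOn q (K ×ˢ Metric.sphere (0 : Euc n) 1) := by
    simp only [hq, dotProduct, Matrix.mulVec]
    have hco : ∀ i, Continuous fun z : Euc n × Euc n => z.2 i := fun i => by fun_prop
    refine continuousOn_finsetSum _ fun i _ => (hco i).continuousOn.mul ?_
    exact continuousOn_finsetSum _ fun j _ => ((hc i j).comp continuousOn_fst fun z hz => hz.1).mul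
      (hco j).continuousOn
  have hpos : ∀ z ∈ K ×ˢ Metric.sphere (0 : Euc n) 1, 0 < q z := by
    rintro ⟨y, ξ⟩ ⟨hy, hξ⟩
    have h0 : (⇑ξ : Fin n → ℝ) ≠ 0 := by
      intro h0
      have : ξ = 0 := by ext i; exact congrFun h0 i
      simp [this] at hξ
    simpa using (hp y hy).dotProduct_mulVec_pos h0
  obtain ⟨c, hc0, hcq⟩ : ∃ c : ℝ, 0 < c ∧ ∀ z ∈ K ×ˢ Metric.sphere (0 : Euc n) 1, c ≤ q z := by
    rcases (K ×ˢ Metric.sphere (0 : Euc n) 1).eq_empty_or_nonempty with he | hne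
    · exact ⟨1, one_pos, by simp [he]⟩
    · obtain ⟨z, hz, hmin⟩ := hS.exists_isMinOn hne hqc
      exact ⟨q z, hpos z hz, fun w hw => hmin hw⟩
  refine ⟨c, hc0, fun y hy ξ => ?_⟩
  rcases eq_or_ne ξ 0 with rfl | hξ
  · simp
  set v : Euc n := WithLp.toLp 2 ξ with hv
  have hv0 : v ≠ 0 := by simpa [hv] using hξ
  have hn : ‖v‖ ≠ 0 := norm_ne_zero_iff.2 hv0
  have h1 := hcq (y, ‖v‖⁻¹ • v) ⟨hy, by simp [norm_smul, hn]⟩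
  have h2 : q (y, ‖v‖⁻¹ • v) = (‖v‖⁻¹) ^ 2 * (ξ ⬝ᵥ (H y).mulVec ξ) := by
    simp only [hq, WithLp.ofLp_smul, Matrix.mulVec_smul, smul_dotProduct, dotProduct_smul, smul_eq_mul,
      hv]
    ring
  have h3 : ‖v‖ ^ 2 = ξ ⬝ᵥ ξ := by
    rw [EuclideanSpace.real_norm_sq_eq]
    simp [hv, dotProduct, sq]
  rw [h2] at h1
  rw [← h3]
  have h4 := mul_le_mul_of_nonneg_right h1 (sq_nonneg ‖v‖)
  calc c * ‖v‖ ^ 2 ≤ _ := h4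
    _ = ξ ⬝ᵥ (H y).mulVec ξ := by field_simp

end

section

variable {n : ℕ} {M : Type*} [TopologicalSpace M] [ChartedSpace (EuclideanSpace ℝ (Fin n)) M]
  [IsManifold (𝓡 n) ∞ M] {P : ReferenceManifold n M}
  {φ ψ : OpenPartialHomeomorph M (EuclideanSpace ℝ (Fin n))}

/-! ### Components of weighted Sobolev tensors in charts -/

theorem contDiffOn_smoothChristoffel (hφ : φ ∈ IsManifold.maximalAtlas (𝓡 n) ∞ M)
    (h : SmoothMetric n M) (k i j : Fin n) :
    ContDiffOn ℝ ∞ (fun y => smoothChristoffel φ h.toRiemannianMetric y k i j) φ.target := by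
  have h0 : ∀ i j, ContDiffOn ℝ ∞ (fun y => coordMatrix φ h.inner y i j) φ.target :=
    contDiffOn_coordMatrix_smooth hφ h
  have h1 : ∀ a i j, ContDiffOn ℝ ∞ (pd a fun y => coordMatrix φ h.inner y i j) φ.target :=
    fun a i j => pd_contDiffOn φ.open_target (h0 i j) a
  have h2 : ∀ i j, ContDiffOn ℝ ∞ (fun y => (coordMatrix φ h.inner y)⁻¹ i j) φ.target :=
    fun i j => contDiffOn_inv_entry h0
      (fun y hy => (coordMatrix_pos hφ h.toRiemannianMetric hy).det_pos.ne') i j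
  exact contDiffOn_const.mul (ContDiffOn.sum fun l _ =>
    (h2 k l).mul (((h1 i j l).add (h1 j i l)).sub (h1 l i j)))

variable [MeasurableSpace M] [BorelSpace M]

/-- On a compact set the density is bounded below, so Lebesgue measure is at most a multiple of the
chart measure. -/
theorem memLp_chart (hφ : φ ∈ IsManifold.maximalAtlas (𝓡 n) ∞ M) (h : SmoothMetric n M) {f : M → ℝ}
    {p : ENNReal} (hf : MemLp f p (riemannianMeasure h.toRiemannianMetric)) {K : Set (Euc n)}
    (hK : K ⊆ φ.target) (hc : IsCompact K) :
    MemLp (fun y => f (φ.symm y)) p (volume.restrict K) := by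
  have h1 : MemLp f p (chartMeasure φ h.toRiemannianMetric) :=
    hf.mono_measure (chartMeasure_le hφ _)
  have h2 := (memLp_map_measure_iff h1.1 (aemeasurable_chart_symm_withDensity _)).1 h1
  obtain ⟨C, hC⟩ := hc.exists_bound_of_continuousOn
    (f := fun y => (density φ h.toRiemannianMetric y)⁻¹)
    (((continuousOn_density hφ h).mono hK).inv₀ fun y hy => (density_pos hφ _ (hK hy)).ne')
  refine h2.of_measure_le_smul (c := ENNReal.ofReal C) ENNReal.ofReal_ne_top
    (Measure.le_iff.2 fun E hE => ?_)
  rw [Measure.restrict_apply hE, Measure.smul_apply, withDensity_apply _ hE,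
    Measure.restrict_restrict hE, smul_eq_mul]
  have hm : MeasurableSet (E ∩ K) := hE.inter hc.measurableSet
  calc volume (E ∩ K) = ∫⁻ _ in E ∩ K, 1 := by simp
    _ ≤ ∫⁻ y in E ∩ K, ENNReal.ofReal C * ENNReal.ofReal (density φ h.toRiemannianMetric y) := by
        refine setLIntegral_mono' hm fun y hy => ?_
        have hd := density_pos hφ h.toRiemannianMetric (hK hy.2)
        have h3 := hC y hy.2
        rw [Real.norm_of_nonneg (inv_nonneg.2 hd.le)] at h3
        rw [← ENNReal.ofReal_mul ((inv_nonneg.2 hd.le).trans h3), ← ENNReal.ofReal_one]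
        refine ENNReal.ofReal_le_ofReal ?_
        calc (1 : ℝ) = (density φ h.toRiemannianMetric y)⁻¹ * density φ h.toRiemannianMetric y := by
              rw [inv_mul_cancel₀ hd.ne']
          _ ≤ _ := mul_le_mul_of_nonneg_right h3 hd.le
    _ = ENNReal.ofReal C * ∫⁻ y in E ∩ K, ENNReal.ofReal (density φ h.toRiemannianMetric y) :=
        lintegral_const_mul' _ _ ENNReal.ofReal_ne_top
    _ ≤ _ := mul_le_mul_right (lintegral_mono_set (inter_subset_inter_right _ hK)) _

variable {B : BackgroundStructure P}

/-- On compact sets the weight is comparable to one and the coordinate vectors have bounded length,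
so components are bounded by a multiple of the weighted norm. -/
theorem MemWeightedLp.memLp_coordComp {p : ENNReal} {τ : ℝ} {m : ℕ} {T : TensorField n M m}
    (hT : MemWeightedLp B p τ T) (hφ : φ ∈ IsManifold.maximalAtlas (𝓡 n) ∞ M) (I : Fin m → Fin n)
    {K : Set (Euc n)} (hK : K ⊆ φ.target) (hc : IsCompact K) :
    MemLp (coordComp φ T I) p (volume.restrict K) := by
  have h1 := memLp_chart hφ B.smoothMetric hT.2 hK hc
  have hr : ContinuousOn (fun y => B.r (φ.symm y)) K :=
    B.contMDiff_r.continuous.comp_continuousOn (φ.continuousOn_symm.mono hK)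
  set s : ℝ := τ - n / p.toReal
  have hw : ContinuousOn (fun y => (B.r (φ.symm y)) ^ (-s) *
      ∏ a, Real.sqrt (coordMatrix φ B.h.inner y (I a) (I a))) K := by
    refine (hr.rpow_const fun y _ => Or.inl (B.r_pos _).ne').mul ?_
    refine continuousOn_finsetProd _ fun a _ => ?_
    exact ((contDiffOn_coordMatrix_smooth hφ B.smoothMetric _ _).continuousOn.mono hK).sqrt
  obtain ⟨C, hC⟩ := hc.exists_bound_of_continuousOn hw
  refine h1.of_le_mul (c := C) ((hT.1 φ hφ I).mono_measure (Measure.restrict_mono hK le_rfl)) ?_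
  rw [ae_restrict_iff' hc.measurableSet]
  refine ae_of_all _ fun y hy => ?_
  have h2 := abs_coordComp_le (φ := φ) B.h T I y
  have h3 := hC y hy
  have hrp := Real.rpow_pos_of_pos (B.r_pos (φ.symm y)) s
  have hrn := Real.rpow_pos_of_pos (B.r_pos (φ.symm y)) (-s)
  have htn : 0 ≤ tensorNorm B.h T (φ.symm y) := Real.sqrt_nonneg _
  have hpn : 0 ≤ ∏ a, Real.sqrt (coordMatrix φ B.h.inner y (I a) (I a)) :=
    Finset.prod_nonneg fun _ _ => Real.sqrt_nonneg _
  rw [Real.norm_of_nonneg (by positivity)] at h3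
  rw [Real.norm_eq_abs, Real.norm_of_nonneg (by positivity)]
  have h4 : B.r (φ.symm y) ^ (-s) * B.r (φ.symm y) ^ s = 1 := by
    rw [← Real.rpow_add (B.r_pos _)]; simp
  calc |coordComp φ T I y| ≤ _ := h2
    _ = (B.r (φ.symm y) ^ (-s) * ∏ a, Real.sqrt (coordMatrix φ B.h.inner y (I a) (I a))) *
          (B.r (φ.symm y) ^ s * tensorNorm B.h T (φ.symm y)) := by
        rw [mul_mul_mul_comm, h4, one_mul, mul_comm]
    _ ≤ _ := mul_le_mul_of_nonneg_right h3 (by positivity)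

/-- Components `∂_c u` of the first covariant derivative of a `(0,2)`-tensor. -/
theorem IsWeakCovDeriv.isWeakPartial_two {h : RoughMetric n M} {T : TensorField n M 2}
    {T' : TensorField n M 3} (hT : IsWeakCovDeriv h T T')
    (hφ : φ ∈ IsManifold.maximalAtlas (𝓡 n) ∞ M) (k i j : Fin n) :
    IsWeakPartial φ.target k (coordComp φ T ![i, j]) fun y => coordComp φ T' ![k, i, j] y +
      ∑ l, (smoothChristoffel φ h y l k i * coordComp φ T ![l, j] y +
        smoothChristoffel φ h y l k j * coordComp φ T ![i, l] y) := by
  have u0 : ∀ l, Function.update ![i, j] 0 l = ![l, j] := fun l => by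
    ext a; fin_cases a <;> simp [Function.update]
  have u1 : ∀ l, Function.update ![i, j] 1 l = ![i, l] := fun l => by
    ext a; fin_cases a <;> simp [Function.update]
  have := hT φ hφ k ![i, j]
  simp only [Fin.sum_univ_two, u0, u1] at this
  simp only [Finset.sum_add_distrib]
  exact this

theorem IsWeakCovDeriv.isWeakPartial_three {h : RoughMetric n M} {T : TensorField n M 3}
    {T' : TensorField n M 4} (hT : IsWeakCovDeriv h T T')
    (hφ : φ ∈ IsManifold.maximalAtlas (𝓡 n) ∞ M) (c k i j : Fin n) :
    IsWeakPartial φ.target c (coordComp φ T ![k, i, j]) fun y => coordComp φ T' ![c, k, i, j] y +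
      ∑ l, (smoothChristoffel φ h y l c k * coordComp φ T ![l, i, j] y +
        smoothChristoffel φ h y l c i * coordComp φ T ![k, l, j] y +
        smoothChristoffel φ h y l c j * coordComp φ T ![k, i, l] y) := by
  have u0 : ∀ l, Function.update ![k, i, j] 0 l = ![l, i, j] := fun l => by
    ext a; fin_cases a <;> simp [Function.update]
  have u1 : ∀ l, Function.update ![k, i, j] 1 l = ![k, l, j] := fun l => by
    ext a; fin_cases a <;> simp [Function.update]
  have u2 : ∀ l, Function.update ![k, i, j] 2 l = ![k, i, l] := fun l => by
    ext a; fin_cases a <;> simp [Function.update]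
  have := hT φ hφ c ![k, i, j]
  simp only [Fin.sum_univ_three, u0, u1, u2] at this
  simp only [Finset.sum_add_distrib]
  exact this

theorem coordComp_toTensor (b : BilinField n M) (y : Euc n) (i j : Fin n) :
    coordComp φ (BilinField.toTensor b) ![i, j] y = coordMatrix φ b y i j := rfl

/-- The weak derivatives of the error term of an asymptotically Euclidean metric. -/
structure HasErrorData (B : BackgroundStructure P) (τ : ℝ) (g : RoughMetric n M)
    (T₁ : TensorField n M 3) (T₂ : TensorField n M 4) : Prop where
  cov_one : IsWeakCovDeriv B.h (BilinField.toTensor fun x => g.inner x - B.h.inner x) T₁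
  cov_two : IsWeakCovDeriv B.h T₁ T₂
  mem_zero : MemWeightedLp B 2 τ (BilinField.toTensor fun x => g.inner x - B.h.inner x)
  mem_one : MemWeightedLp B 2 (τ + 1) T₁
  mem_two : MemWeightedLp B 2 (τ + 2) T₂

theorem MemWeightedSobolev.exists_hasErrorData {τ : ℝ} {g : RoughMetric n M}
    (hg : MemWeightedSobolev B 2 2 τ (BilinField.toTensor fun x => g.inner x - B.h.inner x)) :
    ∃ T₁ T₂, HasErrorData B τ g T₁ T₂ := by
  obtain ⟨S, h0, hd, hm⟩ := hg
  have d0 : IsWeakCovDeriv (m := 2) B.h (S 0) (S 1) := hd 0 (by norm_num)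
  have d1 : IsWeakCovDeriv (m := 3) B.h (S 1) (S 2) := hd 1 (by norm_num)
  have m0 : MemWeightedLp (m := 2) B 2 (τ + (0 : ℕ)) (S 0) := hm 0 (by norm_num)
  have m1 : MemWeightedLp (m := 3) B 2 (τ + (1 : ℕ)) (S 1) := hm 1 (by norm_num)
  have m2 : MemWeightedLp (m := 4) B 2 (τ + (2 : ℕ)) (S 2) := hm 2 (by norm_num)
  rw [Nat.cast_zero, add_zero] at m0
  rw [Nat.cast_one] at m1
  rw [Nat.cast_ofNat] at m2
  exact ⟨S 1, S 2, h0 ▸ d0, d1, h0 ▸ m0, m1, m2⟩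

end

section

variable {n : ℕ} {M : Type*} [TopologicalSpace M] [ChartedSpace (EuclideanSpace ℝ (Fin n)) M]
  [IsManifold (𝓡 n) ∞ M] {P : ReferenceManifold n M} [MeasurableSpace M] [BorelSpace M]
  {B : BackgroundStructure P} {φ ψ : OpenPartialHomeomorph M (EuclideanSpace ℝ (Fin n))}

/-! ### Curvature of asymptotically Euclidean metrics -/

theorem IsAsymptoticallyEuclidean.bddLoc_coordMatrix {k : ℕ} {p : ENNReal} {τ : ℝ}
    {g : RoughMetric n M} (hg : IsAsymptoticallyEuclidean B k p τ g)
    (hφ : φ ∈ IsManifold.maximalAtlas (𝓡 n) ∞ M) (i j : Fin n) :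
    BddLoc φ.target fun y => coordMatrix φ g.inner y i j := fun _ hK hc =>
  hg.metric_bounded.memLp_coordComp hφ ![i, j] hK hc

theorem coordMatrix_dotProduct (b : BilinField n M) (y : Euc n) (ξ : Fin n → ℝ) :
    ξ ⬝ᵥ (coordMatrix φ b y).mulVec ξ =
      formAt b (φ.symm y) (∑ i, ξ i • coordVecE φ y i) (∑ i, ξ i • coordVecE φ y i) := by
  simp only [map_sum, map_smul, sum_apply, smul_apply, smul_eq_mul, dotProduct, Matrix.mulVec,
    Finset.mul_sum, coordMatrix_apply]
  rw [Finset.sum_comm]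
  exact Finset.sum_congr rfl fun i _ => Finset.sum_congr rfl fun j _ => by ring

theorem IsAsymptoticallyEuclidean.ae_chart_le {k : ℕ} {p : ENNReal} {τ : ℝ}
    {g : RoughMetric n M} (hg : IsAsymptoticallyEuclidean B k p τ g) :
    ∃ C : ℝ, 1 < C ∧ ∀ φ ∈ IsManifold.maximalAtlas (𝓡 n) ∞ M, ∀ᵐ y ∂volume.restrict φ.target,
      ∀ ξ : Fin n → ℝ, C⁻¹ * (ξ ⬝ᵥ (coordMatrix φ B.h.inner y).mulVec ξ) ≤
          ξ ⬝ᵥ (coordMatrix φ g.inner y).mulVec ξ ∧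
        ξ ⬝ᵥ (coordMatrix φ g.inner y).mulVec ξ ≤
          C * (ξ ⬝ᵥ (coordMatrix φ B.h.inner y).mulVec ξ) := by
  obtain ⟨C, hC, h⟩ := hg.equivalent
  refine ⟨C, hC, fun φ hφ => ?_⟩
  filter_upwards [ae_chart_of_ae hφ B.smoothMetric h] with y hy ξ
  rw [coordMatrix_dotProduct, coordMatrix_dotProduct]
  exact hy (∑ i, ξ i • coordVecE φ y i)

theorem IsAsymptoticallyEuclidean.locCoercive {k : ℕ} {p : ENNReal} {τ : ℝ}
    {g : RoughMetric n M} (hg : IsAsymptoticallyEuclidean B k p τ g)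
    (hφ : φ ∈ IsManifold.maximalAtlas (𝓡 n) ∞ M) : LocCoercive φ.target (coordMatrix φ g.inner) := by
  intro K hK hc
  obtain ⟨C, hC, h⟩ := hg.ae_chart_le
  obtain ⟨c, hc0, hcK⟩ := exists_coercive_of_posDef hc (H := coordMatrix φ B.h.inner)
    (fun i j => (contDiffOn_coordMatrix_smooth hφ B.smoothMetric i j).continuousOn.mono hK)
    fun y hy => coordMatrix_pos hφ B.h (hK hy)
  refine ⟨C⁻¹ * c, by positivity, ?_⟩
  filter_upwards [ae_restrict_of_ae_restrict_of_subset hK (h φ hφ),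
    ae_restrict_mem hc.measurableSet] with y hy hyK ξ
  rw [mul_assoc]
  exact (mul_le_mul_of_nonneg_left (hcK y hyK ξ) (by positivity)).trans (hy ξ).1

/-- Write `g = h + e`. Partial derivatives of `e` are its covariant derivatives plus Christoffel
symbols of `h` times lower order terms; these symbols are smooth, so everything stays in `L²_loc`.
-/
theorem HasErrorData.exists_hasWeakCurvature {k : ℕ} {p : ENNReal} {τ τ' : ℝ} {g : RoughMetric n M}
    (hg : IsAsymptoticallyEuclidean B k p τ' g) {T₁ : TensorField n M 3} {T₂ : TensorField n M 4}
    (hT : HasErrorData B τ g T₁ T₂) (hφ : φ ∈ IsManifold.maximalAtlas (𝓡 n) ∞ M) :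
    ∃ dG dΓ, HasWeakCurvature φ.target (coordMatrix φ g.inner) dG dΓ := by
  have hΩ := φ.open_target
  have hH := contDiffOn_coordMatrix_smooth hφ B.smoothMetric
  have hΓ := contDiffOn_smoothChristoffel hφ B.smoothMetric
  set T₀ := BilinField.toTensor fun x => g.inner x - B.h.inner x
  set Γ := smoothChristoffel φ B.h
  have l0 : ∀ I, L2Loc φ.target (coordComp φ T₀ I) := fun I K hK hc =>
    hT.mem_zero.memLp_coordComp hφ I hK hc
  have l1 : ∀ I, L2Loc φ.target (coordComp φ T₁ I) := fun I K hK hc =>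
    hT.mem_one.memLp_coordComp hφ I hK hc
  have l2 : ∀ I, L2Loc φ.target (coordComp φ T₂ I) := fun I K hK hc =>
    hT.mem_two.memLp_coordComp hφ I hK hc
  have bs : ∀ {f : Euc n → ℝ}, ContDiffOn ℝ ∞ f φ.target → BddLoc φ.target f := fun hf =>
    .of_continuousOn hf.continuousOn
  have hdΓ := fun c k i j => pd_contDiffOn hΩ (hΓ k i j) c
  set dE : Fin n → Fin n → Fin n → Euc n → ℝ := fun k i j y => coordComp φ T₁ ![k, i, j] y +
    ∑ l, (Γ y l k i * coordComp φ T₀ ![l, j] y + Γ y l k j * coordComp φ T₀ ![i, l] y) with hdE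
  have wE : ∀ k i j, IsWeakPartial φ.target k (coordComp φ T₀ ![i, j]) (dE k i j) :=
    fun k i j => hT.cov_one.isWeakPartial_two hφ k i j
  have ldE : ∀ k i j, L2Loc φ.target (dE k i j) := fun k i j =>
    (l1 _).add (.sum _ fun l _ => ((bs (hΓ l k i)).mul_l2Loc (l0 _)).add
      ((bs (hΓ l k j)).mul_l2Loc (l0 _)))
  set dP : Fin n → Fin n → Fin n → Fin n → Euc n → ℝ := fun c k i j y =>
    coordComp φ T₂ ![c, k, i, j] y + ∑ l, (Γ y l c k * coordComp φ T₁ ![l, i, j] y +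
        Γ y l c i * coordComp φ T₁ ![k, l, j] y + Γ y l c j * coordComp φ T₁ ![k, i, l] y) with hdP
  have wP : ∀ c k i j, IsWeakPartial φ.target c (coordComp φ T₁ ![k, i, j]) (dP c k i j) :=
    fun c k i j => hT.cov_two.isWeakPartial_three hφ c k i j
  have ldP : ∀ c k i j, L2Loc φ.target (dP c k i j) := fun c k i j =>
    (l2 _).add (.sum _ fun l _ => (((bs (hΓ l c k)).mul_l2Loc (l1 _)).add
      ((bs (hΓ l c i)).mul_l2Loc (l1 _))).add ((bs (hΓ l c j)).mul_l2Loc (l1 _)))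
  have hh : ∀ i j, ContDiffOn ℝ ∞ (fun y => coordMatrix φ B.h.inner y i j) φ.target := hH
  have hg_eq : ∀ i j, (fun y => coordMatrix φ g.inner y i j) =
      fun y => coordMatrix φ B.h.inner y i j + coordComp φ T₀ ![i, j] y := by
    intro i j
    ext y
    rw [coordComp_toTensor]
    exact (add_sub_cancel _ _).symm
  refine ⟨fun k y => Matrix.of fun i j =>
    pd k (fun z => coordMatrix φ B.h.inner z i j) y + dE k i j y, _,
    hasWeakCurvature_of_l2Loc hΩ (ddG := fun c k y => Matrix.of fun i j =>
      pd c (pd k fun z => coordMatrix φ B.h.inner z i j) y + (dP c k i j y +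
        ∑ l, ((pd c (fun z => Γ z l k i) y * coordComp φ T₀ ![l, j] y + Γ y l k i * dE c l j y) +
          (pd c (fun z => Γ z l k j) y * coordComp φ T₀ ![i, l] y + Γ y l k j * dE c i l y))))
      (hg.bddLoc_coordMatrix hφ) (hg.locCoercive hφ) ?_ ?_ ?_ ?_⟩
  · intro k i j
    rw [hg_eq]
    exact (IsWeakPartial.of_contDiffOn hΩ (hh i j)).add (wE k i j)
  · intro c k i j
    exact (IsWeakPartial.of_contDiffOn hΩ (pd_contDiffOn hΩ (hh i j) k)).add
      ((wP c k i j).add (.sum _ fun l _ => ((wE c l j).smooth_mul hΩ (hΓ l k i)).add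
        ((wE c i l).smooth_mul hΩ (hΓ l k j))))
  · intro k i j
    exact (bs (pd_contDiffOn hΩ (hh i j) k)).l2Loc.add (ldE k i j)
  · intro c k i j
    exact (bs (pd_contDiffOn hΩ (pd_contDiffOn hΩ (hh i j) k) c)).l2Loc.add
      ((ldP c k i j).add (.sum _ fun l _ =>
        (((bs (hdΓ c l k i)).mul_l2Loc (l0 _)).add ((bs (hΓ l k i)).mul_l2Loc (ldE c l j))).add
        (((bs (hdΓ c l k j)).mul_l2Loc (l0 _)).add ((bs (hΓ l k j)).mul_l2Loc (ldE c i l)))))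

/-- The Ricci tensor of an asymptotically Euclidean metric exists. -/
theorem IsAsymptoticallyEuclidean.isRicciTensor [SecondCountableTopology M] {τ : ℝ}
    {g : RoughMetric n M} (hg : IsAsymptoticallyEuclidean B 2 2 τ g) :
    IsRicciTensor g (ricciTensor g) := by
  obtain ⟨T₁, T₂, hT⟩ := hg.error_mem.exists_hasErrorData
  exact isRicciTensor_ricciTensor g (exists_isRicciTensor g fun φ hφ =>
    hT.exists_hasWeakCurvature hg hφ)

end

section

variable {n : ℕ} {Ω : Set (Euc n)} {i : Fin n} {u v f : Euc n → ℝ}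

/-! ### Locally Lipschitz functions -/

open scoped NNReal

/-- At almost every point of a level set the derivative is determined by the function on that set,
where it is constant. The vector-valued `F` is approximated there by the zero map with error
constant `0`, so its derivative vanishes. Continuity suffices, since `fderiv` is zero where `f` is
not differentiable. -/
theorem fderiv_eq_zero_ae_of_level (hΩ : IsOpen Ω) (hf : ContinuousOn f Ω) (c : ℝ) :
    ∀ᵐ y ∂volume.restrict Ω, f y = c → fderiv ℝ f y = 0 := by
  rcases isEmpty_or_nonempty (Fin n) with hn | ⟨⟨i₀⟩⟩
  · exact ae_of_all _ fun y _ => Subsingleton.elim _ _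
  set s : Set (Euc n) := (Ω ∩ f ⁻¹' {c}) ∩ {y | fderiv ℝ f y ≠ 0} with hs
  have hsm : MeasurableSet s := (hf.measurableSet_inter_preimage' hΩ.measurableSet
    (measurableSet_singleton c)).inter ((measurable_fderiv ℝ f) (measurableSet_singleton 0).compl)
  set F : Euc n → Euc n := fun y => f y • stdVec i₀ with hF
  set F' : Euc n → Euc n →L[ℝ] Euc n := fun y => (fderiv ℝ f y).smulRight (stdVec i₀) with hF'
  have hd : ∀ y ∈ s, HasFDerivWithinAt F (F' y) s y := by
    rintro y ⟨-, hy⟩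
    have : DifferentiableAt ℝ f y := by
      by_contra h; exact hy (fderiv_zero_of_not_differentiableAt h)
    exact (this.hasFDerivAt.smul_const (stdVec i₀)).hasFDerivWithinAt
  have happ : ApproximatesLinearOn F (0 : Euc n →L[ℝ] Euc n) s 0 := by
    rintro x ⟨⟨-, hx⟩, -⟩ y ⟨⟨-, hy⟩, -⟩
    rw [mem_preimage, mem_singleton_iff] at hx hy
    simp [hF, hx, hy]
  have h1 := happ.norm_fderiv_sub_le volume hsm F' hd
  rw [ae_restrict_iff' hsm] at h1
  rw [ae_restrict_iff' hΩ.measurableSet]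
  filter_upwards [h1] with y hy hyΩ hyc
  by_contra hne
  have h2 := hy ⟨⟨hyΩ, hyc⟩, hne⟩
  have h3 : F' y = 0 := by simpa using h2
  refine hne (ContinuousLinearMap.ext fun v => ?_)
  have := congrArg (fun L : Euc n →L[ℝ] Euc n => L v i₀) h3
  simpa [hF'] using this

/-- By Rademacher the partial derivative is almost everywhere the line derivative, for which
integration by parts against a compactly supported Lipschitz function holds. -/
theorem isWeakPartial_of_lipschitzWith {C : ℝ≥0} (hf : LipschitzWith C f) (i : Fin n) :
    IsWeakPartial univ i f (pd i f) := by
  have hae : (fun x => lineDeriv ℝ f x (stdVec i)) =ᵐ[volume] pd i f := by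
    filter_upwards [hf.ae_differentiableAt (μ := volume)] with x hx
    exact hx.lineDeriv_eq_fderiv
  have hl := hf.locallyIntegrable_lineDeriv (μ := (volume : Measure (Euc n))) (stdVec i)
  refine .of_test (hf.continuous.locallyIntegrable.locallyIntegrableOn _)
    (LocallyIntegrableOn.congr_ae_restrict isOpen_univ (hl.locallyIntegrableOn _)
      (by rwa [Measure.restrict_univ])) fun η hη => ?_
  obtain ⟨D, hD⟩ := hη.smooth.lipschitzWith_of_hasCompactSupport hη.compact (by simp)
  have h1 := hf.integral_lineDeriv_mul_eq (μ := (volume : Measure (Euc n))) hD hη.compact (stdVec i)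
  have h2 : ∫ x, lineDeriv ℝ f x (stdVec i) * η x = ∫ x, pd i f x * η x :=
    integral_congr_ae (by filter_upwards [hae] with x hx; rw [hx])
  rw [← h2, h1, ← integral_neg]
  refine integral_congr_ae (ae_of_all _ fun x => ?_)
  have hd : DifferentiableAt ℝ η x := hη.smooth.differentiable (by simp) x
  simp only
  rw [hd.lineDeriv_eq_fderiv, map_neg]
  ring

theorem exists_lipschitzWith_eqOn (hΩ : IsOpen Ω) (hf : LocallyLipschitzOn Ω f) {K : Set (Euc n)}
    (hK : IsCompact K) (hs : K ⊆ Ω) :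
    ∃ (C : ℝ≥0) (f₁ : Euc n → ℝ), LipschitzWith C f₁ ∧ ∀ y ∈ K, f =ᶠ[𝓝 y] f₁ := by
  obtain ⟨K', hK', h1, h2⟩ := exists_compact_between hK hΩ hs
  obtain ⟨C, hC⟩ := (hf.mono h2).exists_lipschitzOnWith_of_compact hK'
  obtain ⟨f₁, hf₁, he⟩ := hC.extend_real
  refine ⟨C, f₁, hf₁, fun y hy => ?_⟩
  filter_upwards [mem_interior_iff_mem_nhds.1 (h1 hy)] with z hz
  exact he hz

theorem bddLoc_pd_of_locallyLipschitzOn (hΩ : IsOpen Ω) (hf : LocallyLipschitzOn Ω f) (i : Fin n) :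
    BddLoc Ω (pd i f) := by
  intro K hK hc
  obtain ⟨C, f₁, hf₁, he⟩ := exists_lipschitzWith_eqOn hΩ hf hc hK
  refine memLp_top_of_bound (measurable_fderiv_apply_const ℝ f _).aestronglyMeasurable C ?_
  rw [ae_restrict_iff' hc.measurableSet]
  refine ae_of_all _ fun y hy => ?_
  have h1 : pd i f y = pd i f₁ y := by unfold pd; rw [(he y hy).fderiv_eq]
  rw [h1]
  calc ‖fderiv ℝ f₁ y (stdVec i)‖ ≤ ‖fderiv ℝ f₁ y‖ * ‖stdVec i‖ :=
        ContinuousLinearMap.le_opNorm _ _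
    _ ≤ C * 1 := by
        gcongr
        · exact norm_fderiv_le_of_lipschitz ℝ hf₁
        · simp
    _ = C := mul_one _

theorem isWeakPartial_of_locallyLipschitzOn (hΩ : IsOpen Ω) (hf : LocallyLipschitzOn Ω f)
    (i : Fin n) : IsWeakPartial Ω i f (pd i f) := by
  refine .of_test (locallyIntegrableOn_of_continuousOn hΩ hf.continuousOn)
    ((bddLoc_pd_of_locallyLipschitzOn hΩ hf i).l2Loc.locallyIntegrableOn hΩ) fun η hη => ?_
  obtain ⟨C, f₁, hf₁, he⟩ := exists_lipschitzWith_eqOn hΩ hf hη.compact hη.subset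
  have h1 := (isWeakPartial_of_lipschitzWith hf₁ i).integral_eq (hη.mono (subset_univ _))
  have e1 : ∫ y, f y * fderiv ℝ η y (stdVec i) = ∫ y, f₁ y * fderiv ℝ η y (stdVec i) := by
    congr 1; ext y
    by_cases hy : y ∈ tsupport η
    · rw [(he y hy).eq_of_nhds]
    · rw [show fderiv ℝ η y (stdVec i) = 0 from
        image_eq_zero_of_notMem_tsupport (f := pd i η) fun h => hy (tsupport_pd_subset η i h)]
      simp
  have e2 : ∫ y, pd i f y * η y = ∫ y, pd i f₁ y * η y := by
    congr 1; ext y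
    by_cases hy : y ∈ tsupport η
    · unfold pd; rw [(he y hy).fderiv_eq]
    · rw [image_eq_zero_of_notMem_tsupport hy]; simp
  rw [e1, e2, h1]

/-! ### Divergence-free fields and weakly differentiable test functions -/

/-- Needed because the cutoff functions are only Lipschitz. The compactly supported `ζ` is
approximated by mollification, and `L²` convergence of its gradient passes to the limit against the
`L²_loc` field `U`. -/
theorem sum_integral_eq_zero_of_divergence_free (hΩ : IsOpen Ω) {U : Fin n → Euc n → ℝ}
    (hU : ∀ j, L2Loc Ω (U j)) (hdiv : ∀ η, IsTest Ω η → ∑ j, ∫ y, U j y * pd j η y = 0)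
    {ζ : Euc n → ℝ} {z : Fin n → Euc n → ℝ} (hζ : ∀ j, IsWeakPartial Ω j ζ (z j))
    (lζ : L2Loc Ω ζ) (lz : ∀ j, L2Loc Ω (z j)) {K : Set (Euc n)} (hK : IsCompact K) (hs : K ⊆ Ω)
    (h0 : ∀ y ∈ Ω \ K, ζ y = 0) (hz : ∀ j, ∀ y ∈ Ω \ K, z j y = 0) :
    ∑ j, ∫ y in Ω, U j y * z j y = 0 := by
  obtain ⟨θ, hθ, hθ1, -⟩ := exists_isTest_one_nhds hΩ hK hs
  have hθK : ∀ y ∈ K, θ y = 1 ∧ ∀ j, pd j θ y = 0 := fun y hy => by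
    exact ⟨(eventually_nhdsSet_iff_forall.1 hθ1 y hy).self_of_nhds, pd_eq_zero_of_one_nhds hθ1 hy⟩
  have hθΩ : ∀ y ∉ Ω, θ y = 0 ∧ ∀ j, pd j θ y = 0 := fun y hy =>
    ⟨image_eq_zero_of_notMem_tsupport fun h => hy (hθ.subset h), fun j =>
      image_eq_zero_of_notMem_tsupport fun h => hy (hθ.subset (tsupport_pd_subset θ j h))⟩
  set f : Euc n → ℝ := fun y => θ y * ζ y with hf
  set w : Fin n → Euc n → ℝ := fun j y => pd j θ y * ζ y + θ y * z j y with hw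
  have hfw : ∀ j, IsWeakPartial univ j f (w j) := fun j => (hζ j).test_mul hθ
  have lf : MemLp f 2 := lζ.test_mul hθ.smooth.continuous hθ.compact hθ.subset
  have lw : ∀ j, MemLp (w j) 2 := fun j =>
    (lζ.test_mul (hθ.pd j).smooth.continuous (hθ.pd j).compact (hθ.pd j).subset).add
      ((lz j).test_mul hθ.smooth.continuous hθ.compact hθ.subset)
  have cf : HasCompactSupport f := hθ.compact.mul_right
  have cw : ∀ j, HasCompactSupport (w j) := fun j =>
    (hθ.pd j).compact.mul_right.add hθ.compact.mul_right
  have hwz : ∀ j y, y ∈ Ω → w j y = z j y := by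
    intro j y hy
    by_cases hyK : y ∈ K
    · simp [hw, hθK y hyK]
    · simp [hw, h0 y ⟨hy, hyK⟩, hz j y ⟨hy, hyK⟩]
  have hlocf : LocallyIntegrable f := lf.locallyIntegrable (by norm_num)
  have g1 : ∀ j, MemLp (fun y => pd j θ y * U j y) 2 := fun j =>
    (hU j).test_mul (hθ.pd j).smooth.continuous (hθ.pd j).compact (hθ.pd j).subset
  have g2 : ∀ j, MemLp (fun y => θ y * U j y) 2 := fun j =>
    (hU j).test_mul hθ.smooth.continuous hθ.compact hθ.subset
  have t1 : ∀ j, Tendsto (fun k => ∫ y, moll k f y * (pd j θ y * U j y)) atTop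
      (𝓝 (∫ y, f y * (pd j θ y * U j y))) := fun j =>
    tendsto_integral_mul_of_L2 (fun k => moll_memLp k hlocf cf) lf (g1 j) (moll_tendsto_L2 lf)
  have t2 : ∀ j, Tendsto (fun k => ∫ y, moll k (w j) y * (θ y * U j y)) atTop
      (𝓝 (∫ y, w j y * (θ y * U j y))) := fun j =>
    tendsto_integral_mul_of_L2 (fun k => moll_memLp k ((lw j).locallyIntegrable (by norm_num)) (cw j)) (lw j) (g2 j) (moll_tendsto_L2 (lw j))
  have ht : Tendsto (fun k => ∑ j, ((∫ y, moll k f y * (pd j θ y * U j y)) +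
      ∫ y, moll k (w j) y * (θ y * U j y))) atTop
      (𝓝 (∑ j, ((∫ y, f y * (pd j θ y * U j y)) + ∫ y, w j y * (θ y * U j y)))) :=
    tendsto_finsetSum _ fun j _ => (t1 j).add (t2 j)
  have hzero : ∀ k, ∑ j, ((∫ y, moll k f y * (pd j θ y * U j y)) +
      ∫ y, moll k (w j) y * (θ y * U j y)) = 0 := by
    intro k
    have hmc := moll_contDiff k hlocf
    -- The second factor `θ` keeps the support in `Ω` whatever the mollification radius.
    have hη : IsTest Ω fun y => moll k f y * θ y := hθ.smul hΩ hmc.contDiffOn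
    rw [← hdiv _ hη]
    refine Finset.sum_congr rfl fun j _ => ?_
    rw [← integral_add (integrable_mul_of_memLp_two (moll_memLp k hlocf cf) (g1 j))
      (integrable_mul_of_memLp_two (moll_memLp k ((lw j).locallyIntegrable (by norm_num)) (cw j)) (g2 j))]
    refine integral_congr_ae (ae_of_all _ fun y => ?_)
    simp only
    rw [pd_mul (hmc.differentiable (by simp) y) (hθ.smooth.differentiable (by simp) y),
      pd_moll k (hfw j)]
    ring
  simp only [hzero] at ht
  have := tendsto_nhds_unique ht tendsto_const_nhds
  rw [← this]
  refine Finset.sum_congr rfl fun j _ => ?_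
  have e1 : ∀ y, f y * (pd j θ y * U j y) = 0 := by
    intro y
    by_cases hy : y ∈ Ω
    · by_cases hyK : y ∈ K
      · simp [hθK y hyK]
      · simp [hf, h0 y ⟨hy, hyK⟩]
    · simp [hθΩ y hy]
  simp only [e1, integral_zero, zero_add]
  rw [← integral_indicator hΩ.measurableSet]
  congr 1; ext y
  by_cases hy : y ∈ Ω
  · rw [indicator_of_mem hy, hwz j y hy]
    by_cases hyK : y ∈ K
    · simp [hθK y hyK, mul_comm]
    · simp [hz j y ⟨hy, hyK⟩]
  · simp [indicator_of_notMem hy, hθΩ y hy]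

end

section

variable {n : ℕ} {Ω : Set (Euc n)}

/-! ### The linearised Einstein tensor -/

/-- The Ricci tensor linearised at the Euclidean metric, `q c k i j` standing for
`∂_c ∂_k g_{ij}`. -/
def linRicci (q : Fin n → Fin n → Matrix (Fin n) (Fin n) ℝ) (i j : Fin n) : ℝ :=
  (1 / 2) * ∑ k, (q k i j k + q k j i k - q k k i j - q j i k k)

/-- The linearised scalar curvature. -/
def linScal (q : Fin n → Fin n → Matrix (Fin n) (Fin n) ℝ) : ℝ :=
  ∑ i, ∑ k, (q k i i k - q k k i i)

/-- The linearised Einstein tensor. -/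
def linEinstein (q : Fin n → Fin n → Matrix (Fin n) (Fin n) ℝ) (i j : Fin n) : ℝ :=
  linRicci q i j - (1 / 2) * (linScal q * (1 : Matrix (Fin n) (Fin n) ℝ) i j)

theorem sum_linRicci (q : Fin n → Fin n → Matrix (Fin n) (Fin n) ℝ) :
    ∑ i, linRicci q i i = linScal q := by
  have h : ∑ i, ∑ k, q i i k k = ∑ i, ∑ k, q k k i i := Finset.sum_comm
  simp only [linRicci, linScal, ← Finset.mul_sum, Finset.sum_sub_distrib, Finset.sum_add_distrib]
  rw [h]
  ring

/-- Pairing with the position field leaves exactly this trace, which is how integrability of the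
scalar curvature enters the limit. -/
theorem sum_linEinstein (q : Fin n → Fin n → Matrix (Fin n) (Fin n) ℝ) :
    ∑ i, linEinstein q i i = (1 - (n : ℝ) / 2) * linScal q := by
  simp only [linEinstein, Finset.sum_sub_distrib, sum_linRicci, Matrix.one_apply_eq, mul_one,
    Finset.sum_const, Finset.card_univ, Fintype.card_fin, nsmul_eq_mul]
  ring

/-- `u` can be integrated against `η`, the integral being `c`. -/
structure HasPairing (η u : Euc n → ℝ) (c : ℝ) : Prop where
  integrable : Integrable fun y => u y * η y
  integral_eq : ∫ y, u y * η y = c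

namespace HasPairing

variable {η u v : Euc n → ℝ} {c d : ℝ}

theorem add (h : HasPairing η u c) (h' : HasPairing η v d) :
    HasPairing η (fun y => u y + v y) (c + d) := by
  refine ⟨?_, ?_⟩
  · simpa only [add_mul] using! h.1.add h'.1
  · simp only [add_mul]
    rw [integral_add h.1 h'.1, h.2, h'.2]

theorem const_mul (h : HasPairing η u c) (a : ℝ) : HasPairing η (fun y => a * u y) (a * c) := by
  refine ⟨?_, ?_⟩
  · simpa only [mul_assoc] using h.1.const_mul a
  · simp only [mul_assoc]
    rw [integral_const_mul, h.2]

theorem mul_const (h : HasPairing η u c) (a : ℝ) : HasPairing η (fun y => u y * a) (c * a) := by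
  simpa only [mul_comm] using h.const_mul a

theorem sub (h : HasPairing η u c) (h' : HasPairing η v d) :
    HasPairing η (fun y => u y - v y) (c - d) := by
  simpa [sub_eq_add_neg] using h.add (h'.const_mul (-1))

theorem sum {ι : Type*} (s : Finset ι) {U : ι → Euc n → ℝ} {C : ι → ℝ}
    (h : ∀ a ∈ s, HasPairing η (U a) (C a)) :
    HasPairing η (fun y => ∑ a ∈ s, U a y) (∑ a ∈ s, C a) := by
  refine ⟨?_, ?_⟩
  · simp only [Finset.sum_mul]
    exact integrable_finsetSum _ fun a ha => (h a ha).1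
  · simp only [Finset.sum_mul]
    rw [integral_finsetSum _ fun a ha => (h a ha).1]
    exact Finset.sum_congr rfl fun a ha => (h a ha).2

end HasPairing

/-- The linearised Einstein tensor is divergence free. -/
theorem linEinstein_divergence_free {G : Euc n → Matrix (Fin n) (Fin n) ℝ}
    {p : Fin n → Euc n → Matrix (Fin n) (Fin n) ℝ}
    {q : Fin n → Fin n → Euc n → Matrix (Fin n) (Fin n) ℝ}
    (hp : ∀ k i j, IsWeakPartial Ω k (fun y => G y i j) fun y => p k y i j)
    (hq : ∀ c k i j, IsWeakPartial Ω c (fun y => p k y i j) fun y => q c k y i j)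
    {η : Euc n → ℝ} (hη : IsTest Ω η) (i : Fin n) :
    ∑ j, ∫ y, linEinstein (fun c k => q c k y) i j * pd j η y = 0 := by
  -- Two integrations by parts express every term through third derivatives of the test function.
  -- What remains is relabelling of indices and commutation of these derivatives; symmetry of `G`
  -- plays no role.
  set T : Fin n → Fin n → Fin n → Fin n → Fin n → ℝ := fun a b x y z =>
    ∫ w, G w a b * pd x (pd y (pd z η)) w with hT
  have c1 : ∀ x y z, pd x (pd y (pd z η)) = pd y (pd x (pd z η)) := fun x y z => funext fun w =>
    pd_comm isOpen_univ (hη.pd z).smooth.contDiffOn (mem_univ w) x y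
  have c2 : ∀ y z, pd y (pd z η) = pd z (pd y η) := fun y z => funext fun w =>
    pd_comm isOpen_univ hη.smooth.contDiffOn (mem_univ w) y z
  have hQ : ∀ c k a b j, HasPairing (pd j η) (fun y => q c k y a b) (T a b k c j) := by
    intro c k a b j
    refine ⟨(hη.pd j).integrable_mul (hq c k a b).2.1, ?_⟩
    have h1 := (hq c k a b).integral_eq (hη.pd j)
    have h2 := (hp k a b).integral_eq ((hη.pd j).pd c)
    calc ∫ y, q c k y a b * pd j η y = -∫ y, p k y a b * pd c (pd j η) y := by
          rw [eq_neg_iff_add_eq_zero, add_comm, ← eq_neg_iff_add_eq_zero]; exact h1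
      _ = T a b k c j := by rw [← h2]; rfl
  have hE : ∀ j, ∫ y, linEinstein (fun c k => q c k y) i j * pd j η y =
      (1 / 2) * ∑ k, (T j k i k j + T i k j k j - T i j k k j - T k k i j j) -
        (1 / 2) * ((∑ l, ∑ k, (T l k l k j - T l l k k j)) * (1 : Matrix (Fin n) (Fin n) ℝ) i j) := by
    intro j
    exact (((HasPairing.sum _ fun k _ => (((hQ k i j k j).add (hQ k j i k j)).sub
      (hQ k k i j j)).sub (hQ j i k k j)).const_mul _).sub (((HasPairing.sum _ fun l _ =>
        HasPairing.sum _ fun k _ => (hQ k l l k j).sub (hQ k k l l j)).mul_const _).const_mul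
          _)).integral_eq
  simp only [hE, Finset.sum_sub_distrib, ← Finset.mul_sum, Matrix.one_apply, mul_ite, mul_one,
    mul_zero, Finset.sum_ite_eq, Finset.mem_univ, if_true, Finset.sum_add_distrib]
  -- The second and third Ricci terms cancel each other; the first and fourth cancel against the
  -- scalar curvature.
  have e1 : ∑ j, ∑ k, T i k j k j = ∑ j, ∑ k, T i j k k j := by
    rw [Finset.sum_comm]
    refine Finset.sum_congr rfl fun k _ => Finset.sum_congr rfl fun j _ => ?_
    simp only [hT, c1 j k j, c2 j k]
  have e2 : ∑ j, ∑ k, T j k i k j = ∑ l, ∑ k, T l k l k i := by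
    refine Finset.sum_congr rfl fun j _ => Finset.sum_congr rfl fun k _ => ?_
    simp only [hT, c2 k j, c1 i j k, c2 i k]
  have e3 : ∑ j, ∑ k, T k k i j j = ∑ l, ∑ k, T l l k k i := by
    rw [Finset.sum_comm]
    refine Finset.sum_congr rfl fun j _ => Finset.sum_congr rfl fun k _ => ?_
    simp only [hT, c1 i k k, c2 i k]
  rw [e1, e2, e3]
  ring

end

section

variable {n : ℕ} {ν : Measure (Euc n)}

/-! ### Decay of the nonlinear terms -/

theorem integrable_bdd_mul {u v : Euc n → ℝ} (hu : MemLp u ⊤ ν) (hv : Integrable v ν) :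
    Integrable (fun y => u y * v y) ν :=
  memLp_one_iff_integrable.1 ((memLp_one_iff_integrable.2 hv).mul hu)

/-- A metric with two derivatives which decay in the weighted `L²` sense. -/
structure HasDecay (ν : Measure (Euc n)) (G : Euc n → Matrix (Fin n) (Fin n) ℝ)
    (p : Fin n → Euc n → Matrix (Fin n) (Fin n) ℝ)
    (q : Fin n → Fin n → Euc n → Matrix (Fin n) (Fin n) ℝ) : Prop where
  norm_ne : ∀ᵐ y ∂ν, ‖y‖ ≠ 0
  bdd : ∀ i j, MemLp (fun y => G y i j) ⊤ ν
  coercive : ∃ c : ℝ, 0 < c ∧ ∀ᵐ y ∂ν, ∀ ξ : Fin n → ℝ, c * (ξ ⬝ᵥ ξ) ≤ ξ ⬝ᵥ (G y).mulVec ξ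
  decay_zero : ∀ i j, MemLp (fun y => ‖y‖⁻¹ * (G y i j - (1 : Matrix (Fin n) (Fin n) ℝ) i j)) 2 ν
  decay_one : ∀ k i j, MemLp (fun y => p k y i j) 2 ν
  decay_two : ∀ c k i j, MemLp (fun y => ‖y‖ * q c k y i j) 2 ν

namespace HasDecay

variable {G : Euc n → Matrix (Fin n) (Fin n) ℝ} {p : Fin n → Euc n → Matrix (Fin n) (Fin n) ℝ}
  {q : Fin n → Fin n → Euc n → Matrix (Fin n) (Fin n) ℝ} (h : HasDecay ν G p q)
include h

theorem bdd_inv (a b : Fin n) : MemLp (fun y => (G y)⁻¹ a b) ⊤ ν := by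
  obtain ⟨c, hc, hco⟩ := h.coercive
  refine memLp_top_of_bound (aestronglyMeasurable_inv_entry (fun a b => (h.bdd a b).1) a b) c⁻¹ ?_
  filter_upwards [hco] with y hy
  exact coercive_inv_le hc hy a b

/-- From `G⁻¹ - 1 = -G⁻¹ (G - 1)` with bounded `G⁻¹`. -/
theorem decay_inv (a b : Fin n) :
    MemLp (fun y => ‖y‖⁻¹ * ((G y)⁻¹ a b - (1 : Matrix (Fin n) (Fin n) ℝ) a b)) 2 ν := by
  obtain ⟨c, hc, hco⟩ := h.coercive
  have h1 : MemLp (fun y => ∑ m, (-1) * ((G y)⁻¹ a m *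
      (‖y‖⁻¹ * (G y m b - (1 : Matrix (Fin n) (Fin n) ℝ) m b)))) 2 ν :=
    memLp_finsetSum _ fun m _ => ((h.decay_zero m b).mul (h.bdd_inv a m)).const_mul (-1)
  refine h1.ae_eq ?_
  filter_upwards [hco] with y hy
  have hB := Matrix.nonsing_inv_mul (G y) (coercive_det_ne_zero hc hy).isUnit
  have h2 : (G y)⁻¹ - 1 = -((G y)⁻¹ * (G y - 1)) := by rw [mul_sub, hB, mul_one, neg_sub]
  have h3 := congrFun (congrFun h2 a) b
  rw [Matrix.sub_apply, Matrix.neg_apply, Matrix.mul_apply] at h3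
  rw [h3, ← Finset.sum_neg_distrib, Finset.mul_sum]
  refine Finset.sum_congr rfl fun m _ => ?_
  rw [Matrix.sub_apply]; ring

/-- The weights cancel and Cauchy–Schwarz applies; this is where the critical decay rate suffices.
-/
theorem integrable_mul {u v : Euc n → ℝ} (hu : MemLp (fun y => ‖y‖⁻¹ * u y) 2 ν)
    (hv : MemLp (fun y => ‖y‖ * v y) 2 ν) : Integrable (fun y => u y * v y) ν := by
  refine (hu.integrable_mul hv).congr ?_
  filter_upwards [h.norm_ne] with y hy
  simp only [Pi.mul_apply]
  field_simp

theorem memLp_christoffel (k i j : Fin n) :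
    MemLp (fun y => christoffel (G y) (fun a => p a y) k i j) 2 ν :=
  (memLp_finsetSum _ fun l _ => ((((h.decay_one i j l).add (h.decay_one j i l)).sub
    (h.decay_one l i j)).mul (h.bdd_inv k l))).const_mul _

theorem memLp_mul_lin (c i j l : Fin n) :
    MemLp (fun y => ‖y‖ * (q c i y j l + q c j y i l - q c l y i j)) 2 ν := by
  have := ((h.decay_two c i j l).add (h.decay_two c j i l)).sub (h.decay_two c l i j)
  refine this.ae_eq (ae_of_all _ fun y => ?_)
  simp only [Pi.add_apply, Pi.sub_apply]
  ring

/-- Subtracting the linear part leaves `∂(G⁻¹) ∂G`, quadratic in `∂G ∈ L²`, and `(G⁻¹ - 1) ∂²G`, a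
product with cancelling weights. -/
theorem integrable_christoffelDeriv_sub (c k i j : Fin n) :
    Integrable (fun y => christoffelDeriv (G y)⁻¹ (fun a => p a y) (fun c a => q c a y) c k i j -
      (1 / 2) * (q c i y j k + q c j y i k - q c k y i j)) ν := by
  have h1 : ∀ l, Integrable (fun y => (-∑ a, ∑ b, (G y)⁻¹ k a * p c y a b * (G y)⁻¹ b l) *
      (p i y j l + p j y i l - p l y i j)) ν := by
    intro l
    have hs : MemLp (fun y => ∑ a, ∑ b, (G y)⁻¹ k a * p c y a b * (G y)⁻¹ b l) 2 ν := by
      refine memLp_finsetSum _ fun a _ => memLp_finsetSum _ fun b _ => ?_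
      have := ((h.decay_one c a b).mul (h.bdd_inv k a) (r := 2))
      exact (h.bdd_inv b l).mul this
    exact hs.neg.integrable_mul
      (((h.decay_one i j l).add (h.decay_one j i l)).sub (h.decay_one l i j))
  have h2 : ∀ l, Integrable (fun y => ((G y)⁻¹ k l - (1 : Matrix (Fin n) (Fin n) ℝ) k l) *
      (q c i y j l + q c j y i l - q c l y i j)) ν := fun l =>
    h.integrable_mul (h.decay_inv k l) (h.memLp_mul_lin c i j l)
  have h3 := (integrable_finsetSum Finset.univ fun l _ => (h1 l).add (h2 l)).const_mul (1 / 2)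
  refine h3.congr (ae_of_all _ fun y => ?_)
  have h4 : q c i y j k + q c j y i k - q c k y i j = ∑ l, (1 : Matrix (Fin n) (Fin n) ℝ) k l *
      (q c i y j l + q c j y i l - q c l y i j) := by simp [Matrix.one_apply]
  simp only [christoffelDeriv, Pi.add_apply]
  rw [h4, ← mul_sub, ← Finset.sum_sub_distrib]
  congr 1
  exact Finset.sum_congr rfl fun l _ => by ring

/-- The Ricci tensor agrees with its linearisation up to an integrable error. -/
theorem integrable_ricciForm_sub (i j : Fin n) :
    Integrable (fun y => ricciForm (christoffel (G y) fun a => p a y)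
      (christoffelDeriv (G y)⁻¹ (fun a => p a y) fun c a => q c a y) i j -
        linRicci (fun c k => q c k y) i j) ν := by
  have h1 := integrable_finsetSum Finset.univ fun k (_ : k ∈ Finset.univ) =>
    (h.integrable_christoffelDeriv_sub k k i j).sub (h.integrable_christoffelDeriv_sub j k i k)
  have h2 := integrable_finsetSum Finset.univ fun k (_ : k ∈ Finset.univ) =>
    integrable_finsetSum Finset.univ fun l (_ : l ∈ Finset.univ) =>
      ((h.memLp_christoffel k k l).integrable_mul (h.memLp_christoffel l i j)).sub
        ((h.memLp_christoffel k j l).integrable_mul (h.memLp_christoffel l i k))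
  refine (h1.add h2).congr (ae_of_all _ fun y => ?_)
  simp only [Pi.add_apply, Pi.sub_apply, Pi.mul_apply, ricciForm, linRicci]
  rw [add_sub_right_comm, Finset.mul_sum, ← Finset.sum_sub_distrib]
  congr 1
  exact Finset.sum_congr rfl fun k _ => by ring

theorem memLp_mul_linRicci (i j : Fin n) :
    MemLp (fun y => ‖y‖ * linRicci (fun c k => q c k y) i j) 2 ν := by
  have := (memLp_finsetSum Finset.univ fun k (_ : k ∈ Finset.univ) =>
    (((h.decay_two k i j k).add (h.decay_two k j i k)).sub (h.decay_two k k i j)).sub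
      (h.decay_two j i k k)).const_mul (1 / 2)
  refine this.ae_eq (ae_of_all _ fun y => ?_)
  simp only [linRicci, Pi.add_apply, Pi.sub_apply, Finset.mul_sum]
  exact Finset.sum_congr rfl fun k _ => by ring

theorem memLp_mul_linEinstein (i j : Fin n) :
    MemLp (fun y => ‖y‖ * linEinstein (fun c k => q c k y) i j) 2 ν := by
  have h1 := memLp_finsetSum Finset.univ fun l (_ : l ∈ Finset.univ) => h.memLp_mul_linRicci l l
  have := (h.memLp_mul_linRicci i j).sub
    (h1.const_mul (1 / 2 * (1 : Matrix (Fin n) (Fin n) ℝ) i j))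
  refine this.ae_eq (ae_of_all _ fun y => ?_)
  simp only [linEinstein, Pi.sub_apply, ← Finset.mul_sum, sum_linRicci]
  ring

variable {Ric : Euc n → Matrix (Fin n) (Fin n) ℝ}
  (hR : ∀ i j, Integrable (fun y => Ric y i j - linRicci (fun c k => q c k y) i j) ν)
  (hS : Integrable (fun y => ∑ i, ∑ j, (G y)⁻¹ i j * Ric y i j) ν)
include hR hS

/-- Decompose the difference as the trace by `G⁻¹` of the integrable Ricci error, plus `G⁻¹ - 1`
contracted with the linearised Ricci tensor. -/
theorem integrable_scal_sub : Integrable (fun y => ∑ i, ∑ j, (G y)⁻¹ i j * Ric y i j -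
    linScal fun c k => q c k y) ν := by
  have h1 := integrable_finsetSum Finset.univ fun i (_ : i ∈ Finset.univ) =>
    integrable_finsetSum Finset.univ fun j (_ : j ∈ Finset.univ) =>
      (integrable_bdd_mul (h.bdd_inv i j) (hR i j)).add
        (h.integrable_mul (h.decay_inv i j) (h.memLp_mul_linRicci i j))
  refine h1.congr (ae_of_all _ fun y => ?_)
  have h2 : linScal (fun c k => q c k y) = ∑ i, ∑ j, (1 : Matrix (Fin n) (Fin n) ℝ) i j *
      linRicci (fun c k => q c k y) i j := by
    rw [← sum_linRicci]; simp [Matrix.one_apply]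
  simp only [Pi.add_apply]
  rw [h2, ← Finset.sum_sub_distrib]
  refine Finset.sum_congr rfl fun i _ => ?_
  rw [← Finset.sum_sub_distrib]
  exact Finset.sum_congr rfl fun j _ => by ring

theorem integrable_linScal : Integrable (fun y => linScal fun c k => q c k y) ν := by
  refine (hS.sub (h.integrable_scal_sub hR hS)).congr (ae_of_all _ fun y => ?_)
  simp

/-- The Einstein tensor agrees with its linearisation up to an integrable error. -/
theorem integrable_einstein_sub (i j : Fin n) :
    Integrable (fun y => Ric y i j - (∑ a, ∑ b, (G y)⁻¹ a b * Ric y a b) / 2 * G y i j -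
      linEinstein (fun c k => q c k y) i j) ν := by
  -- The scalar terms need no comparison: both the scalar curvature times bounded `G` and the
  -- linearised scalar curvature are integrable on their own.
  have h1 := integrable_bdd_mul (h.bdd i j) hS
  have h2 := ((hR i j).sub (h1.const_mul (1 / 2))).add
    ((h.integrable_linScal hR hS).const_mul (1 / 2 * (1 : Matrix (Fin n) (Fin n) ℝ) i j))
  refine h2.congr (ae_of_all _ fun y => ?_)
  simp only [Pi.add_apply, Pi.sub_apply, linEinstein]
  ring

end HasDecay

end

section

variable {n : ℕ}

/-! ### The mass integrals of cutoff sequences on an end -/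

/-- The exterior of a closed ball. -/
abbrev exterior (n : ℕ) (R : ℝ) : Set (Euc n) := (Metric.closedBall 0 R)ᶜ

theorem isOpen_exterior (R : ℝ) : IsOpen (exterior n R) := Metric.isClosed_closedBall.isOpen_compl

theorem mem_exterior {R : ℝ} {y : Euc n} : y ∈ exterior n R ↔ R < ‖y‖ := by simp

/-- Sequences of cutoff functions on an end. -/
structure IsEndCutoff (R : ℝ) (χ : ℕ → Euc n → ℝ) : Prop where
  lipschitz : ∀ α, LocallyLipschitzOn (exterior n R) (χ α)
  support : ∀ α, ∃ ρ, ∀ y ∈ exterior n R, ρ < ‖y‖ → χ α y = 0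
  bounded : ∃ C, ∀ α, ∀ᵐ y ∂volume.restrict (exterior n R),
    |χ α y| ≤ C ∧ ∀ j, ‖y‖ * |pd j (χ α) y| ≤ C
  eventually_one : ∀ᵐ y ∂volume.restrict (exterior n R),
    ∀ᶠ α in atTop, χ α y = 1 ∧ ∀ j, pd j (χ α) y = 0

theorem tendsto_integral_mul_of_bounded {X : Type*} [MeasurableSpace X] {ν : Measure X} {f : X → ℝ}
    (hf : Integrable f ν) {b : ℕ → X → ℝ} {b₀ : X → ℝ} {C : ℝ}
    (hm : ∀ α, AEStronglyMeasurable (b α) ν) (hb : ∀ α, ∀ᵐ y ∂ν, |b α y| ≤ C)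
    (ht : ∀ᵐ y ∂ν, Tendsto (fun α => b α y) atTop (𝓝 (b₀ y))) :
    Tendsto (fun α => ∫ y, f y * b α y ∂ν) atTop (𝓝 (∫ y, f y * b₀ y ∂ν)) := by
  refine tendsto_integral_of_dominated_convergence (fun y => |f y| * C)
    (fun α => hf.1.mul (hm α)) (hf.abs.mul_const C) (fun α => ?_) ?_
  · filter_upwards [hb α] with y hy
    rw [norm_mul, Real.norm_eq_abs, Real.norm_eq_abs]
    exact mul_le_mul_of_nonneg_left hy (abs_nonneg _)
  · filter_upwards [ht] with y hy
    exact hy.const_mul _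

theorem integrable_mul_of_bounded_support {ν : Measure (Euc n)} [IsFiniteMeasureOnCompacts ν]
    {f g : Euc n → ℝ} (hf : MemLp f 2 ν) (hg : MemLp g ⊤ ν) {ρ : ℝ}
    (h0 : ∀ᵐ y ∂ν, ρ < ‖y‖ → g y = 0) : Integrable (fun y => f y * g y) ν := by
  have hc := isCompact_closedBall (0 : Euc n) ρ
  have h1 : MemLp ((Metric.closedBall (0 : Euc n) ρ).indicator g) 2 ν := by
    rw [memLp_indicator_iff_restrict hc.measurableSet]
    have : IsFiniteMeasure (ν.restrict (Metric.closedBall (0 : Euc n) ρ)) :=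
      ⟨by simpa using hc.measure_lt_top⟩
    exact (hg.restrict _).mono_exponent le_top
  refine (hf.integrable_mul h1).congr ?_
  filter_upwards [h0] with y hy
  by_cases hyb : y ∈ Metric.closedBall (0 : Euc n) ρ
  · simp only [Pi.mul_apply, indicator_of_mem hyb]
  · simp only [Pi.mul_apply, indicator_of_notMem hyb]
    rw [hy (by simpa using hyb)]

theorem exists_smooth_transition {R : ℝ} (hR : 1 ≤ R) : ∃ ψ : Euc n → ℝ, ContDiff ℝ ∞ ψ ∧
    (∀ y, ψ y ∈ Icc (0 : ℝ) 1) ∧ (∀ y, ‖y‖ < R + 1 → ψ y = 0) ∧ ∀ y, R + 2 < ‖y‖ → ψ y = 1 := by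
  let f : ContDiffBump (0 : Euc n) := ⟨R + 1, R + 2, by linarith, by linarith⟩
  refine ⟨fun y => 1 - f y, contDiff_const.sub f.contDiff, fun y => ⟨?_, ?_⟩, fun y hy => ?_,
    fun y hy => ?_⟩
  · have := f.le_one (x := y); linarith
  · have := f.nonneg' y; linarith
  · change 1 - f y = 0
    rw [f.one_of_mem_closedBall (by simpa [f] using hy.le), sub_self]
  · change 1 - f y = 1
    rw [f.zero_of_le_dist (by simpa [f] using hy.le), sub_zero]

/-- Along cutoff sequences, the mass integrals converge to a limit independent of the sequence. -/
theorem exists_tendsto_mass {R : ℝ} (hR : 1 ≤ R) {E L : Fin n → Fin n → Euc n → ℝ}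
    (hN : ∀ i j, Integrable (fun y => E i j y - L i j y) (volume.restrict (exterior n R)))
    (hL : ∀ i j, MemLp (L i j) 2 (volume.restrict (exterior n R)))
    (htr : Integrable (fun y => ∑ i, L i i y) (volume.restrict (exterior n R)))
    (hdiv : ∀ i η, IsTest (exterior n R) η → ∑ j, ∫ y, L i j y * pd j η y = 0) :
    ∃ ℓ : ℝ, ∀ χ : ℕ → Euc n → ℝ, IsEndCutoff R χ →
      (∀ α, Integrable (fun y => ∑ i, ∑ j, E i j y * (y i * pd j (χ α) y))
        (volume.restrict (exterior n R))) ∧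
      Tendsto (fun α => ∫ y in exterior n R, ∑ i, ∑ j, E i j y * (y i * pd j (χ α) y)) atTop
        (𝓝 ℓ) := by
  have hΩ := isOpen_exterior (n := n) R
  set Ω := exterior n R with hΩd
  set ν := (volume : Measure (Euc n)).restrict Ω with hν
  have hmem : ∀ᵐ y ∂ν, y ∈ Ω := ae_restrict_mem hΩ.measurableSet
  -- The divergence identity holds only for functions supported away from the inner sphere, while
  -- the cutoffs need not vanish there; `ψ` removes a bounded collar.
  obtain ⟨ψ, hψ, hψ01, hψ0, hψ1⟩ := exists_smooth_transition (n := n) hR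
  have hcoord : ∀ i, ContDiff ℝ ∞ fun y : Euc n => y i := fun i => by fun_prop
  have hpdψ0 : ∀ j y, R + 2 < ‖y‖ → pd j ψ y = 0 := by
    intro j y hy
    have : ψ =ᶠ[𝓝 y] fun _ => 1 := by
      filter_upwards [(isOpen_lt continuous_const continuous_norm).mem_nhds hy] with z hz
      exact hψ1 z hz
    simp [pd, this.fderiv_eq]
  have hpdψ1 : ∀ j y, ‖y‖ < R + 1 → pd j ψ y = 0 := by
    intro j y hy
    have : ψ =ᶠ[𝓝 y] fun _ => 0 := by
      filter_upwards [(isOpen_lt continuous_norm continuous_const).mem_nhds hy] with z hz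
      exact hψ0 z hz
    simp [pd, this.fderiv_eq]
  have hcoord_le : ∀ (y : Euc n) i, |y i| ≤ ‖y‖ := fun y i => by
    simpa using PiLp.norm_apply_le y i
  have hψ_top : MemLp ψ ⊤ ν := memLp_top_of_bound hψ.continuous.aestronglyMeasurable 1
    (ae_of_all _ fun y => by rw [Real.norm_of_nonneg (hψ01 y).1]; exact (hψ01 y).2)
  have hψ_top' : MemLp (fun y => 1 - ψ y) ⊤ ν :=
    memLp_top_of_bound (continuous_const.sub hψ.continuous).aestronglyMeasurable 1
      (ae_of_all _ fun y => by
        rw [Real.norm_of_nonneg (by linarith [(hψ01 y).2])]; linarith [(hψ01 y).1])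
  have hd_top : ∀ i j, MemLp (fun y : Euc n => y i * pd j ψ y) ⊤ ν := by
    intro i j
    have hc : Continuous fun y : Euc n => y i * pd j ψ y :=
      (hcoord i).continuous.mul (pd_continuous hψ j)
    have hcs : HasCompactSupport fun y : Euc n => y i * pd j ψ y :=
      HasCompactSupport.intro (isCompact_closedBall (0 : Euc n) (R + 2)) fun y hy => by
        rw [hpdψ0 j y (by simpa using hy), mul_zero]
    obtain ⟨C, hC⟩ := hc.bounded_above_of_compact_support hcs
    exact memLp_top_of_bound hc.aestronglyMeasurable C (ae_of_all _ hC)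
  have hLd : ∀ i j, Integrable (fun y => L i j y * (y i * pd j ψ y)) ν := fun i j =>
    integrable_mul_of_bounded_support (hL i j) (hd_top i j) (ρ := R + 2)
      (ae_of_all _ fun y hy => by rw [hpdψ0 j y hy, mul_zero])
  have hLψ : ∀ i j, Integrable (fun y => L i j y * (1 - ψ y)) ν := fun i j =>
    integrable_mul_of_bounded_support (hL i j) hψ_top' (ρ := R + 2)
      (ae_of_all _ fun y hy => by rw [hψ1 y hy, sub_self])
  have htrψ : Integrable (fun y => ψ y * ∑ i, L i i y) ν := integrable_bdd_mul hψ_top htr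
  -- The value comes from setting `χ = 1` in the integration by parts `hparts` below.
  refine ⟨-(∫ y, ψ y * ∑ i, L i i y ∂ν) - ∑ i, ∑ j, ∫ y, L i j y * (y i * pd j ψ y) ∂ν,
    fun χ hχ => ?_⟩
  obtain ⟨C, hC⟩ := hχ.bounded
  have hχm : ∀ α, AEStronglyMeasurable (χ α) ν := fun α =>
    (hχ.lipschitz α).continuousOn.aestronglyMeasurable hΩ.measurableSet
  have hbm : ∀ α i j, AEStronglyMeasurable (fun y : Euc n => y i * pd j (χ α) y) ν := fun α i j =>
    (hcoord i).continuous.aestronglyMeasurable.mul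
      (measurable_fderiv_apply_const ℝ (χ α) _).aestronglyMeasurable
  have hbC : ∀ α i j, ∀ᵐ y ∂ν, |y i * pd j (χ α) y| ≤ C := by
    intro α i j
    filter_upwards [hC α] with y hy
    rw [abs_mul]
    exact (mul_le_mul_of_nonneg_right (hcoord_le y i) (abs_nonneg _)).trans (hy.2 j)
  have hb_top : ∀ α i j, MemLp (fun y : Euc n => y i * pd j (χ α) y) ⊤ ν := fun α i j =>
    memLp_top_of_bound (hbm α i j) C (hbC α i j)
  have hχ_top : ∀ α, MemLp (χ α) ⊤ ν := fun α => memLp_top_of_bound (hχm α) C (by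
    filter_upwards [hC α] with y hy using hy.1)
  choose ρ hρ using hχ.support
  have hpdχ0 : ∀ α j, ∀ y ∈ Ω, ρ α < ‖y‖ → pd j (χ α) y = 0 := by
    intro α j y hy hyρ
    have : χ α =ᶠ[𝓝 y] fun _ => 0 := by
      filter_upwards [(isOpen_lt continuous_const continuous_norm).mem_nhds hyρ,
        hΩ.mem_nhds hy] with z hz hzΩ
      exact hρ α z hzΩ hz
    simp [pd, this.fderiv_eq]
  have i1 : ∀ α i j, Integrable (fun y => (E i j y - L i j y) * (y i * pd j (χ α) y)) ν :=
    fun α i j => by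
      simpa only [mul_comm] using integrable_bdd_mul (hb_top α i j) (hN i j)
  have i2 : ∀ α i j, Integrable (fun y => L i j y * (1 - ψ y) * (y i * pd j (χ α) y)) ν :=
    fun α i j => by
      simpa only [mul_comm] using integrable_bdd_mul (hb_top α i j) (hLψ i j)
  have i3 : ∀ α i j, Integrable (fun y => L i j y * (ψ y * (y i * pd j (χ α) y))) ν :=
    fun α i j => integrable_mul_of_bounded_support (hL i j) ((hb_top α i j).mul hψ_top) (ρ := ρ α)
      (by filter_upwards [hmem] with y hy hyρ; rw [hpdχ0 α j y hy hyρ]; simp)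
  have i4 : ∀ α i j, Integrable (fun y => L i j y * (ψ y * χ α y)) ν :=
    fun α i j => integrable_mul_of_bounded_support (hL i j) ((hχ_top α).mul hψ_top) (ρ := ρ α)
      (by filter_upwards [hmem] with y hy hyρ; rw [hρ α y hy hyρ]; simp)
  have i5 : ∀ α i j, Integrable (fun y => L i j y * (y i * pd j ψ y) * χ α y) ν :=
    fun α i j => by
      simpa only [mul_comm] using integrable_bdd_mul (hχ_top α) (hLd i j)
  -- Three pieces: the integrable error, the collar where `ψ ≠ 1`, and the main term. The first two
  -- vanish in the limit.
  have hsum : ∀ α y, ∑ i, ∑ j, E i j y * (y i * pd j (χ α) y) =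
      ∑ i, ∑ j, ((E i j y - L i j y) * (y i * pd j (χ α) y) +
        L i j y * (1 - ψ y) * (y i * pd j (χ α) y) + L i j y * (ψ y * (y i * pd j (χ α) y))) :=
    fun α y => Finset.sum_congr rfl fun i _ => Finset.sum_congr rfl fun j _ => by ring
  have hint : ∀ α, ∀ i ∈ Finset.univ, ∀ j ∈ Finset.univ,
      Integrable (fun y => (E i j y - L i j y) * (y i * pd j (χ α) y) +
        L i j y * (1 - ψ y) * (y i * pd j (χ α) y) + L i j y * (ψ y * (y i * pd j (χ α) y))) ν :=
    fun α i _ j _ => ((i1 α i j).add (i2 α i j)).add (i3 α i j)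
  -- For each `i`, the divergence identity for row `i` of `L` is tested with `y i * ψ * χ α`; the
  -- derivative of `y i` produces the trace.
  have hparts : ∀ α, ∑ i, ∑ j, ∫ y, L i j y * (ψ y * (y i * pd j (χ α) y)) ∂ν =
      -(∫ y, (ψ y * ∑ i, L i i y) * χ α y ∂ν) -
        ∑ i, ∑ j, ∫ y, L i j y * (y i * pd j ψ y) * χ α y ∂ν := by
    intro α
    have hi : ∀ i, ∑ j, ((∫ y, L i j y * (ψ y * χ α y) * (if j = i then 1 else 0) ∂ν) +
        (∫ y, L i j y * (y i * pd j ψ y) * χ α y ∂ν) +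
        ∫ y, L i j y * (ψ y * (y i * pd j (χ α) y)) ∂ν) = 0 := by
      intro i
      set a : Euc n → ℝ := fun y => y i * ψ y with ha
      have has : ContDiff ℝ ∞ a := (hcoord i).mul hψ
      have hpda : ∀ j y, pd j a y = (if j = i then 1 else 0) * ψ y + y i * pd j ψ y := by
        intro j y
        rw [ha, pd_mul ((hcoord i).differentiable (by simp) y) (hψ.differentiable (by simp) y)]
        congr 2
        have : fderiv ℝ (fun z : Euc n => z i) y = EuclideanSpace.proj i :=
          (EuclideanSpace.proj (𝕜 := ℝ) i).fderiv
        simp [pd, this, eq_comm]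
      have hw : ∀ j, IsWeakPartial Ω j (fun y => a y * χ α y)
          fun y => pd j a y * χ α y + a y * pd j (χ α) y := fun j =>
        (isWeakPartial_of_locallyLipschitzOn hΩ (hχ.lipschitz α) j).smooth_mul hΩ has.contDiffOn
      have bχ : BddLoc Ω (χ α) := .of_continuousOn (hχ.lipschitz α).continuousOn
      have bpχ := fun j => bddLoc_pd_of_locallyLipschitzOn hΩ (hχ.lipschitz α) j
      have ba : BddLoc Ω a := .of_continuousOn has.continuous.continuousOn
      have bpa : ∀ j, BddLoc Ω (pd j a) := fun j =>
        .of_continuousOn (pd_continuous has j).continuousOn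
      -- The test function lives in the shell between radius `R + 1`, below which `ψ` vanishes, and
      -- `ρ α`, beyond which `χ α` vanishes.
      have hK : IsCompact (Metric.closedBall (0 : Euc n) (ρ α) ∩ {y | R + 1 ≤ ‖y‖}) :=
        (isCompact_closedBall _ _).inter_right (isClosed_le continuous_const continuous_norm)
      have hKs : Metric.closedBall (0 : Euc n) (ρ α) ∩ {y | R + 1 ≤ ‖y‖} ⊆ Ω := fun y hy =>
        mem_exterior.2 (by have := hy.2; simp only [mem_ofPred_eq] at this; linarith)
      have hcase : ∀ y ∈ Ω \ (Metric.closedBall (0 : Euc n) (ρ α) ∩ {y | R + 1 ≤ ‖y‖}),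
          ρ α < ‖y‖ ∨ ‖y‖ < R + 1 := by
        rintro y ⟨-, hy⟩
        by_contra! hcon
        exact hy ⟨by simpa using hcon.1, hcon.2⟩
      have hmain := sum_integral_eq_zero_of_divergence_free hΩ
        (fun j K hK hc => (hL i j).mono_measure (Measure.restrict_mono hK le_rfl))
        (hdiv i) hw (ba.mul bχ).l2Loc
        (fun j => (((bpa j).mul bχ).add (ba.mul (bpχ j))).l2Loc) hK hKs
        (fun y hy => by
          rcases hcase y hy with h | h
          · rw [hρ α y hy.1 h, mul_zero]
          · simp only [ha]; rw [hψ0 y h]; simp)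
        (fun j y hy => by
          rcases hcase y hy with h | h
          · rw [hρ α y hy.1 h, hpdχ0 α j y hy.1 h, mul_zero, mul_zero, add_zero]
          · rw [hpda, hψ0 y h, hpdψ1 j y h]; simp [ha, hψ0 y h])
      refine Eq.trans (Finset.sum_congr rfl fun j _ => ?_) hmain
      have i6 : Integrable (fun y => L i j y * (ψ y * χ α y) * (if j = i then 1 else 0) +
          L i j y * (y i * pd j ψ y) * χ α y) ν := ((i4 α i j).mul_const _).add (i5 α i j)
      rw [← integral_add ((i4 α i j).mul_const _) (i5 α i j), ← integral_add i6 (i3 α i j)]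
      refine integral_congr_ae (ae_of_all _ fun y => ?_)
      simp only [hpda]
      simp only [ha]
      ring
    have hs := Finset.sum_congr (s₁ := Finset.univ) rfl fun i _ => hi i
    simp only [Finset.sum_add_distrib, Finset.sum_const_zero] at hs
    have hd : ∑ i, ∑ j, ∫ y, L i j y * (ψ y * χ α y) * (if j = i then 1 else 0) ∂ν =
        ∫ y, (ψ y * ∑ i, L i i y) * χ α y ∂ν := by
      have : ∀ i, ∑ j, ∫ y, L i j y * (ψ y * χ α y) * (if j = i then 1 else 0) ∂ν =
          ∫ y, L i i y * (ψ y * χ α y) ∂ν := by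
        intro i
        rw [Finset.sum_eq_single i (fun j _ hj => by simp [hj]) (by simp)]
        simp
      simp only [this]
      rw [← integral_finsetSum _ fun i _ => i4 α i i]
      congr 1; ext y
      rw [← Finset.sum_mul]; ring
    rw [hd] at hs
    linarith
  have hval : ∀ α, ∫ y, ∑ i, ∑ j, E i j y * (y i * pd j (χ α) y) ∂ν =
      ∑ i, ∑ j, ((∫ y, (E i j y - L i j y) * (y i * pd j (χ α) y) ∂ν) +
        ∫ y, L i j y * (1 - ψ y) * (y i * pd j (χ α) y) ∂ν) +
      (-(∫ y, (ψ y * ∑ i, L i i y) * χ α y ∂ν) -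
        ∑ i, ∑ j, ∫ y, L i j y * (y i * pd j ψ y) * χ α y ∂ν) := by
    intro α
    simp only [hsum]
    rw [integral_finsetSum _ fun i hi => integrable_finsetSum _ fun j hj => hint α i hi j hj,
      ← hparts, ← Finset.sum_add_distrib]
    refine Finset.sum_congr rfl fun i hi => ?_
    rw [integral_finsetSum _ fun j hj => hint α i hi j hj, ← Finset.sum_add_distrib]
    refine Finset.sum_congr rfl fun j _ => ?_
    have i6 : Integrable (fun y => (E i j y - L i j y) * (y i * pd j (χ α) y) +
        L i j y * (1 - ψ y) * (y i * pd j (χ α) y)) ν := (i1 α i j).add (i2 α i j)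
    rw [integral_add i6 (i3 α i j), integral_add (i1 α i j) (i2 α i j)]
  refine ⟨fun α => ?_, ?_⟩
  · simp only [hsum]
    exact integrable_finsetSum _ fun i hi => integrable_finsetSum _ fun j hj => hint α i hi j hj
  · simp only [hval]
    -- Dominated convergence throughout: factors with `∂χ` tend to zero and factors `χ` to one,
    -- almost everywhere and with uniform bounds.
    have lim0 : ∀ i j, ∀ᵐ y ∂ν, Tendsto (fun α => y i * pd j (χ α) y) atTop (𝓝 0) := by
      intro i j
      filter_upwards [hχ.eventually_one] with y hy
      refine tendsto_const_nhds.congr' ?_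
      filter_upwards [hy] with α hα
      rw [hα.2 j, mul_zero]
    have lim1 : ∀ᵐ y ∂ν, Tendsto (fun α => χ α y) atTop (𝓝 1) := by
      filter_upwards [hχ.eventually_one] with y hy
      refine tendsto_const_nhds.congr' ?_
      filter_upwards [hy] with α hα
      exact hα.1.symm
    have t1 : ∀ i j, Tendsto (fun α => ∫ y, (E i j y - L i j y) * (y i * pd j (χ α) y) ∂ν) atTop
        (𝓝 0) := fun i j => by
      simpa using tendsto_integral_mul_of_bounded (b₀ := fun _ => 0) (hN i j)
        (fun α => hbm α i j) (fun α => hbC α i j) (lim0 i j)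
    have t2 : ∀ i j, Tendsto (fun α => ∫ y, L i j y * (1 - ψ y) * (y i * pd j (χ α) y) ∂ν) atTop
        (𝓝 0) := fun i j => by
      simpa using tendsto_integral_mul_of_bounded (b₀ := fun _ => 0) (hLψ i j)
        (fun α => hbm α i j) (fun α => hbC α i j) (lim0 i j)
    have hχC : ∀ α, ∀ᵐ y ∂ν, |χ α y| ≤ C := fun α => by
      filter_upwards [hC α] with y hy using hy.1
    have t3 := tendsto_integral_mul_of_bounded (b₀ := fun _ => 1) htrψ hχm hχC lim1
    have t4 := fun i j => tendsto_integral_mul_of_bounded (b₀ := fun _ => 1) (hLd i j) hχm hχC lim1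
    have := (tendsto_finsetSum Finset.univ fun i _ => tendsto_finsetSum Finset.univ fun j _ =>
      (t1 i j).add (t2 i j)).add (t3.neg.sub (tendsto_finsetSum Finset.univ fun i _ =>
        tendsto_finsetSum Finset.univ fun j _ => t4 i j))
    simpa using this

end

section

variable {n : ℕ} {M : Type*} [TopologicalSpace M] [ChartedSpace (EuclideanSpace ℝ (Fin n)) M]
  [IsManifold (𝓡 n) ∞ M] {P : ReferenceManifold n M}
  {φ ψ : OpenPartialHomeomorph M (EuclideanSpace ℝ (Fin n))}

/-! ### The chart at infinity -/

theorem chartDifferential_coordVec_self (hφ : φ ∈ IsManifold.maximalAtlas (𝓡 n) ∞ M) {y : Euc n}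
    (hy : y ∈ φ.target) (i : Fin n) :
    chartDifferential φ (φ.symm y) (coordVec φ y i) = stdVec i :=
  congrArg (fun L : Euc n →L[ℝ] Euc n => L (stdVec i))
    ((mdifferentiable_of_mem_maximalAtlas hφ).comp_symm_deriv hy)

namespace BackgroundStructure

variable (B : BackgroundStructure P) {y : Euc n}

theorem symm_notMem_K (hy : y ∈ P.Φ.target) : P.Φ.symm y ∉ P.K := by
  have := P.Φ.map_target hy
  rwa [P.source_Φ] at this

theorem r_symm (hy : y ∈ P.Φ.target) : B.r (P.Φ.symm y) = ‖y‖ := by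
  rw [B.r_eq _ (symm_notMem_K hy), P.Φ.right_inv hy]

theorem norm_gt (hy : y ∈ P.Φ.target) : P.R < ‖y‖ := by
  rw [P.target_Φ] at hy
  simpa using hy

theorem coordMatrix_h (hy : y ∈ P.Φ.target) : coordMatrix P.Φ B.h.inner y = 1 := by
  ext i j
  have := B.isometry_Φ (P.Φ.symm y) (symm_notMem_K hy) (coordVec P.Φ y i) (coordVec P.Φ y j)
  rw [chartDifferential_coordVec_self P.Φ_mem hy, chartDifferential_coordVec_self P.Φ_mem hy] at this
  refine this.trans ?_
  simp [Matrix.one_apply, EuclideanSpace.inner_single_left]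

theorem smoothChristoffel_h (hy : y ∈ P.Φ.target) (k i j : Fin n) :
    smoothChristoffel P.Φ B.h y k i j = 0 := by
  have h1 : ∀ b c, fderiv ℝ (fun z => coordMatrix P.Φ B.h.inner z b c) y = 0 := by
    intro b c
    have : (fun z => coordMatrix P.Φ B.h.inner z b c) =ᶠ[𝓝 y]
        fun _ => (1 : Matrix (Fin n) (Fin n) ℝ) b c := by
      filter_upwards [P.Φ.open_target.mem_nhds hy] with z hz
      rw [B.coordMatrix_h hz]
    rw [this.fderiv_eq]
    simp
  simp [smoothChristoffel, christoffel, h1]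

theorem density_h (hy : y ∈ P.Φ.target) : density P.Φ B.h y = 1 := by
  rw [density, B.coordMatrix_h hy, Matrix.det_one, Real.sqrt_one]

variable [MeasurableSpace M] [BorelSpace M]

theorem withDensity_density : ((volume.restrict P.Φ.target).withDensity fun y =>
    ENNReal.ofReal (density P.Φ B.h y)) = volume.restrict P.Φ.target := by
  have : (fun y => ENNReal.ofReal (density P.Φ B.h y)) =ᵐ[volume.restrict P.Φ.target] 1 := by
    filter_upwards [ae_restrict_mem P.Φ.open_target.measurableSet] with y hy
    rw [B.density_h hy]
    simp
  rw [withDensity_congr_ae this, withDensity_one]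

theorem map_restrict : (B.μ.restrict P.Φ.source).map P.Φ = volume.restrict P.Φ.target :=
  (map_restrict_source P.Φ_mem B.h).trans B.withDensity_density

variable {B}

theorem memLp_symm {f : M → ℝ} {p : ENNReal} (hf : MemLp f p B.μ) :
    MemLp (fun y => f (P.Φ.symm y)) p (volume.restrict P.Φ.target) := by
  have h1 : MemLp f p (chartMeasure P.Φ B.h) := hf.mono_measure (chartMeasure_le P.Φ_mem _)
  have h2 := (memLp_map_measure_iff h1.1 (aemeasurable_chart_symm_withDensity _)).1 h1
  rw [B.withDensity_density] at h2
  exact h2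

theorem memLp_coordComp {p : ENNReal} {τ : ℝ} {m : ℕ} {T : TensorField n M m}
    (hT : MemWeightedLp B p τ T) (I : Fin m → Fin n) :
    MemLp (fun y => ‖y‖ ^ (τ - n / p.toReal) * coordComp P.Φ T I y) p
      (volume.restrict P.Φ.target) := by
  have hm := P.Φ.open_target.measurableSet
  refine (memLp_symm hT.2).mono ?_ ?_
  · exact ((measurable_norm.pow_const _).aestronglyMeasurable).mul (hT.1 _ P.Φ_mem I)
  · filter_upwards [ae_restrict_mem hm] with y hy
    have h1 := abs_coordComp_le (φ := P.Φ) B.h T I y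
    simp only [B.coordMatrix_h hy, Matrix.one_apply_eq, Real.sqrt_one, Finset.prod_const_one,
      mul_one] at h1
    have h2 : 0 ≤ tensorNorm B.h T (P.Φ.symm y) := Real.sqrt_nonneg _
    rw [B.r_symm hy, norm_mul, norm_mul, Real.norm_of_nonneg h2]
    exact mul_le_mul_of_nonneg_left h1 (norm_nonneg _)

/-- Integration of functions vanishing on the compact part. -/
theorem integrable_of_end {f : M → ℝ} (hK : ∀ᵐ x ∂B.μ, x ∈ P.K → f x = 0)
    (hf : Integrable (fun y => f (P.Φ.symm y)) (volume.restrict P.Φ.target)) :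
    Integrable f B.μ ∧ ∫ x, f x ∂B.μ = ∫ y in P.Φ.target, f (P.Φ.symm y) := by
  have hms := P.Φ.open_source.measurableSet
  have hΦ : AEMeasurable P.Φ (B.μ.restrict P.Φ.source) :=
    P.Φ.continuousOn.aemeasurable hms
  have hcomp : (fun x => f (P.Φ.symm (P.Φ x))) =ᵐ[B.μ.restrict P.Φ.source] f := by
    filter_upwards [ae_restrict_mem hms] with x hx
    rw [P.Φ.left_inv hx]
  rw [← B.map_restrict] at hf ⊢
  have h1 : IntegrableOn f P.Φ.source B.μ :=
    ((integrable_map_measure hf.1 hΦ).1 hf).congr hcomp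
  have hae : P.Φ.source.indicator f =ᵐ[B.μ] f := by
    filter_upwards [hK] with x hx
    by_cases hxs : x ∈ P.Φ.source
    · rw [indicator_of_mem hxs]
    · rw [indicator_of_notMem hxs, hx (by simpa [P.source_Φ] using hxs)]
  refine ⟨((integrable_indicator_iff hms).2 h1).congr hae, ?_⟩
  rw [← integral_congr_ae hae, integral_indicator hms, integral_map hΦ hf.1]
  exact (integral_congr_ae hcomp).symm

end BackgroundStructure

/-! ### The metric and its Ricci tensor on the end -/

variable [MeasurableSpace M] [BorelSpace M] {B : BackgroundStructure P} {g : RoughMetric n M}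
  {T₁ : TensorField n M 3} {T₂ : TensorField n M 4}

open BackgroundStructure

/-- The components of a tensor of order three in the chart at infinity. -/
def endDeriv (P : ReferenceManifold n M) (T : TensorField n M 3) (k : Fin n) (y : Euc n) :
    Matrix (Fin n) (Fin n) ℝ := Matrix.of fun i j => coordComp P.Φ T ![k, i, j] y

/-- The components of a tensor of order four in the chart at infinity. -/
def endDeriv₂ (P : ReferenceManifold n M) (T : TensorField n M 4) (c k : Fin n) (y : Euc n) :
    Matrix (Fin n) (Fin n) ℝ := Matrix.of fun i j => coordComp P.Φ T ![c, k, i, j] y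

/-- On the end `h` is Euclidean: its symbols vanish, so covariant derivatives are partial
derivatives, and the constant `δ` contributes nothing. -/
theorem HasErrorData.isWeakPartial_end {τ : ℝ} (hT : HasErrorData B τ g T₁ T₂) (k i j : Fin n) :
    IsWeakPartial P.Φ.target k (fun y => coordMatrix P.Φ g.inner y i j)
      fun y => endDeriv P T₁ k y i j := by
  have hΩ := P.Φ.open_target
  have h1 := (hT.cov_one.isWeakPartial_two P.Φ_mem k i j).add (.of_contDiffOn hΩ
    (contDiffOn_const (c := (1 : Matrix (Fin n) (Fin n) ℝ) i j)))
  refine h1.congr hΩ ?_ ?_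
  · filter_upwards [ae_restrict_mem hΩ.measurableSet] with y hy
    rw [coordComp_toTensor, ← B.coordMatrix_h hy]
    exact sub_add_cancel _ _
  · filter_upwards [ae_restrict_mem hΩ.measurableSet] with y hy
    simp [B.smoothChristoffel_h hy, endDeriv, pd]

theorem HasErrorData.isWeakPartial_end₂ {τ : ℝ} (hT : HasErrorData B τ g T₁ T₂)
    (c k i j : Fin n) : IsWeakPartial P.Φ.target c (fun y => endDeriv P T₁ k y i j)
      fun y => endDeriv₂ P T₂ c k y i j := by
  have hΩ := P.Φ.open_target
  refine (hT.cov_two.isWeakPartial_three P.Φ_mem c k i j).congr hΩ (EventuallyEq.refl _ _) ?_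
  filter_upwards [ae_restrict_mem hΩ.measurableSet] with y hy
  simp [B.smoothChristoffel_h hy, endDeriv₂]

theorem HasErrorData.hasDecay {k : ℕ} {p : ENNReal} {τ : ℝ}
    (hT : HasErrorData B (((n : ℝ) - 2) / 2) g T₁ T₂) (hg : IsAsymptoticallyEuclidean B k p τ g) :
    HasDecay (volume.restrict P.Φ.target) (coordMatrix P.Φ g.inner) (endDeriv P T₁)
      (endDeriv₂ P T₂) where
  norm_ne := by
    filter_upwards [ae_restrict_mem P.Φ.open_target.measurableSet] with y hy
    have := norm_gt hy
    linarith [P.one_le_R]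
  bdd i j := by
    have := memLp_coordComp hg.metric_bounded ![i, j]
    simpa [coordComp_toTensor] using this
  coercive := by
    obtain ⟨C, hC, h⟩ := hg.ae_chart_le
    refine ⟨C⁻¹, by positivity, ?_⟩
    filter_upwards [h _ P.Φ_mem, ae_restrict_mem P.Φ.open_target.measurableSet] with y hy hyt ξ
    have := (hy ξ).1
    rwa [B.coordMatrix_h hyt, Matrix.one_mulVec] at this
  decay_zero i j := by
    have := memLp_coordComp hT.mem_zero ![i, j]
    -- The exponent of the weight is `τ + l - n/2 = l - 1` for the derivative of order `l`, here `l
    -- = 0`; hence the weights `-1`, `0`, `1`.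
    rw [show ((n : ℝ) - 2) / 2 - n / (2 : ENNReal).toReal = -1 by norm_num; ring] at this
    refine this.ae_eq ?_
    filter_upwards [ae_restrict_mem P.Φ.open_target.measurableSet] with y hy
    rw [Real.rpow_neg_one, coordComp_toTensor, ← B.coordMatrix_h hy]
    rfl
  decay_one k i j := by
    have := memLp_coordComp hT.mem_one ![k, i, j]
    rw [show ((n : ℝ) - 2) / 2 + 1 - n / (2 : ENNReal).toReal = 0 by norm_num; ring] at this
    simp only [Real.rpow_zero, one_mul] at this
    exact this
  decay_two c k i j := by
    have := memLp_coordComp hT.mem_two ![c, k, i, j]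
    rw [show ((n : ℝ) - 2) / 2 + 2 - n / (2 : ENNReal).toReal = 1 by norm_num; ring] at this
    simp only [Real.rpow_one] at this
    exact this

/-- The definition of the Ricci tensor only asserts that some weak derivatives exist; uniqueness
identifies them with those supplied by the error term. -/
theorem IsRicciTensor.ae_eq_ricciForm {k : ℕ} {p : ENNReal} {τ τ' : ℝ} {Ric : BilinField n M}
    (hR : IsRicciTensor g Ric) (hT : HasErrorData B τ g T₁ T₂)
    (hg : IsAsymptoticallyEuclidean B k p τ' g) (i j : Fin n) :
    ∀ᵐ y ∂volume.restrict P.Φ.target, coordMatrix P.Φ Ric y i j =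
      ricciForm (christoffel (coordMatrix P.Φ g.inner y) fun a => endDeriv P T₁ a y)
        (christoffelDeriv (coordMatrix P.Φ g.inner y)⁻¹ (fun a => endDeriv P T₁ a y)
          fun c a => endDeriv₂ P T₂ c a y) i j := by
  have hΩ := P.Φ.open_target
  obtain ⟨dG, dΓ, h1, h2, h3⟩ := hR P.Φ P.Φ_mem
  have hw := hasWeakCurvature_of_l2Loc hΩ (hg.bddLoc_coordMatrix P.Φ_mem)
    (hg.locCoercive P.Φ_mem) hT.isWeakPartial_end hT.isWeakPartial_end₂
    (fun k i j K hK hc => hT.mem_one.memLp_coordComp P.Φ_mem ![k, i, j] hK hc)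
    (fun c k i j K hK hc => hT.mem_two.memLp_coordComp P.Φ_mem ![c, k, i, j] hK hc)
  have e1 : ∀ᵐ y ∂volume.restrict P.Φ.target, ∀ a, dG a y = endDeriv P T₁ a y := by
    have : ∀ a i j, ∀ᵐ y ∂volume.restrict P.Φ.target, dG a y i j = endDeriv P T₁ a y i j :=
      fun a i j => (h1 a i j).ae_unique hΩ (hw.metric a i j) (EventuallyEq.refl _ _)
    simp only [← ae_all_iff] at this
    filter_upwards [this] with y hy a
    ext i j
    exact hy a i j
  have e2 : ∀ᵐ y ∂volume.restrict P.Φ.target, ∀ c k i j, dΓ c k i j y =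
      christoffelDeriv (coordMatrix P.Φ g.inner y)⁻¹ (fun a => endDeriv P T₁ a y)
        (fun c a => endDeriv₂ P T₂ c a y) c k i j := by
    simp only [ae_all_iff]
    intro c k i j
    refine (h2 c k i j).ae_unique hΩ (hw.connection c k i j) ?_
    filter_upwards [e1] with y hy
    simp only [hy]
  filter_upwards [h3 i j, e1, e2] with y hy hy1 hy2
  rw [hy]
  simp only [ricciForm, hy1, hy2]

end

/-! ### The mass limit on the end -/

section

variable {n : ℕ} {M : Type*} [TopologicalSpace M] [ChartedSpace (EuclideanSpace ℝ (Fin n)) M]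
  [IsManifold (𝓡 n) ∞ M] {P : ReferenceManifold n M} [MeasurableSpace M] [BorelSpace M]
  {B : BackgroundStructure P} {g : RoughMetric n M}

open BackgroundStructure

theorem scalarCurvature_symm {φ : OpenPartialHomeomorph M (EuclideanSpace ℝ (Fin n))}
    (hφ : φ ∈ IsManifold.maximalAtlas (𝓡 n) ∞ M) {y : Euc n} (hy : y ∈ φ.target) :
    scalarCurvature g (φ.symm y) =
      ∑ i, ∑ j, (coordMatrix φ g.inner y)⁻¹ i j * coordMatrix φ (ricciTensor g) y i j :=
  sum_gram_inv_mul hφ g (ricciTensor g) hy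

theorem coordMatrix_einsteinTensor {φ : OpenPartialHomeomorph M (EuclideanSpace ℝ (Fin n))}
    (y : Euc n) (i j : Fin n) : coordMatrix φ (einsteinTensor g) y i j =
      coordMatrix φ (ricciTensor g) y i j -
        scalarCurvature g (φ.symm y) / 2 * coordMatrix φ g.inner y i j := rfl

/-- On the end, the mass integrals of an asymptotically Euclidean metric with integrable scalar
curvature converge to a limit independent of the cutoff functions. -/
theorem IsAsymptoticallyEuclidean.exists_tendsto_mass_end
    (hg : IsAsymptoticallyEuclidean B 2 2 (((n : ℝ) - 2) / 2) g)
    (hRic : IsRicciTensor g (ricciTensor g)) (hScal : Integrable (scalarCurvature g) B.μ) :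
    ∃ ℓ : ℝ, ∀ χ : ℕ → Euc n → ℝ, IsEndCutoff P.R χ →
      (∀ α, Integrable (fun y => ∑ i, ∑ j, coordMatrix P.Φ (einsteinTensor g) y i j *
        (y i * pd j (χ α) y)) (volume.restrict P.Φ.target)) ∧
      Tendsto (fun α => ∫ y in P.Φ.target, ∑ i, ∑ j, coordMatrix P.Φ (einsteinTensor g) y i j *
        (y i * pd j (χ α) y)) atTop (𝓝 ℓ) := by
  obtain ⟨T₁, T₂, hT⟩ := hg.error_mem.exists_hasErrorData
  have hd := hT.hasDecay hg
  have hm := P.Φ.open_target.measurableSet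
  have hR : ∀ i j, Integrable (fun y => coordMatrix P.Φ (ricciTensor g) y i j -
      linRicci (fun c k => endDeriv₂ P T₂ c k y) i j) (volume.restrict P.Φ.target) := fun i j =>
    (hd.integrable_ricciForm_sub i j).congr (by
      filter_upwards [hRic.ae_eq_ricciForm hT hg i j] with y hy
      rw [hy])
  have hS : Integrable (fun y => ∑ i, ∑ j, (coordMatrix P.Φ g.inner y)⁻¹ i j *
      coordMatrix P.Φ (ricciTensor g) y i j) (volume.restrict P.Φ.target) := by
    refine (memLp_one_iff_integrable.1 (memLp_symm (memLp_one_iff_integrable.2 hScal))).congr ?_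
    filter_upwards [ae_restrict_mem hm] with y hy
    exact scalarCurvature_symm P.Φ_mem hy
  -- The weight `‖y‖` can be dropped, because `‖y‖ ≥ 1` on the end.
  have hL : ∀ i j, MemLp (fun y => linEinstein (fun c k => endDeriv₂ P T₂ c k y) i j) 2
      (volume.restrict P.Φ.target) := by
    intro i j
    have h1 : MemLp (fun y : Euc n => ‖y‖⁻¹) ⊤ (volume.restrict P.Φ.target) := by
      refine memLp_top_of_bound measurable_norm.inv.aestronglyMeasurable 1 ?_
      filter_upwards [ae_restrict_mem hm] with y hy
      rw [norm_inv, norm_norm]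
      exact inv_le_one_of_one_le₀ (P.one_le_R.trans (norm_gt hy).le)
    refine ((hd.memLp_mul_linEinstein i j).mul h1).ae_eq ?_
    filter_upwards [hd.norm_ne] with y hy
    simp only [Pi.mul_apply]
    field_simp
  have htr : Integrable (fun y => ∑ i, linEinstein (fun c k => endDeriv₂ P T₂ c k y) i i)
      (volume.restrict P.Φ.target) := by
    simp only [sum_linEinstein]
    exact (hd.integrable_linScal hR hS).const_mul _
  have hN : ∀ i j, Integrable (fun y => coordMatrix P.Φ (einsteinTensor g) y i j -
      linEinstein (fun c k => endDeriv₂ P T₂ c k y) i j) (volume.restrict P.Φ.target) := by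
    intro i j
    refine (hd.integrable_einstein_sub hR hS i j).congr ?_
    filter_upwards [ae_restrict_mem hm] with y hy
    rw [coordMatrix_einsteinTensor, scalarCurvature_symm P.Φ_mem hy]
  have hdiv : ∀ i η, IsTest P.Φ.target η →
      ∑ j, ∫ y, linEinstein (fun c k => endDeriv₂ P T₂ c k y) i j * pd j η y = 0 := fun i η hη =>
    linEinstein_divergence_free hT.isWeakPartial_end hT.isWeakPartial_end₂ hη i
  rw [P.target_Φ] at hL htr hN hdiv ⊢
  exact exists_tendsto_mass P.one_le_R hN hL htr hdiv

end

section

variable {n : ℕ} {M : Type*} [TopologicalSpace M] [ChartedSpace (EuclideanSpace ℝ (Fin n)) M]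
  {φ : OpenPartialHomeomorph M (EuclideanSpace ℝ (Fin n))} {y : Euc n} {f : M → ℝ}

/-! ### Differentials and gradients in charts -/

/-- The differential, as a linear form on the model space. -/
def differentialE (f : M → ℝ) (x : M) : Euc n →L[ℝ] ℝ := differential f x

/-- Charts preserve and reflect differentiability, so the chain rule survives at points where `f` is
not differentiable: both sides are then zero by convention. This allows Lipschitz `f`. -/
theorem differentialE_comp_symm (hφ : φ ∈ IsManifold.maximalAtlas (𝓡 n) ∞ M) (f : M → ℝ)
    (hy : y ∈ φ.target) :
    (differentialE f (φ.symm y)).comp (mfderiv (𝓡 n) (𝓡 n) φ.symm y : Euc n →L[ℝ] Euc n) =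
      fderiv ℝ (f ∘ φ.symm) y := by
  have hmd := mdifferentiable_of_mem_maximalAtlas hφ
  by_cases hf : MDifferentiableAt (𝓡 n) 𝓘(ℝ, ℝ) f (φ.symm y)
  · rw [← mfderiv_eq_fderiv]
    exact (mfderiv_comp y hf (hmd.mdifferentiableAt_symm hy)).symm
  · have h0 : differentialE f (φ.symm y) = 0 := mfderiv_zero_of_not_mdifferentiableAt hf
    suffices hnd : ¬DifferentiableAt ℝ (f ∘ φ.symm) y by
      rw [h0, fderiv_zero_of_not_differentiableAt hnd]
      rfl
    refine fun hd => hf ?_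
    have h1 : MDifferentiableAt (𝓡 n) 𝓘(ℝ, ℝ) ((f ∘ φ.symm) ∘ φ) (φ.symm y) := by
      refine MDifferentiableAt.comp (I' := 𝓡 n) _ ?_ (hmd.mdifferentiableAt (φ.map_target hy))
      rw [φ.right_inv hy]
      exact hd.mdifferentiableAt
    refine h1.congr_of_eventuallyEq ?_
    filter_upwards [φ.open_source.mem_nhds (φ.map_target hy)] with x hx
    simp [φ.left_inv hx]

theorem differentialE_coordVecE (hφ : φ ∈ IsManifold.maximalAtlas (𝓡 n) ∞ M) (f : M → ℝ)
    (hy : y ∈ φ.target) (j : Fin n) :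
    differentialE f (φ.symm y) (coordVecE φ y j) = pd j (f ∘ φ.symm) y :=
  congrArg (fun L : Euc n →L[ℝ] ℝ => L (stdVec j)) (differentialE_comp_symm hφ f hy)

theorem exists_eq_sum_coordVecE (hφ : φ ∈ IsManifold.maximalAtlas (𝓡 n) ∞ M) (hy : y ∈ φ.target)
    (v : Euc n) : ∃ w : Fin n → ℝ, v = ∑ i, w i • coordVecE φ y i := by
  set L : Euc n →L[ℝ] Euc n := mfderiv (𝓡 n) (𝓡 n) φ.symm y with hL
  have hinj : Function.Injective (L : Euc n →ₗ[ℝ] Euc n) := coordVec_injective hφ hy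
  obtain ⟨w, hw⟩ := LinearMap.injective_iff_surjective.1 hinj v
  refine ⟨w, ?_⟩
  have h2 : L w = ∑ i, w i • coordVecE φ y i := by
    conv_lhs => rw [← sum_stdVec w]
    simp only [map_sum, map_smul]
    rfl
  exact hw.symm.trans h2

/-- A nonzero gradient would have positive square length `df(Df)`, while `df` vanishes on all
coordinate vectors, which span. -/
theorem gradE_eq_zero (hφ : φ ∈ IsManifold.maximalAtlas (𝓡 n) ∞ M) (h : RoughMetric n M)
    (hy : y ∈ φ.target) (hf : fderiv ℝ (f ∘ φ.symm) y = 0) : gradE h f (φ.symm y) = 0 := by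
  by_contra hne
  refine (formAt_pos h (φ.symm y) hne).ne' ?_
  obtain ⟨w, hw⟩ := exists_eq_sum_coordVecE hφ hy (gradE h f (φ.symm y))
  rw [gradient_inner]
  change differentialE f (φ.symm y) _ = 0
  rw [hw, map_sum]
  refine Finset.sum_eq_zero fun i _ => ?_
  rw [map_smul, differentialE_coordVecE hφ f hy, pd, hf]
  simp

variable [IsManifold (𝓡 n) ∞ M] {P : ReferenceManifold n M} {B : BackgroundStructure P}

open BackgroundStructure

theorem formAt_h_coordVecE (hy : y ∈ P.Φ.target) (i j : Fin n) :
    formAt B.h.inner (P.Φ.symm y) (coordVecE P.Φ y i) (coordVecE P.Φ y j) =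
      (1 : Matrix (Fin n) (Fin n) ℝ) i j := by
  rw [← coordMatrix_apply, B.coordMatrix_h hy]

theorem gradE_end (hy : y ∈ P.Φ.target) (f : M → ℝ) :
    gradE B.h f (P.Φ.symm y) = ∑ i, pd i (f ∘ P.Φ.symm) y • coordVecE P.Φ y i := by
  obtain ⟨w, hw⟩ := exists_eq_sum_coordVecE P.Φ_mem hy (gradE B.h f (P.Φ.symm y))
  rw [hw]
  refine Finset.sum_congr rfl fun j _ => ?_
  rw [← differentialE_coordVecE P.Φ_mem f hy j]
  have := gradient_inner B.h f (P.Φ.symm y) (coordVecE P.Φ y j)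
  rw [hw] at this
  simp only [map_sum, map_smul, sum_apply, smul_apply, formAt_h_coordVecE hy, smul_eq_mul,
    Matrix.one_apply, mul_ite, mul_one, mul_zero, Finset.sum_ite_eq', Finset.mem_univ,
    if_true] at this
  rw [this]
  rfl

theorem formAt_gradE_end (hy : y ∈ P.Φ.target) (f : M → ℝ) :
    formAt B.h.inner (P.Φ.symm y) (gradE B.h f (P.Φ.symm y)) (gradE B.h f (P.Φ.symm y)) =
      ∑ i, pd i (f ∘ P.Φ.symm) y ^ 2 := by
  rw [gradient_inner]
  change differentialE f (P.Φ.symm y) _ = _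
  rw [gradE_end hy, map_sum]
  refine Finset.sum_congr rfl fun i _ => ?_
  rw [map_smul, differentialE_coordVecE P.Φ_mem f hy, smul_eq_mul, sq]

/-- Differentiate the square of the norm in two ways. -/
theorem norm_mul_pd_norm (hy : y ≠ 0) (i : Fin n) : ‖y‖ * pd i (fun z => ‖z‖) y = y i := by
  have hd : DifferentiableAt ℝ (fun z : Euc n => ‖z‖) y := differentiableAt_id.norm ℝ hy
  have h1 := pd_mul (i := i) hd hd
  have h2 : pd i (fun z : Euc n => ‖z‖ * ‖z‖) y = 2 * y i := by
    simp only [← sq, pd, fderiv_norm_sq_apply]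
    simp [EuclideanSpace.inner_single_right]
  linarith

/-- On the end `r = |y|`, and `|y|` times its Euclidean gradient is the position field. -/
theorem r_smul_gradE_r (hy : y ∈ P.Φ.target) :
    B.r (P.Φ.symm y) • gradE B.h B.r (P.Φ.symm y) = ∑ i, y i • coordVecE P.Φ y i := by
  have hy0 : y ≠ 0 := norm_pos_iff.1 (by linarith [norm_gt hy, P.one_le_R])
  have hev : B.r ∘ P.Φ.symm =ᶠ[𝓝 y] fun z => ‖z‖ := by
    filter_upwards [P.Φ.open_target.mem_nhds hy] with z hz
    exact B.r_symm hz
  rw [gradE_end hy, B.r_symm hy, Finset.smul_sum]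
  refine Finset.sum_congr rfl fun i _ => ?_
  rw [smul_smul, ← norm_mul_pd_norm hy0 i, pd, hev.fderiv_eq]
  rfl

theorem ricciMassIntegrand_end (g : RoughMetric n M) (χ : M → ℝ) (hy : y ∈ P.Φ.target) :
    ricciMassIntegrand B g χ (P.Φ.symm y) =
      -∑ i, ∑ j, coordMatrix P.Φ (einsteinTensor g) y i j *
        (y i * pd j (χ ∘ P.Φ.symm) y) := by
  have h1 : ricciMassIntegrand B g χ (P.Φ.symm y) =
      formAt (einsteinTensor g) (P.Φ.symm y) (B.r (P.Φ.symm y) • gradE B.h B.r (P.Φ.symm y))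
        (-gradE B.h χ (P.Φ.symm y)) := rfl
  rw [h1, r_smul_gradE_r hy, gradE_end hy, map_neg]
  simp only [map_sum, map_smul, sum_apply, smul_apply, smul_eq_mul, coordMatrix_apply,
    Finset.mul_sum]
  rw [Finset.sum_comm]
  congr 1
  exact Finset.sum_congr rfl fun i _ => Finset.sum_congr rfl fun j _ => by ring

/-! ### Cutoff sequences seen on the end -/

variable [MeasurableSpace M] [BorelSpace M] {χ : ℕ → M → ℝ}

theorem IsCutoffSequence.isEndCutoff (hχ : IsCutoffSequence B χ) :
    IsEndCutoff P.R fun α => χ α ∘ P.Φ.symm where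
  lipschitz α := by
    have := hχ.locallyLipschitz α P.Φ P.Φ_mem
    rwa [P.target_Φ] at this
  support α := by
    -- The continuous function `r` is bounded on the compact support, and `r = |y|` on the end.
    obtain ⟨ρ, hρ⟩ := (hχ.compactSupport α).bddAbove_image B.contMDiff_r.continuous.continuousOn
    refine ⟨ρ, fun y hy hyρ =>
      image_eq_zero_of_notMem_tsupport (f := χ α) fun hmem => ?_⟩
    have hy' : y ∈ P.Φ.target := by rwa [P.target_Φ]
    have := hρ (mem_image_of_mem B.r hmem)
    rw [B.r_symm hy'] at this
    exact absurd hyρ this.not_gt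
  bounded := by
    obtain ⟨C, hC⟩ := hχ.bounded
    refine ⟨C, fun α => ?_⟩
    rw [exterior, ← P.target_Φ]
    filter_upwards [ae_chart_of_ae P.Φ_mem B.smoothMetric (hC α),
      ae_restrict_mem P.Φ.open_target.measurableSet] with y hy hyt
    have h1 : |χ α (P.Φ.symm y)| + B.r (P.Φ.symm y) * Real.sqrt (formAt B.h.inner (P.Φ.symm y)
      (gradE B.h (χ α) (P.Φ.symm y)) (gradE B.h (χ α) (P.Φ.symm y))) ≤ C := hy
    rw [formAt_gradE_end hyt, B.r_symm hyt] at h1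
    have h2 : 0 ≤ ‖y‖ * Real.sqrt (∑ i, pd i (χ α ∘ P.Φ.symm) y ^ 2) := by positivity
    refine ⟨le_trans (le_add_of_nonneg_right h2) h1, fun j => ?_⟩
    refine le_trans ?_ ((le_add_of_nonneg_left (abs_nonneg _)).trans h1)
    refine mul_le_mul_of_nonneg_left (Real.abs_le_sqrt ?_) (norm_nonneg _)
    exact Finset.single_le_sum (f := fun i => pd i (χ α ∘ P.Φ.symm) y ^ 2)
      (fun i _ => sq_nonneg _) (Finset.mem_univ j)
  eventually_one := by
    rw [exterior, ← P.target_Φ]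
    -- The set where `χ α = 1` need not be a neighbourhood of its points, so vanishing of the
    -- gradient there is only an almost everywhere statement.
    have h1 : ∀ᵐ y ∂volume.restrict P.Φ.target, ∀ α, (χ α ∘ P.Φ.symm) y = 1 →
        fderiv ℝ (χ α ∘ P.Φ.symm) y = 0 := ae_all_iff.2 fun α =>
      fderiv_eq_zero_ae_of_level P.Φ.open_target
        (hχ.locallyLipschitz α P.Φ P.Φ_mem).continuousOn 1
    filter_upwards [h1] with y hy
    obtain ⟨α₀, hα₀⟩ := mem_iUnion.1 (hχ.exhaust ▸ mem_univ (P.Φ.symm y))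
    filter_upwards [eventually_ge_atTop α₀] with α hα
    have h2 : χ α (P.Φ.symm y) = 1 :=
      monotone_nat_of_le_succ (f := fun α => {x | χ α x = 1}) hχ.monotone_one hα hα₀
    refine ⟨h2, fun j => ?_⟩
    simp [pd, hy α h2]

/-- On `K` the cutoff equals one, perhaps only on `K`, which suffices for its gradient to vanish
almost everywhere there. All mass integrals therefore reduce to the end. -/
theorem IsCutoffSequence.ricciMassIntegrand_eq_zero [SecondCountableTopology M]
    (hχ : IsCutoffSequence B χ) (g : RoughMetric n M) (α : ℕ) :
    ∀ᵐ x ∂B.μ, x ∈ P.K → ricciMassIntegrand B g (χ α) x = 0 := by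
  refine ae_of_ae_charts B.h fun φ hφ => ?_
  filter_upwards [fderiv_eq_zero_ae_of_level φ.open_target
    (hχ.locallyLipschitz α φ hφ).continuousOn 1, ae_restrict_mem φ.open_target.measurableSet]
    with y hy hyt hyK
  have h1 : ricciMassIntegrand B g (χ α) (φ.symm y) =
      formAt (einsteinTensor g) (φ.symm y) (B.r (φ.symm y) • gradE B.h B.r (φ.symm y))
        (-gradE B.h (χ α) (φ.symm y)) := rfl
  rw [h1, gradE_eq_zero hφ B.h hyt (hy (hχ.subset_one α hyK)), neg_zero, map_zero]

theorem IsCutoffSequence.integral_ricciMassIntegrand [SecondCountableTopology M]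
    (hχ : IsCutoffSequence B χ) (g : RoughMetric n M) (α : ℕ)
    (hint : Integrable (fun y => ∑ i, ∑ j, coordMatrix P.Φ (einsteinTensor g) y i j *
      (y i * pd j (χ α ∘ P.Φ.symm) y)) (volume.restrict P.Φ.target)) :
    Integrable (ricciMassIntegrand B g (χ α)) B.μ ∧ ∫ x, ricciMassIntegrand B g (χ α) x ∂B.μ =
      -∫ y in P.Φ.target, ∑ i, ∑ j, coordMatrix P.Φ (einsteinTensor g) y i j *
        (y i * pd j (χ α ∘ P.Φ.symm) y) := by
  have hae : (fun y => -∑ i, ∑ j, coordMatrix P.Φ (einsteinTensor g) y i j *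
      (y i * pd j (χ α ∘ P.Φ.symm) y)) =ᵐ[volume.restrict P.Φ.target]
      fun y => ricciMassIntegrand B g (χ α) (P.Φ.symm y) := by
    filter_upwards [ae_restrict_mem P.Φ.open_target.measurableSet] with y hy
    exact (ricciMassIntegrand_end g (χ α) hy).symm
  obtain ⟨h1, h2⟩ := integrable_of_end (hχ.ricciMassIntegrand_eq_zero g α) (hint.neg.congr hae)
  exact ⟨h1, by rw [h2, ← integral_congr_ae hae, integral_neg]⟩

end

end

end AsympEuclid

/-! ### The theorem -/

theorem mainTheorem4 {n : ℕ} (hn : 3 ≤ n) {M : Type*} [TopologicalSpace M] [T2Space M]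
    [SecondCountableTopology M] [ChartedSpace (EuclideanSpace ℝ (Fin n)) M]
    [IsManifold (𝓡 n) ∞ M] [MeasurableSpace M] [BorelSpace M]
    (P : ReferenceManifold n M) (B : BackgroundStructure P) (g : RoughMetric n M)
    (hg : IsAsymptoticallyEuclidean B 2 2 (((n : ℝ) - 2) / 2) g)
    (hScal : Integrable (scalarCurvature g) B.μ) :
    IsRicciTensor g (ricciTensor g) ∧
    ∃ m : ℝ, ∀ χ : ℕ → M → ℝ, IsCutoffSequence B χ → HasRicciMass B g χ m := by
  refine ⟨hg.isRicciTensor, ?_⟩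
  obtain ⟨ℓ, hℓ⟩ := hg.exists_tendsto_mass_end hg.isRicciTensor hScal
  -- The sign of `ℓ` comes from `-Dχ` in the integrand, while `ℓ` was computed with `+∂χ`.
  refine ⟨-1 / (((n : ℝ) - 1) * ((n : ℝ) - 2) * sphereArea n) * -ℓ, fun χ hχ => ?_⟩
  obtain ⟨hint, hlim⟩ := hℓ _ hχ.isEndCutoff
  refine ⟨fun α => (hχ.integral_ricciMassIntegrand g α (hint α)).1, ?_⟩
  simp only [fun α => (hχ.integral_ricciMassIntegrand g α (hint α)).2]
  exact hlim.neg.const_mul _
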